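/- **Theorem 2.2.** Let $\ell\ge 1$ be an integer and let $0<\nu\le M<\ell\le 10$. Let $X=\{X(t):t\in\mathbb R\}$ be a stationary (real) Gaussian process with constant mean and covariance function $$\operatorname{Cov}\{X(x),X(y)\}=\tilde K(x-y)=\sum_{j=0}^{\lfloor\nu\rfloor}\beta_j|x-y|^{2j}+\beta^*_\nu G_\nu(|x-y|)+r(x,y)\qquad(x,y\in\mathbb R),$$ where $\beta_0,\dots,\beta_{\lfloor\nu\rfloor}$ and $\beta_\nu^*\neq0$ are constants, $r(x,y)=O(|x-y|^{2\nu+\tau})$ as $|x-y|\to0$ for some $\tau>0$ (in particular $r(x,x)=0$), $G_s(0)=0$, and, for $u>0$, $G_s(u)=u^{2s}$ if $s\notin\mathbb Z$ and $G_s(u)=u^{2s}\log u$ if $s\in\mathbb Z$. Assume that $\tilde K$ has a continuous derivative $\tilde K^{(2\ell)}$ of order $2\ell$ on an open interval containing $(0,1]$ and that, for some constant $C_\ell$, $|\tilde K^{(2\ell)}(t)|\le C_\ell\,t^{2\nu-2\ell}$ for all $t\in(0,1]$. Let $\varphi:\mathbb R\to\mathbb R$ be twice continuously differentiable with $\varphi(0)=0$,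 $\varphi(1)=1$ and $\min_{0\le s\le1}\varphi'(s)>0$. For $n\ge 2\ell+1$ put $t_i=t_{n,i}=\varphi((i-1)/(n-1))$ and $X_i=X(t_i)$, $1\le i\le n$. For $\theta\in\{1,2\}$ let $$a_{\theta,\ell;i,k}=\frac{\ell!}{\prod_{0\le j\le\ell,\,j\ne k}(t_{i+\theta k}-t_{i+\theta j})},\qquad V_{\theta,\ell}=\sum_{i=1}^{n-\theta\ell}\Big(\sum_{k=0}^{\ell}a_{\theta,\ell;i,k}X_{i+\theta k}\Big)^2,$$ $$f_{\theta,\ell}(s)=2\beta_s^*\sum_{i=1}^{n-\theta\ell}\ \sum_{0\le k_1<k_2\le\ell}a_{\theta,\ell;i,k_1}a_{\theta,\ell;i,k_2}\,G_s(t_{i+\theta k_2}-t_{i+\theta k_1})\qquad(0<s<\ell),$$ where the coefficients $\beta^*_s$, $0<s\le M$, are arbitrary non-zero real numbers (for $s=\nu$, the constant in the covariance function). Put $F_{\ell,n}(s)=f_{2,\ell}(s)/f_{1,\ell}(s)$ for $0<s\le M$, a quantity that does not depend on the $\beta_s^*$, and $F_{\ell,n}(0)=\lim_{\delta\to0+}f_{2,\ell}(\delta)/f_{1,\ell}(\delta)$.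 Let the estimator $\hat\nu_{a,\ell}=\hat\nu_{a,\ell}(n)\in[0,M]$, $n\ge2\ell+1$, be any minimiser, that is, $$\Big\{\frac{V_{1,\ell}F_{\ell,n}(\hat\nu_{a,\ell})}{V_{2,\ell}}-1\Big\}^2=\min_{0\le\nu^*\le M}\Big\{\frac{V_{1,\ell}F_{\ell,n}(\nu^*)}{V_{2,\ell}}-1\Big\}^2\quad\text{almost surely}.$$ Then $\hat\nu_{a,\ell}\to\nu$ almost surely as $n\to\infty$. -/

import Mathlib

open MeasureTheory ProbabilityTheory Filter Topology

noncomputable section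

namespace QuadVar

/-- The principal irregular function: `G_ν(0) = 0` and, for `s > 0`, `G_ν(s) = s ^ (2ν)` if `ν` is
not an integer and `G_ν(s) = s ^ (2ν) log s` if `ν` is an integer. -/
def G (ν s : ℝ) : ℝ :=
  open Classical in
  if s = 0 then 0
  else if ∃ m : ℤ, ν = m then s ^ (2 * ν) * Real.log s
  else s ^ (2 * ν)

/-- The covariance class: `K(x, y) = ∑_{j ≤ ⌊ν⌋} β_j |x - y|^(2j) + b G_ν(|x - y|) + r(x, y)` for all
real `x`, `y`, where `r(x, y) = O(|x - y|^(2ν + τ))` as `|x - y| → 0` for some `τ > 0`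
(the filter below contains the diagonal, so that `r(x, x) = 0`). -/
def HasCovarianceForm (K : ℝ → ℝ → ℝ) (ν b : ℝ) : Prop :=
  ∃ (β : ℕ → ℝ) (r : ℝ → ℝ → ℝ) (τ : ℝ), 0 < τ ∧
    (∀ x y : ℝ, K x y =
      ∑ j ∈ Finset.range (⌊ν⌋₊ + 1), β j * |x - y| ^ (2 * j) + b * G ν |x - y| + r x y) ∧
    (fun p : ℝ × ℝ => r p.1 p.2) =O[comap (fun p : ℝ × ℝ => |p.1 - p.2|) (𝓝 0)]
      (fun p : ℝ × ℝ => |p.1 - p.2| ^ (2 * ν + τ))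

/-- `X` is a stationary Gaussian process on the real line with covariance function
`(x, y) ↦ Kt (x - y)` (in dimension one, isotropy is the symmetry of the covariance). -/
structure IsStationaryGaussian {Ω : Type*} [MeasurableSpace Ω]
    (X : ℝ → Ω → ℝ) (P : Measure Ω) (Kt : ℝ → ℝ) : Prop where
  gaussian : IsGaussianProcess X P
  mean : ∃ μ : ℝ, ∀ x : ℝ, ∫ ω, X x ω ∂P = μ
  cov : ∀ x y : ℝ, covariance (X x) (X y) P = Kt (x - y)

/-- The design function: twice continuously differentiable with `φ 0 = 0`, `φ 1 = 1` and
positive derivative on `[0, 1]` (whose minimum is then positive by compactness). -/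
structure IsDesign (φ : ℝ → ℝ) : Prop where
  smooth : ContDiff ℝ 2 φ
  zero : φ 0 = 0
  one : φ 1 = 1
  deriv_pos : ∀ s ∈ Set.Icc (0 : ℝ) 1, 0 < deriv φ s

/-- The sites `t_{n,i} = φ((i - 1)/(n - 1))`, `i = 1, …, n`. -/
def site (φ : ℝ → ℝ) (n i : ℕ) : ℝ := φ (((i : ℝ) - 1) / ((n : ℝ) - 1))

/-- The weights `a_{θ,ℓ;i,k} = ℓ! / ∏_{0 ≤ j ≤ ℓ, j ≠ k} (t_{i+θk} - t_{i+θj})`. -/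
def a (φ : ℝ → ℝ) (n θ ℓ i k : ℕ) : ℝ :=
  (ℓ.factorial : ℝ) /
    ∏ j ∈ (Finset.range (ℓ + 1)).erase k, (site φ n (i + θ * k) - site φ n (i + θ * j))

/-- The generalised difference `∇_{θ,ℓ} X_i = ∑_{k=0}^{ℓ} a_{θ,ℓ;i,k} X_{i+θk}`
of a path `x : ℝ → ℝ`, where `X_i = x (t_{n,i})`. -/
def nabla (φ : ℝ → ℝ) (n θ ℓ : ℕ) (x : ℝ → ℝ) (i : ℕ) : ℝ :=
  ∑ k ∈ Finset.range (ℓ + 1), a φ n θ ℓ i k * x (site φ n (i + θ * k))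

/-- The `ℓ`th-order quadratic variation `V_{θ,ℓ} = ∑_{i=1}^{n-θℓ} (∇_{θ,ℓ} X_i)²`
of a path (meant for `n ≥ θℓ + 1`). -/
def V (φ : ℝ → ℝ) (n θ ℓ : ℕ) (x : ℝ → ℝ) : ℝ :=
  ∑ i ∈ Finset.Icc 1 (n - θ * ℓ), nabla φ n θ ℓ x i ^ 2

/-- `f_{θ,ℓ}(s) = 2 b_s ∑_{i=1}^{n-θℓ} ∑_{0 ≤ k₁ < k₂ ≤ ℓ} a_{θ,ℓ;i,k₁} a_{θ,ℓ;i,k₂}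
G_s(t_{i+θk₂} - t_{i+θk₁})`, where `s ↦ b_s` are the nuisance coefficients. -/
def f (φ : ℝ → ℝ) (n θ ℓ : ℕ) (b : ℝ → ℝ) (s : ℝ) : ℝ :=
  2 * b s * ∑ i ∈ Finset.Icc 1 (n - θ * ℓ),
    ∑ k₂ ∈ Finset.range (ℓ + 1), ∑ k₁ ∈ Finset.range k₂,
      a φ n θ ℓ i k₁ * a φ n θ ℓ i k₂ * G s (site φ n (i + θ * k₂) - site φ n (i + θ * k₁))

/-- `F_{ℓ,n}(s) = f_{2,ℓ}(s) / f_{1,ℓ}(s)` for `s > 0`, extended to `s = 0` by its limit from the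
right. As long as the coefficients `b_s` do not vanish, they cancel. -/
def F (φ : ℝ → ℝ) (n ℓ : ℕ) (b : ℝ → ℝ) (s : ℝ) : ℝ :=
  open Classical in
  if s = 0 then limUnder (𝓝[>] (0 : ℝ)) (fun δ : ℝ => f φ n 2 ℓ b δ / f φ n 1 ℓ b δ)
  else f φ n 2 ℓ b s / f φ n 1 ℓ b s

/-- The criterion `{V_{1,ℓ} F_{ℓ,n}(s) / V_{2,ℓ} - 1}²`, for the observed path `x`. -/
def criterion (φ : ℝ → ℝ) (n ℓ : ℕ) (b : ℝ → ℝ) (x : ℝ → ℝ) (s : ℝ) : ℝ :=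
  (V φ n 1 ℓ x * F φ n ℓ b s / V φ n 2 ℓ x - 1) ^ 2

/-- `est` is a value of the estimator: a point of `[0, M]` at which the criterion attains its
minimum over `[0, M]`. -/
def IsEstimate (φ : ℝ → ℝ) (n ℓ : ℕ) (b : ℝ → ℝ) (M : ℝ) (x : ℝ → ℝ) (est : ℝ) : Prop :=
  est ∈ Set.Icc 0 M ∧ IsMinOn (criterion φ n ℓ b x) (Set.Icc 0 M) est

end QuadVar

end

/-!
The estimator compares the observed ratio `V₂ / V₁` of the quadratic variations at the two scales
with the function `s ↦ F_{ℓ,n}(s)`. The theorem holds because `F_{ℓ,n}(s)` converges to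
`2 ^ (2s - 2ℓ)`, uniformly in `s ∈ [0, M]`, while `V₂ / V₁` converges almost surely to the value of
this strictly monotone function at `s = ν` (`tendsto_of_isEstimate`).

*The ratio `F`.* A generalised difference is `ℓ!` times a divided difference of order `ℓ`, and so
annihilates the polynomials of degree less than `ℓ`. For `0 < s < ℓ` the function `x ↦ G s |x|` is,
up to a nonzero constant factor and a polynomial in `x²` of degree less than `ℓ`, the regularised
Fourier transform of `|lam| ^ (-2s - 1)`; the double difference annihilates the polynomial. Hence
the double divided difference of `G s` at nodes `v` is a constant multiple of the integral of
`|∑ w_k exp (i lam v_k)|² lam ^ (-2s - 1)` over `lam > 0`, where `w_k` are the weights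
(`exists_spectralInt_eq`). The constant depends on `s` only and cancels in `F`. The integral is
positive, scales like `h ^ (2s - 2ℓ)` (`spectralInt_add_mul`) and depends continuously on the nodes,
uniformly in `s` (`exists_abs_spectralInt_div_sub_one_le`). The sites of a smooth design are locally
equidistant (`IsDesign.eventually_abs_div_step_sub_le`), and doubling the step multiplies every
summand by `2 ^ (2s - 2ℓ)` up to a relative error that vanishes uniformly
(`eventually_abs_F_sub_le`). As `s → 0+` the integral diverges like `1 / s`, so uniformity down to
`s = 0` is obtained for its ratio to the integral at equidistant nodes.

*The quadratic variations.* The same asymptotics describe the variances of the generalised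
differences of the process, because the even powers in the covariance are annihilated and the
remainder is of smaller order (`exists_eventually_abs_nablaCov_self_sub_le`). This gives
`E V₂ / E V₁ → 2 ^ (2ν - 2ℓ)`. The mean value theorem for divided differences and the bound on the
derivative of order `2ℓ` control the covariances of distant differences (`exists_abs_nablaCov_le`),
so that the row sums of the covariance matrix are smaller than its trace by a power of `n`
(`exists_rowSum_bound`). In principal axes a quadratic variation is a sum of squares of independent
centred normal variables whose variances are bounded by the row sums, and Chernoff's bound gives a
tail that is exponentially small in a power of `n` (`measureReal_abs_sum_sq_sub_ge_le`). The
Borel–Cantelli lemma then yields `V / E V → 1` almost surely.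
-/

noncomputable section

namespace QuadVar

/-! ### Divided differences -/

/-- The weights of the divided difference of order `ℓ` at the nodes `v 0, …, v ℓ`, multiplied by
`ℓ!`, so that `∑ k, ddWeight ℓ v k * g (v k)` approximates the `ℓ`-th derivative of `g`. -/
def ddWeight (ℓ : ℕ) (v : ℕ → ℝ) (k : ℕ) : ℝ :=
  (ℓ.factorial : ℝ) / ∏ j ∈ (Finset.range (ℓ + 1)).erase k, (v k - v j)

/-- Rolle's theorem for higher derivatives: a function with `n + 1` zeros has a zero of its `n`-th
derivative between them. -/
theorem exists_iteratedDeriv_eq_zero {U : Set ℝ} (hU : IsOpen U) (n : ℕ) (f : ℝ → ℝ) (v : ℕ → ℝ)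
    (hv : ∀ k < n, v k < v (k + 1)) (hvU : Set.Icc (v 0) (v n) ⊆ U) (hf : ContDiffOn ℝ n f U)
    (h0 : ∀ k ≤ n, f (v k) = 0) : ∃ ξ ∈ Set.Icc (v 0) (v n), iteratedDeriv n f ξ = 0 := by
  induction n generalizing f v with
  | zero => exact ⟨v 0, by simp, by simpa using h0 0 le_rfl⟩
  | succ n ih =>
    have hmono : MonotoneOn v (Set.Iic (n + 1)) := by
      refine (strictMonoOn_of_lt_succ Set.ordConnected_Iic ?_).monotoneOn
      intro a _ _ ha
      exact hv a (Nat.lt_of_succ_le ha)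
    have hsub : ∀ k ≤ n, Set.Icc (v k) (v (k + 1)) ⊆ Set.Icc (v 0) (v (n + 1)) := fun k hk =>
      Set.Icc_subset_Icc (hmono (by simp) (by simp; omega) (Nat.zero_le k))
        (hmono (by simp; omega) (by simp) (by omega))
    have key : ∀ k, ∃ y, k ≤ n → y ∈ Set.Ioo (v k) (v (k + 1)) ∧ deriv f y = 0 := by
      intro k
      by_cases hk : k ≤ n
      · obtain ⟨y, hy, hy'⟩ := exists_deriv_eq_zero (hv k (by omega))
          (hf.continuousOn.mono ((hsub k hk).trans hvU))
          ((h0 k (by omega)).trans (h0 (k + 1) (by omega)).symm)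
        exact ⟨y, fun _ => ⟨hy, hy'⟩⟩
      · exact ⟨0, fun h => absurd h hk⟩
    choose y hy using key
    have hsub' : Set.Icc (y 0) (y n) ⊆ Set.Icc (v 0) (v (n + 1)) :=
      Set.Icc_subset_Icc (hy 0 (by omega)).1.1.le (hy n le_rfl).1.2.le
    obtain ⟨ξ, hξ, hξ'⟩ := ih (deriv f) y
      (fun k hk => (hy k hk.le).1.2.trans (hy (k + 1) hk).1.1)
      (hsub'.trans hvU) (hf.deriv_of_isOpen hU (by norm_cast))
      (fun k hk => (hy k hk).2)
    exact ⟨ξ, hsub' hξ, by rw [iteratedDeriv_succ']; exact hξ'⟩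

/-- The mean value theorem for divided differences. It follows from Rolle's theorem for the
difference of `g` and its interpolation polynomial. -/
theorem exists_sum_ddWeight_eq {U : Set ℝ} (hU : IsOpen U) {ℓ : ℕ} {v : ℕ → ℝ}
    (hv : StrictMonoOn v (Set.Iic ℓ)) (hvU : Set.Icc (v 0) (v ℓ) ⊆ U) {g : ℝ → ℝ}
    (hg : ContDiffOn ℝ ℓ g U) :
    ∃ ξ ∈ Set.Icc (v 0) (v ℓ),
      ∑ k ∈ Finset.range (ℓ + 1), ddWeight ℓ v k * g (v k) = iteratedDeriv ℓ g ξ := by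
  have hinj : Set.InjOn v (Finset.range (ℓ + 1)) := by
    refine hv.injOn.mono ?_
    intro k hk
    simpa [Nat.lt_succ_iff] using hk
  set p := Lagrange.interpolate (Finset.range (ℓ + 1)) v (fun k => g (v k)) with hp
  have hdeg : p.degree < (Finset.range (ℓ + 1)).card := Lagrange.degree_interpolate_lt _ hinj
  have heval : ∀ k ∈ Finset.range (ℓ + 1), p.eval (v k) = g (v k) := fun k hk =>
    Lagrange.eval_interpolate_at_node _ hinj hk
  have hpd : ContDiff ℝ ℓ (fun x => p.eval x) := by
    simpa using p.contDiff_aeval (𝕜 := ℝ) ℓ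
  obtain ⟨ξ, hξ, hξ0⟩ := exists_iteratedDeriv_eq_zero hU ℓ (fun x => g x - p.eval x) v
    (fun k hk => hv (by simp; omega) (by simp; omega) (Nat.lt_succ_self k)) hvU
    (hg.sub hpd.contDiffOn)
    (fun k hk => by
      rw [heval k (by simp; omega), sub_self])
  refine ⟨ξ, hξ, ?_⟩
  have h1 : iteratedDeriv ℓ (fun x => g x - p.eval x) ξ
      = iteratedDeriv ℓ g ξ - iteratedDeriv ℓ (fun x => p.eval x) ξ :=
    iteratedDeriv_fun_sub (hg.contDiffAt (hU.mem_nhds (hvU hξ))) hpd.contDiffAt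
  have h2 : iteratedDeriv ℓ (fun x => p.eval x) ξ = (Polynomial.derivative^[ℓ] p).eval ξ := by
    rw [iteratedDeriv_eq_iterate]
    have : ∀ (m : ℕ) (q : Polynomial ℝ), deriv^[m] (fun x => q.eval x)
        = fun x => (Polynomial.derivative^[m] q).eval x := by
      intro m
      induction m with
      | zero => intro q; rfl
      | succ m ih =>
        intro q
        rw [Function.iterate_succ_apply, Function.iterate_succ_apply, ← ih]
        congr 1
        funext x
        exact q.deriv
    rw [this]
  rw [h1, h2, Lagrange.eval_iterate_derivative_eq_sum hinj hdeg (by simp)] at hξ0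
  have h3 : iteratedDeriv ℓ g ξ = _ := sub_eq_zero.mp hξ0
  rw [h3, Finset.mul_sum]
  refine Finset.sum_congr rfl fun k hk => ?_
  rw [heval k hk]
  simp [ddWeight]
  ring

/-- Divided differences of order `ℓ` annihilate the polynomials of degree less than `ℓ`. -/
theorem sum_ddWeight_mul_pow {ℓ : ℕ} {v : ℕ → ℝ} (hv : StrictMonoOn v (Set.Iic ℓ)) {p : ℕ}
    (hp : p < ℓ) : ∑ k ∈ Finset.range (ℓ + 1), ddWeight ℓ v k * v k ^ p = 0 := by
  obtain ⟨ξ, -, h⟩ := exists_sum_ddWeight_eq isOpen_univ hv (Set.subset_univ _)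
    (g := fun x => x ^ p) (contDiff_id.pow p).contDiffOn
  rw [h, iteratedDeriv_eq_iterate, iter_deriv_pow,
    Finset.prod_eq_zero (Finset.mem_range.mpr hp) (sub_self _), zero_mul]

/-- In the double divided difference of `(x - y) ^ (2 * p)` each monomial has degree less than `ℓ`
in one of the two variables. -/
theorem sum_sum_ddWeight_mul_sub_pow {ℓ : ℕ} {v : ℕ → ℝ} (hv : StrictMonoOn v (Set.Iic ℓ)) {p : ℕ}
    (hp : p < ℓ) : ∑ k ∈ Finset.range (ℓ + 1), ∑ j ∈ Finset.range (ℓ + 1),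
      ddWeight ℓ v k * ddWeight ℓ v j * (v k - v j) ^ (2 * p) = 0 := by
  have h1 : ∀ k j, ddWeight ℓ v k * ddWeight ℓ v j * (v k - v j) ^ (2 * p) =
      ∑ i ∈ Finset.range (2 * p + 1), ((2 * p).choose i * (-1) ^ (2 * p - i)) *
        ((ddWeight ℓ v k * v k ^ i) * (ddWeight ℓ v j * v j ^ (2 * p - i))) := by
    intro k j
    rw [sub_eq_add_neg, add_pow, Finset.mul_sum]
    refine Finset.sum_congr rfl fun i _ => ?_
    rw [neg_pow (v j)]
    ring
  simp_rw [h1]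
  rw [Finset.sum_congr rfl fun k _ => Finset.sum_comm, Finset.sum_comm]
  refine Finset.sum_eq_zero fun i hi => ?_
  simp_rw [← Finset.mul_sum]
  rw [← Finset.sum_mul]
  rcases lt_or_ge i ℓ with h | h
  · rw [sum_ddWeight_mul_pow hv h]; simp
  · rw [sum_ddWeight_mul_pow hv (p := 2 * p - i) (by omega)]; simp

theorem ddWeight_add_mul (ℓ : ℕ) (x : ℝ) {h : ℝ} (hh : h ≠ 0) (z : ℕ → ℝ) {k : ℕ} (hk : k ≤ ℓ) :
    ddWeight ℓ (fun j => x + h * z j) k = h⁻¹ ^ ℓ * ddWeight ℓ z k := by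
  unfold ddWeight
  have : ∀ j, x + h * z k - (x + h * z j) = h * (z k - z j) := fun j => by ring
  simp_rw [this]
  rw [Finset.prod_mul_distrib, Finset.prod_const, Finset.card_erase_of_mem (by simp; omega)]
  simp only [Finset.card_range, Nat.add_sub_cancel, inv_pow]
  field_simp

theorem ddWeight_ne_zero {ℓ : ℕ} {v : ℕ → ℝ} (hv : StrictMonoOn v (Set.Iic ℓ)) {k : ℕ}
    (hk : k ≤ ℓ) : ddWeight ℓ v k ≠ 0 := by
  unfold ddWeight
  refine div_ne_zero (by positivity) (Finset.prod_ne_zero_iff.mpr fun j hj => sub_ne_zero.mpr ?_)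
  intro h
  simp only [Finset.mem_erase, Finset.mem_range] at hj
  exact hj.1 (hv.injOn (by simpa using hk) (by simp; omega) h).symm

/-! ### Spectral energy of a divided difference -/

/-- The squared modulus `|∑ k, w k * exp (I * lam * v k)|²` of the symbol of the divided difference
of order `ℓ` at the nodes `v`, written as a double sum of cosines. -/
def energy (ℓ : ℕ) (v : ℕ → ℝ) (lam : ℝ) : ℝ :=
  ∑ k ∈ Finset.range (ℓ + 1), ∑ j ∈ Finset.range (ℓ + 1),
    ddWeight ℓ v k * ddWeight ℓ v j * Real.cos (lam * |v k - v j|)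

/-- The integral of the energy against the spectral density `lam ^ (-2 * s - 1)` of the irregular
function `G s`, up to a constant. -/
def spectralInt (ℓ : ℕ) (v : ℕ → ℝ) (s : ℝ) : ℝ :=
  ∫ lam in Set.Ioi (0 : ℝ), energy ℓ v lam * lam ^ (-2 * s - 1)

/-- The double divided difference of `(x, y) ↦ G s |x - y|`. -/
def doubleDiff (ℓ : ℕ) (v : ℕ → ℝ) (s : ℝ) : ℝ :=
  ∑ k ∈ Finset.range (ℓ + 1), ∑ j ∈ Finset.range (ℓ + 1),
    ddWeight ℓ v k * ddWeight ℓ v j * G s |v k - v j|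

theorem energy_eq_sq_add_sq (ℓ : ℕ) (v : ℕ → ℝ) (lam : ℝ) :
    energy ℓ v lam =
      (∑ k ∈ Finset.range (ℓ + 1), ddWeight ℓ v k * Real.cos (lam * v k)) ^ 2 +
      (∑ k ∈ Finset.range (ℓ + 1), ddWeight ℓ v k * Real.sin (lam * v k)) ^ 2 := by
  unfold energy
  rw [sq, sq, Finset.sum_mul_sum, Finset.sum_mul_sum, ← Finset.sum_add_distrib]
  refine Finset.sum_congr rfl fun k _ => ?_
  rw [← Finset.sum_add_distrib]
  refine Finset.sum_congr rfl fun j _ => ?_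
  have : Real.cos (lam * |v k - v j|) = Real.cos (lam * v k - lam * v j) := by
    rcases abs_cases (v k - v j) with h | h
    · rw [h.1, mul_sub]
    · rw [h.1, ← Real.cos_neg]; congr 1; ring
  rw [this, Real.cos_sub]
  ring

theorem energy_nonneg (ℓ : ℕ) (v : ℕ → ℝ) (lam : ℝ) : 0 ≤ energy ℓ v lam := by
  rw [energy_eq_sq_add_sq]; positivity

theorem continuous_energy (ℓ : ℕ) (v : ℕ → ℝ) : Continuous (energy ℓ v) := by
  unfold energy; fun_prop

theorem iteratedDeriv_cos_mul_add (lam c : ℝ) (n : ℕ) :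
    iteratedDeriv n (fun x => Real.cos (lam * x + c)) =
      fun x => lam ^ n * Real.cos (lam * x + c + n * (Real.pi / 2)) := by
  induction n with
  | zero => simp
  | succ n ih =>
    rw [iteratedDeriv_succ, ih]
    funext x
    have h : HasDerivAt (fun x => lam ^ n * Real.cos (lam * x + c + n * (Real.pi / 2)))
        (lam ^ n * (-Real.sin (lam * x + c + n * (Real.pi / 2)) * (lam * 1))) x :=
      (((((hasDerivAt_id x).const_mul lam).add_const c).add_const _).cos).const_mul _
    rw [h.deriv]
    have : lam * x + c + ((n + 1 : ℕ) : ℝ) * (Real.pi / 2)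
        = (lam * x + c + n * (Real.pi / 2)) + Real.pi / 2 := by push_cast; ring
    rw [this, Real.cos_add_pi_div_two]
    ring

theorem exists_sum_ddWeight_mul_cos {ℓ : ℕ} {v : ℕ → ℝ} (hv : StrictMonoOn v (Set.Iic ℓ))
    (lam c : ℝ) : ∃ ξ ∈ Set.Icc (v 0) (v ℓ),
      ∑ k ∈ Finset.range (ℓ + 1), ddWeight ℓ v k * Real.cos (lam * v k + c) =
        lam ^ ℓ * Real.cos (lam * ξ + c + ℓ * (Real.pi / 2)) := by
  obtain ⟨ξ, hξ, h⟩ := exists_sum_ddWeight_eq isOpen_univ hv (Set.subset_univ _)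
    (g := fun x => Real.cos (lam * x + c)) (by fun_prop)
  exact ⟨ξ, hξ, by rw [h, iteratedDeriv_cos_mul_add]⟩

/-- At low frequencies the energy is small, because a divided difference of order `ℓ` is bounded by
the `ℓ`-th derivative. The factor `2` accounts for the real and the imaginary part. -/
theorem energy_le_pow {ℓ : ℕ} {v : ℕ → ℝ} (hv : StrictMonoOn v (Set.Iic ℓ)) (lam : ℝ) :
    energy ℓ v lam ≤ 2 * lam ^ (2 * ℓ) := by
  rw [energy_eq_sq_add_sq]
  obtain ⟨ξ, -, h⟩ := exists_sum_ddWeight_mul_cos hv lam 0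
  obtain ⟨η, -, h'⟩ := exists_sum_ddWeight_mul_cos hv lam (-(Real.pi / 2))
  have e : ∀ x : ℝ, Real.cos (x + -(Real.pi / 2)) = Real.sin x := fun x => by
    rw [← sub_eq_add_neg, Real.cos_sub_pi_div_two]
  simp only [e, add_zero] at h h'
  rw [h, h', mul_pow, mul_pow, ← pow_mul, mul_comm ℓ 2]
  have h1 := Real.cos_sq_le_one (lam * ξ + ℓ * (Real.pi / 2))
  have h2 := Real.cos_sq_le_one (lam * η + -(Real.pi / 2) + ℓ * (Real.pi / 2))
  have h3 : 0 ≤ lam ^ (2 * ℓ) := by rw [pow_mul]; positivity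
  nlinarith

theorem energy_le_sum_sq (ℓ : ℕ) (v : ℕ → ℝ) (lam : ℝ) :
    energy ℓ v lam ≤ (∑ k ∈ Finset.range (ℓ + 1), |ddWeight ℓ v k|) ^ 2 := by
  unfold energy
  rw [sq, Finset.sum_mul_sum]
  refine Finset.sum_le_sum fun k _ => Finset.sum_le_sum fun j _ => ?_
  refine (le_abs_self _).trans ?_
  rw [abs_mul, abs_mul]
  exact mul_le_of_le_one_right (by positivity) (Real.abs_cos_le_one _)

/-- If the energy vanished at a low frequency, a suitably shifted cosine would have divided
difference `0`, although its `ℓ`-th derivative has no zero between the nodes. -/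
theorem exists_energy_pos {ℓ : ℕ} {v : ℕ → ℝ} (hv : StrictMonoOn v (Set.Iic ℓ)) :
    ∃ lam > 0, 0 < energy ℓ v lam := by
  have hle : v 0 ≤ v ℓ := hv.monotoneOn (by simp) (by simp) (Nat.zero_le _)
  set L := v ℓ - v 0 + 1 with hL
  have hLpos : 0 < L := by linarith
  refine ⟨L⁻¹, by positivity, lt_of_le_of_ne (energy_nonneg _ _ _) fun h0 => ?_⟩
  rw [energy_eq_sq_add_sq] at h0
  have hc : ∑ k ∈ Finset.range (ℓ + 1), ddWeight ℓ v k * Real.cos (L⁻¹ * v k) = 0 := by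
    nlinarith [sq_nonneg (∑ k ∈ Finset.range (ℓ + 1), ddWeight ℓ v k * Real.cos (L⁻¹ * v k)),
      sq_nonneg (∑ k ∈ Finset.range (ℓ + 1), ddWeight ℓ v k * Real.sin (L⁻¹ * v k))]
  have hs : ∑ k ∈ Finset.range (ℓ + 1), ddWeight ℓ v k * Real.sin (L⁻¹ * v k) = 0 := by
    nlinarith [sq_nonneg (∑ k ∈ Finset.range (ℓ + 1), ddWeight ℓ v k * Real.cos (L⁻¹ * v k)),
      sq_nonneg (∑ k ∈ Finset.range (ℓ + 1), ddWeight ℓ v k * Real.sin (L⁻¹ * v k))]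
  -- The phase is chosen so that the `ℓ`-th derivative of the cosine is a cosine near its maximum.
  set c := -(L⁻¹ * v 0) - ℓ * (Real.pi / 2) with hcdef
  obtain ⟨ξ, hξ, h⟩ := exists_sum_ddWeight_mul_cos hv L⁻¹ c
  have hz : ∑ k ∈ Finset.range (ℓ + 1), ddWeight ℓ v k * Real.cos (L⁻¹ * v k + c) = 0 := by
    have : ∀ k, ddWeight ℓ v k * Real.cos (L⁻¹ * v k + c) =
        Real.cos c * (ddWeight ℓ v k * Real.cos (L⁻¹ * v k)) -
        Real.sin c * (ddWeight ℓ v k * Real.sin (L⁻¹ * v k)) := fun k => by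
      rw [Real.cos_add]; ring
    simp_rw [this]
    rw [Finset.sum_sub_distrib, ← Finset.mul_sum, ← Finset.mul_sum, hc, hs]
    ring
  have harg : L⁻¹ * ξ + c + ℓ * (Real.pi / 2) = L⁻¹ * (ξ - v 0) := by rw [hcdef]; ring
  rw [hz, harg] at h
  have hb : L⁻¹ * (ξ - v 0) ≤ 1 := by
    rw [inv_mul_le_iff₀ hLpos]; linarith [hξ.2]
  have hb0 : 0 ≤ L⁻¹ * (ξ - v 0) := mul_nonneg (by positivity) (by linarith [hξ.1])
  have hpos : 0 < Real.cos (L⁻¹ * (ξ - v 0)) :=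
    Real.cos_pos_of_le_one (by rw [abs_of_nonneg hb0]; exact hb)
  have : 0 < L⁻¹ ^ ℓ * Real.cos (L⁻¹ * (ξ - v 0)) := by positivity
  linarith

/-! ### Integrals against power weights -/

theorem integrableOn_Ioi_of_rpow_bounds {f : ℝ → ℝ} {C a b : ℝ} (ha : -1 < a) (hb : b < -1)
    (hf : AEStronglyMeasurable f (volume.restrict (Set.Ioi 0)))
    (h0 : ∀ x, 0 < x → x ≤ 1 → |f x| ≤ C * x ^ a) (h1 : ∀ x, 1 < x → |f x| ≤ C * x ^ b) :
    IntegrableOn f (Set.Ioi 0) := by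
  rw [← Set.Ioc_union_Ioi_eq_Ioi (zero_le_one' ℝ)]
  refine IntegrableOn.union ?_ ?_
  · have h := (intervalIntegral.intervalIntegrable_rpow' (a := 0) (b := 1) ha).1.const_mul C
    refine h.mono' (hf.mono_set Set.Ioc_subset_Ioi_self) ?_
    filter_upwards [ae_restrict_mem measurableSet_Ioc] with x hx
    exact h0 x hx.1 hx.2
  · have h := (integrableOn_Ioi_rpow_of_lt hb zero_lt_one).const_mul C
    refine h.mono' (hf.mono_set (Set.Ioi_subset_Ioi zero_le_one)) ?_
    filter_upwards [ae_restrict_mem measurableSet_Ioi] with x hx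
    exact h1 x hx

theorem aestronglyMeasurable_mul_rpow {f : ℝ → ℝ} (hf : Measurable f) (t : ℝ) :
    AEStronglyMeasurable (fun x => f x * x ^ t) (volume.restrict (Set.Ioi 0)) :=
  (hf.mul (by fun_prop)).aestronglyMeasurable

/-- The envelope of the energies, times the spectral weight. -/
def envelope (ℓ : ℕ) (s lam : ℝ) : ℝ := min 1 (lam ^ (2 * ℓ)) * lam ^ (-2 * s - 1)

theorem envelope_of_le_one {ℓ : ℕ} {s x : ℝ} (h0 : 0 < x) (h1 : x ≤ 1) :
    envelope ℓ s x = x ^ (2 * (ℓ : ℝ) - 2 * s - 1) := by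
  unfold envelope
  rw [min_eq_right (pow_le_one₀ h0.le h1), ← Real.rpow_natCast, ← Real.rpow_add h0]
  congr 1
  push_cast
  ring

theorem envelope_of_one_lt {ℓ : ℕ} {s x : ℝ} (h1 : 1 < x) :
    envelope ℓ s x = x ^ (-2 * s - 1) := by
  unfold envelope
  rw [min_eq_left (one_le_pow₀ h1.le), one_mul]

theorem integrableOn_envelope {ℓ : ℕ} {s : ℝ} (h0 : 0 < s) (h1 : s < ℓ) :
    IntegrableOn (envelope ℓ s) (Set.Ioi 0) := by
  refine integrableOn_Ioi_of_rpow_bounds (C := 1) (a := 2 * (ℓ : ℝ) - 2 * s - 1)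
    (b := -2 * s - 1) (by linarith) (by linarith) ?_ ?_ ?_
  · exact aestronglyMeasurable_mul_rpow (by fun_prop) _
  · intro x hx hx1
    rw [envelope_of_le_one hx hx1, one_mul, abs_of_nonneg (by positivity)]
  · intro x hx
    have : 0 < x := by linarith
    rw [envelope_of_one_lt hx, one_mul, abs_of_nonneg (by positivity)]

theorem energy_mul_rpow_le_envelope {ℓ : ℕ} {v : ℕ → ℝ} (hv : StrictMonoOn v (Set.Iic ℓ)) {C : ℝ}
    (h2 : 2 ≤ C) (hC : (∑ k ∈ Finset.range (ℓ + 1), |ddWeight ℓ v k|) ^ 2 ≤ C) (s : ℝ) {lam : ℝ}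
    (hlam : 0 < lam) : energy ℓ v lam * lam ^ (-2 * s - 1) ≤ C * envelope ℓ s lam := by
  unfold envelope
  rw [← mul_assoc]
  refine mul_le_mul_of_nonneg_right ?_ (by positivity)
  rw [mul_min_of_nonneg _ _ (by linarith)]
  refine le_min ?_ ?_
  · rw [mul_one]; exact (energy_le_sum_sq _ _ _).trans hC
  · refine (energy_le_pow hv lam).trans (mul_le_mul_of_nonneg_right h2 (by positivity))

theorem integrableOn_energy {ℓ : ℕ} {v : ℕ → ℝ} (hv : StrictMonoOn v (Set.Iic ℓ)) {s : ℝ}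
    (h0 : 0 < s) (h1 : s < ℓ) :
    IntegrableOn (fun lam => energy ℓ v lam * lam ^ (-2 * s - 1)) (Set.Ioi 0) := by
  refine ((integrableOn_envelope h0 h1).const_mul
    (max 2 ((∑ k ∈ Finset.range (ℓ + 1), |ddWeight ℓ v k|) ^ 2))).mono'
    (aestronglyMeasurable_mul_rpow (continuous_energy ℓ v).measurable _) ?_
  filter_upwards [ae_restrict_mem measurableSet_Ioi] with x hx
  have hx' : 0 < x := hx
  rw [Real.norm_of_nonneg (mul_nonneg (energy_nonneg _ _ _) (by positivity))]
  exact energy_mul_rpow_le_envelope hv (le_max_left _ _) (le_max_right _ _) s hx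

theorem spectralInt_pos {ℓ : ℕ} {v : ℕ → ℝ} (hv : StrictMonoOn v (Set.Iic ℓ)) {s : ℝ}
    (h0 : 0 < s) (h1 : s < ℓ) : 0 < spectralInt ℓ v s := by
  unfold spectralInt
  rw [setIntegral_pos_iff_support_of_nonneg_ae _ (integrableOn_energy hv h0 h1)]
  · obtain ⟨lam, hlam, hpos⟩ := exists_energy_pos hv
    have hopen : IsOpen ({x | 0 < energy ℓ v x} ∩ Set.Ioi 0) :=
      (isOpen_lt continuous_const (continuous_energy ℓ v)).inter isOpen_Ioi
    refine lt_of_lt_of_le (hopen.measure_pos volume ⟨lam, hpos, hlam⟩)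
      (measure_mono ?_)
    rintro x ⟨hx, hx0⟩
    have hx0' : 0 < x := hx0
    have hx' : 0 < energy ℓ v x := hx
    exact ⟨(mul_pos hx' (by positivity)).ne', hx0⟩
  · filter_upwards [ae_restrict_mem measurableSet_Ioi] with x hx
    have hx' : 0 < x := hx
    exact mul_nonneg (energy_nonneg _ _ _) (by positivity)

theorem integral_comp_mul_mul_rpow (ψ : ℝ → ℝ) {a : ℝ} (ha : 0 < a) (s : ℝ) :
    ∫ x in Set.Ioi (0 : ℝ), ψ (x * a) * x ^ (-2 * s - 1) =
      a ^ (2 * s) * ∫ x in Set.Ioi (0 : ℝ), ψ x * x ^ (-2 * s - 1) := by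
  have h := integral_comp_mul_left_Ioi (fun x => ψ x * (x / a) ^ (-2 * s - 1)) 0 ha
  have e1 : ∀ x : ℝ, ψ (a * x) * (a * x / a) ^ (-2 * s - 1) = ψ (x * a) * x ^ (-2 * s - 1) := by
    intro x
    rw [mul_div_cancel_left₀ _ ha.ne', mul_comm a x]
  simp_rw [e1] at h
  rw [h, mul_zero, smul_eq_mul, ← integral_const_mul, ← integral_const_mul]
  refine setIntegral_congr_fun measurableSet_Ioi fun x hx => ?_
  have hx' : 0 < x := hx
  rw [Real.div_rpow hx'.le ha.le, Real.rpow_sub ha, Real.rpow_one,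
    show -2 * s = -(2 * s) by ring, Real.rpow_neg ha.le]
  have := Real.rpow_pos_of_pos ha (2 * s)
  field_simp

theorem integrableOn_comp_mul_mul_rpow {ψ : ℝ → ℝ} {a s : ℝ} (ha : 0 < a)
    (h : IntegrableOn (fun x => ψ x * x ^ (-2 * s - 1)) (Set.Ioi 0)) :
    IntegrableOn (fun x => ψ (x * a) * x ^ (-2 * s - 1)) (Set.Ioi 0) := by
  have h2 := (integrableOn_Ioi_comp_mul_right_iff
    (fun x => ψ x * x ^ (-2 * s - 1)) 0 ha).mpr (by simpa using h)
  have h3 : IntegrableOn (fun x => (a ^ (-2 * s - 1))⁻¹ *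
      (ψ (x * a) * (x * a) ^ (-2 * s - 1))) (Set.Ioi 0) := h2.const_mul _
  refine h3.congr_fun (fun x hx => ?_) measurableSet_Ioi
  have hx' : 0 < x := hx
  simp only
  rw [Real.mul_rpow hx'.le ha.le]
  have := Real.rpow_pos_of_pos ha (-2 * s - 1)
  field_simp

/-- The energy integral scales like the `2 * s - 2 * ℓ`-th power of the mesh. -/
theorem spectralInt_add_mul (ℓ : ℕ) (x : ℝ) {h : ℝ} (hh : 0 < h) (z : ℕ → ℝ) (s : ℝ) :
    spectralInt ℓ (fun k => x + h * z k) s = h ^ (2 * s - 2 * ℓ) * spectralInt ℓ z s := by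
  have he : ∀ lam, energy ℓ (fun k => x + h * z k) lam =
      h⁻¹ ^ (2 * ℓ) * energy ℓ z (lam * h) := by
    intro lam
    unfold energy
    rw [Finset.mul_sum]
    refine Finset.sum_congr rfl fun k hk => ?_
    rw [Finset.mul_sum]
    refine Finset.sum_congr rfl fun j hj => ?_
    rw [ddWeight_add_mul ℓ x hh.ne' z (by simp at hk; omega),
      ddWeight_add_mul ℓ x hh.ne' z (by simp at hj; omega)]
    have : x + h * z k - (x + h * z j) = h * (z k - z j) := by ring
    rw [this, abs_mul, abs_of_pos hh, ← mul_assoc lam]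
    ring
  unfold spectralInt
  simp_rw [he, mul_assoc]
  rw [integral_const_mul, integral_comp_mul_mul_rpow (energy ℓ z) hh s, ← mul_assoc]
  congr 1
  rw [Real.rpow_sub hh, inv_pow, ← Real.rpow_natCast]
  push_cast
  field_simp

/-! ### Spectral representation of the double divided differences of `G s` -/

/-- The remainder of the Taylor expansion of the cosine after `p` terms. -/
def cosRem (p : ℕ) (x : ℝ) : ℝ :=
  Real.cos x - ∑ j ∈ Finset.range p, (-1) ^ j * x ^ (2 * j) / ((2 * j).factorial : ℝ)

theorem continuous_cosRem (p : ℕ) : Continuous (cosRem p) := by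
  unfold cosRem; fun_prop

theorem cosRem_zero {p : ℕ} (hp : 1 ≤ p) : cosRem p 0 = 0 := by
  unfold cosRem
  obtain ⟨q, rfl⟩ : ∃ q, p = q + 1 := ⟨p - 1, by omega⟩
  rw [Finset.sum_range_succ']
  simp

theorem cosRem_succ (p : ℕ) (x : ℝ) :
    cosRem (p + 1) x = cosRem p x - (-1) ^ p / ((2 * p).factorial : ℝ) * x ^ (2 * p) := by
  unfold cosRem
  rw [Finset.sum_range_succ]
  ring

theorem abs_cosRem_le_of_le_one (p : ℕ) {x : ℝ} (h0 : 0 ≤ x) (h1 : x ≤ 1) :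
    |cosRem p x| ≤ Real.cosh 1 * x ^ (2 * p) := by
  have hs := (hasSum_nat_add_iff' p).mpr (Real.hasSum_cos x)
  have hc := (Real.hasSum_cosh 1).mul_right (x ^ (2 * p))
  refine hs.norm_le_of_bounded hc fun n => ?_
  rw [norm_div, norm_mul, norm_pow, norm_neg, norm_one, one_pow, one_mul, Real.norm_of_nonneg
    (by positivity), Real.norm_of_nonneg (by positivity), one_pow, div_mul_eq_mul_div, one_mul]
  refine div_le_div₀ (by positivity) ?_ (by positivity) ?_
  · exact pow_le_pow_of_le_one h0 h1 (by omega)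
  · exact_mod_cast Nat.factorial_le (by omega)

theorem abs_cosRem_le_of_one_le {p : ℕ} (hp : 1 ≤ p) {x : ℝ} (h1 : 1 ≤ x) :
    |cosRem p x| ≤ (p + 1) * x ^ (2 * p - 2) := by
  unfold cosRem
  refine (abs_sub _ _).trans ?_
  have hx : 1 ≤ x ^ (2 * p - 2) := one_le_pow₀ h1
  have h2 : |∑ j ∈ Finset.range p, (-1) ^ j * x ^ (2 * j) / ((2 * j).factorial : ℝ)| ≤
      ∑ j ∈ Finset.range p, x ^ (2 * p - 2) := by
    refine (Finset.abs_sum_le_sum_abs _ _).trans (Finset.sum_le_sum fun j hj => ?_)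
    rw [abs_div, abs_mul, abs_pow, abs_neg, abs_one, one_pow, one_mul,
      abs_of_nonneg (by positivity), abs_of_nonneg (by positivity)]
    refine (div_le_self (by positivity) ?_).trans (pow_le_pow_right₀ h1 ?_)
    · exact_mod_cast Nat.factorial_pos _
    · simp at hj; omega
  rw [Finset.sum_const, Finset.card_range, nsmul_eq_mul] at h2
  have := Real.abs_cos_le_one x
  linarith

theorem integrableOn_cosRem {p : ℕ} (hp : 1 ≤ p) {s : ℝ} (h0 : (p : ℝ) - 1 < s) (h1 : s < p) :
    IntegrableOn (fun x => cosRem p x * x ^ (-2 * s - 1)) (Set.Ioi 0) := by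
  refine integrableOn_Ioi_of_rpow_bounds (C := Real.cosh 1 + (p + 1))
    (a := 2 * (p : ℝ) - 2 * s - 1) (b := 2 * (p : ℝ) - 2 - 2 * s - 1) (by linarith) (by linarith)
    (aestronglyMeasurable_mul_rpow (continuous_cosRem p).measurable _) ?_ ?_
  · intro x hx hx1
    have h := abs_cosRem_le_of_le_one p hx.le hx1
    rw [abs_mul, abs_of_nonneg (by positivity : 0 ≤ x ^ (-2 * s - 1))]
    have e : x ^ (2 * (p : ℝ) - 2 * s - 1) = x ^ (2 * p) * x ^ (-2 * s - 1) := by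
      rw [← Real.rpow_natCast, ← Real.rpow_add hx]; congr 1; push_cast; ring
    rw [e, ← mul_assoc]
    gcongr
    refine h.trans ?_
    gcongr
    have : (0 : ℝ) ≤ p := by positivity
    linarith
  · intro x hx
    have hx0 : 0 < x := by linarith
    have h := abs_cosRem_le_of_one_le hp hx.le
    rw [abs_mul, abs_of_nonneg (by positivity : 0 ≤ x ^ (-2 * s - 1))]
    have e : x ^ (2 * (p : ℝ) - 2 - 2 * s - 1) = x ^ (2 * p - 2) * x ^ (-2 * s - 1) := by
      rw [← Real.rpow_natCast, ← Real.rpow_add hx0]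
      congr 1
      rw [Nat.cast_sub (by omega)]
      push_cast; ring
    rw [e, ← mul_assoc]
    gcongr
    have := (Real.cosh_pos 1).le
    exact h.trans (mul_le_mul_of_nonneg_right (by linarith) (by positivity))

/-- As divided differences annihilate low powers, the cosine in the energy may be replaced by a
Taylor remainder. -/
theorem energy_eq_sum_cosRem {ℓ : ℕ} {v : ℕ → ℝ} (hv : StrictMonoOn v (Set.Iic ℓ)) {p : ℕ}
    (hp : p ≤ ℓ) (lam : ℝ) : energy ℓ v lam =
      ∑ k ∈ Finset.range (ℓ + 1), ∑ j ∈ Finset.range (ℓ + 1),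
        ddWeight ℓ v k * ddWeight ℓ v j * cosRem p (lam * |v k - v j|) := by
  induction p with
  | zero => simp [energy, cosRem]
  | succ p ih =>
    rw [ih (by omega)]
    have h : ∀ k j, ddWeight ℓ v k * ddWeight ℓ v j * cosRem (p + 1) (lam * |v k - v j|) =
        ddWeight ℓ v k * ddWeight ℓ v j * cosRem p (lam * |v k - v j|) -
        (-1) ^ p / ((2 * p).factorial : ℝ) * lam ^ (2 * p) *
          (ddWeight ℓ v k * ddWeight ℓ v j * (v k - v j) ^ (2 * p)) := by
      intro k j
      rw [cosRem_succ, mul_pow, pow_mul |_|, sq_abs, ← pow_mul]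
      ring
    simp_rw [h, Finset.sum_sub_distrib, ← Finset.mul_sum]
    rw [sum_sum_ddWeight_mul_sub_pow hv (by omega)]
    ring

/-- If the energy is a combination of functions `χ |v k - v j|` whose weighted integrals are known,
so is the spectral integral. -/
theorem spectralInt_eq_sum {ℓ : ℕ} {v : ℕ → ℝ} {s : ℝ} (χ : ℝ → ℝ → ℝ) (J : ℝ → ℝ)
    (he : ∀ lam > 0, energy ℓ v lam =
      ∑ k ∈ Finset.range (ℓ + 1), ∑ j ∈ Finset.range (ℓ + 1),
        ddWeight ℓ v k * ddWeight ℓ v j * χ |v k - v j| lam)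
    (hint : ∀ a, 0 ≤ a → IntegrableOn (fun lam => χ a lam * lam ^ (-2 * s - 1)) (Set.Ioi 0))
    (hJ : ∀ a, 0 ≤ a → ∫ lam in Set.Ioi (0 : ℝ), χ a lam * lam ^ (-2 * s - 1) = J a) :
    spectralInt ℓ v s = ∑ k ∈ Finset.range (ℓ + 1), ∑ j ∈ Finset.range (ℓ + 1),
        ddWeight ℓ v k * ddWeight ℓ v j * J |v k - v j| := by
  unfold spectralInt
  have h1 : ∀ lam ∈ Set.Ioi (0 : ℝ), energy ℓ v lam * lam ^ (-2 * s - 1) =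
      ∑ k ∈ Finset.range (ℓ + 1), ∑ j ∈ Finset.range (ℓ + 1),
        ddWeight ℓ v k * ddWeight ℓ v j * (χ |v k - v j| lam * lam ^ (-2 * s - 1)) := by
    intro lam hlam
    rw [he lam hlam, Finset.sum_mul]
    refine Finset.sum_congr rfl fun k _ => ?_
    rw [Finset.sum_mul]
    exact Finset.sum_congr rfl fun j _ => by ring
  rw [setIntegral_congr_fun measurableSet_Ioi h1, integral_finsetSum]
  · refine Finset.sum_congr rfl fun k _ => ?_
    rw [integral_finsetSum]
    · refine Finset.sum_congr rfl fun j _ => ?_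
      rw [integral_const_mul, hJ _ (abs_nonneg _)]
    · intro j _
      exact (hint _ (abs_nonneg _)).const_mul _
  · intro k _
    refine integrable_finsetSum _ fun j _ => ?_
    exact (hint _ (abs_nonneg _)).const_mul _

/-- For `s` not an integer, the Taylor remainder of order `⌊s⌋ + 1` of the cosine is integrable
against `x ^ (-2 * s - 1)` both at `0` and at infinity, and scaling produces `G s`. -/
theorem spectralInt_eq_of_not_int {s : ℝ} (hs : 0 < s) (hn : ¬ ∃ m : ℤ, s = m) {ℓ : ℕ}
    (hsℓ : s < ℓ) {v : ℕ → ℝ} (hv : StrictMonoOn v (Set.Iic ℓ)) :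
    spectralInt ℓ v s =
      (∫ x in Set.Ioi (0 : ℝ), cosRem (⌊s⌋₊ + 1) x * x ^ (-2 * s - 1)) * doubleDiff ℓ v s := by
  set p := ⌊s⌋₊ + 1 with hp
  have hfl : (⌊s⌋₊ : ℝ) ≤ s := Nat.floor_le hs.le
  have hlt : (p : ℝ) - 1 < s := by
    rw [hp]
    push_cast
    rw [add_sub_cancel_right]
    exact lt_of_le_of_ne hfl fun h => hn ⟨(⌊s⌋₊ : ℤ), by rw [← h]; simp⟩
  have hlt' : s < p := by rw [hp]; push_cast; exact Nat.lt_floor_add_one s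
  have hpℓ : p ≤ ℓ := by
    have : (⌊s⌋₊ : ℝ) < ℓ := lt_of_le_of_lt hfl hsℓ
    have : ⌊s⌋₊ < ℓ := by exact_mod_cast this
    omega
  have hp1 : 1 ≤ p := by omega
  set K := ∫ x in Set.Ioi (0 : ℝ), cosRem p x * x ^ (-2 * s - 1) with hK
  have hint := integrableOn_cosRem hp1 hlt hlt'
  rw [spectralInt_eq_sum (fun a lam => cosRem p (lam * a)) (fun a => K * G s a)
    (fun lam _ => energy_eq_sum_cosRem hv hpℓ lam)]
  · unfold doubleDiff
    rw [Finset.mul_sum]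
    refine Finset.sum_congr rfl fun k _ => ?_
    rw [Finset.mul_sum]
    exact Finset.sum_congr rfl fun j _ => by ring
  · intro a ha
    rcases ha.eq_or_lt with rfl | ha
    · simp [cosRem_zero hp1]
    · exact integrableOn_comp_mul_mul_rpow ha hint
  · intro a ha
    rcases ha.eq_or_lt with rfl | ha
    · simp [cosRem_zero hp1, G]
    · rw [integral_comp_mul_mul_rpow _ ha, ← hK, G, if_neg ha.ne', if_neg hn, mul_comm]

/-- The Taylor remainder of order `m`, with the next Taylor term removed below the threshold `a`. -/
def cosRemCut (m : ℕ) (a x : ℝ) : ℝ :=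
  cosRem m x - (if x < a then (-1) ^ m / ((2 * m).factorial : ℝ) * x ^ (2 * m) else 0)

theorem measurable_cosRemCut (m : ℕ) (a : ℝ) : Measurable (cosRemCut m a) := by
  unfold cosRemCut
  exact (continuous_cosRem m).measurable.sub
    (Measurable.ite measurableSet_Iio (by fun_prop) measurable_const)

theorem integrableOn_cosRemCut_one {m : ℕ} (hm : 1 ≤ m) :
    IntegrableOn (fun x => cosRemCut m 1 x * x ^ (-2 * (m : ℝ) - 1)) (Set.Ioi 0) := by
  refine integrableOn_Ioi_of_rpow_bounds (C := Real.cosh 1 + (m + 1))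
    (a := 1) (b := -3) (by norm_num) (by norm_num)
    (aestronglyMeasurable_mul_rpow (measurable_cosRemCut m 1) _) ?_ ?_
  · intro x hx hx1
    have hm0 : (0 : ℝ) ≤ m := by positivity
    have hcosh := (Real.cosh_pos 1).le
    rcases hx1.lt_or_eq with hlt | rfl
    · have h := abs_cosRem_le_of_le_one (m + 1) hx.le hx1
      rw [cosRemCut, if_pos hlt, ← cosRem_succ, abs_mul,
        abs_of_nonneg (by positivity : 0 ≤ x ^ (-2 * (m : ℝ) - 1))]
      have e : x ^ (1 : ℝ) = x ^ (2 * (m + 1)) * x ^ (-2 * (m : ℝ) - 1) := by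
        rw [← Real.rpow_natCast, ← Real.rpow_add hx]; congr 1; push_cast; ring
      rw [e, ← mul_assoc]
      gcongr
      refine h.trans ?_
      gcongr
      linarith
    · have h := abs_cosRem_le_of_one_le hm le_rfl
      rw [cosRemCut, if_neg (lt_irrefl _), sub_zero, Real.one_rpow, Real.one_rpow, mul_one, mul_one]
      rw [one_pow, mul_one] at h
      linarith
  · intro x hx
    have hx0 : 0 < x := by linarith
    have h := abs_cosRem_le_of_one_le hm hx.le
    rw [cosRemCut, if_neg (not_lt.mpr hx.le), sub_zero, abs_mul,
      abs_of_nonneg (by positivity : 0 ≤ x ^ (-2 * (m : ℝ) - 1))]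
    have e : x ^ (-3 : ℝ) = x ^ (2 * m - 2) * x ^ (-2 * (m : ℝ) - 1) := by
      rw [← Real.rpow_natCast, ← Real.rpow_add hx0]
      congr 1
      rw [Nat.cast_sub (by omega)]
      push_cast; ring
    rw [e, ← mul_assoc]
    gcongr
    have := (Real.cosh_pos 1).le
    exact h.trans (mul_le_mul_of_nonneg_right (by linarith) (by positivity))

theorem integrableOn_inv_Ico {a b : ℝ} (ha : 0 < a) :
    IntegrableOn (fun x : ℝ => x⁻¹) (Set.Ico a b) :=
  ((continuousOn_inv₀.mono fun _ hx => (ha.trans_le hx.1).ne').integrableOn_Icc).mono_set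
    Set.Ico_subset_Icc_self

theorem integral_inv_Ico {a b : ℝ} (ha : 0 < a) (hab : a ≤ b) :
    ∫ x in Set.Ico a b, x⁻¹ = Real.log b - Real.log a := by
  rw [integral_Ico_eq_integral_Ioc, ← intervalIntegral.integral_of_le hab,
    integral_inv_of_pos ha (ha.trans_le hab), Real.log_div (ha.trans_le hab).ne' ha.ne']

/-- Moving the threshold from `1` to `a` contributes the integral of `1 / x` in between, which is
where the logarithm of `G` at integers comes from. -/
theorem integral_cosRemCut {m : ℕ} (hm : 1 ≤ m) {a : ℝ} (ha : 0 < a) :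
    IntegrableOn (fun x => cosRemCut m a x * x ^ (-2 * (m : ℝ) - 1)) (Set.Ioi 0) ∧
    ∫ x in Set.Ioi (0 : ℝ), cosRemCut m a x * x ^ (-2 * (m : ℝ) - 1) =
      (∫ x in Set.Ioi (0 : ℝ), cosRemCut m 1 x * x ^ (-2 * (m : ℝ) - 1)) -
        (-1) ^ m / ((2 * m).factorial : ℝ) * Real.log a := by
  set c : ℝ := (-1) ^ m / ((2 * m).factorial : ℝ) with hc
  have h1 := integrableOn_cosRemCut_one hm
  have hpow : ∀ x : ℝ, 0 < x → x ^ (2 * m) * x ^ (-2 * (m : ℝ) - 1) = x⁻¹ := by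
    intro x hx
    rw [← Real.rpow_natCast, ← Real.rpow_add hx, ← Real.rpow_neg_one]
    congr 1; push_cast; ring
  rcases le_total 1 a with h | h
  · have hi : IntegrableOn ((Set.Ico 1 a).indicator fun x => c * x⁻¹) (Set.Ioi 0) :=
      ((integrable_indicator_iff measurableSet_Ico).mpr
        ((integrableOn_inv_Ico one_pos).const_mul c)).integrableOn
    have he : Set.EqOn (fun x => cosRemCut m 1 x * x ^ (-2 * (m : ℝ) - 1) -
        (Set.Ico 1 a).indicator (fun x => c * x⁻¹) x)
        (fun x => cosRemCut m a x * x ^ (-2 * (m : ℝ) - 1)) (Set.Ioi 0) := by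
      intro x hx
      have hx0 : 0 < x := hx
      simp only [cosRemCut, Set.indicator_apply, Set.mem_Ico, ← hc]
      by_cases hx1 : x < 1
      · rw [if_pos hx1, if_neg (by intro h'; linarith [h'.1]), if_pos (by linarith)]; ring
      · by_cases hxa : x < a
        · rw [if_neg hx1, if_pos ⟨not_lt.mp hx1, hxa⟩, if_pos hxa, ← hpow x hx0]; ring
        · rw [if_neg hx1, if_neg (by intro h'; exact hxa h'.2), if_neg hxa]; ring
    refine ⟨IntegrableOn.congr_fun (h1.sub hi) he measurableSet_Ioi, ?_⟩
    rw [← setIntegral_congr_fun measurableSet_Ioi he, integral_sub h1 hi,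
      setIntegral_indicator measurableSet_Ico,
      Set.inter_eq_right.mpr (show Set.Ico 1 a ⊆ Set.Ioi 0 from
        fun x hx => lt_of_lt_of_le one_pos hx.1), integral_const_mul,
      integral_inv_Ico one_pos h, Real.log_one, sub_zero]
  · have hi : IntegrableOn ((Set.Ico a 1).indicator fun x => c * x⁻¹) (Set.Ioi 0) :=
      ((integrable_indicator_iff measurableSet_Ico).mpr
        ((integrableOn_inv_Ico ha).const_mul c)).integrableOn
    have he : Set.EqOn (fun x => cosRemCut m 1 x * x ^ (-2 * (m : ℝ) - 1) +
        (Set.Ico a 1).indicator (fun x => c * x⁻¹) x)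
        (fun x => cosRemCut m a x * x ^ (-2 * (m : ℝ) - 1)) (Set.Ioi 0) := by
      intro x hx
      have hx0 : 0 < x := hx
      simp only [cosRemCut, Set.indicator_apply, Set.mem_Ico, ← hc]
      by_cases hxa : x < a
      · rw [if_pos (hxa.trans_le h), if_neg (by intro h'; linarith [h'.1]), if_pos hxa]; ring
      · by_cases hx1 : x < 1
        · rw [if_pos hx1, if_pos ⟨not_lt.mp hxa, hx1⟩, if_neg hxa, ← hpow x hx0]; ring
        · rw [if_neg hx1, if_neg (by intro h'; exact hx1 h'.2), if_neg hxa]; ring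
    refine ⟨IntegrableOn.congr_fun (h1.add hi) he measurableSet_Ioi, ?_⟩
    rw [← setIntegral_congr_fun measurableSet_Ioi he, integral_add h1 hi,
      setIntegral_indicator measurableSet_Ico,
      Set.inter_eq_right.mpr (show Set.Ico a 1 ⊆ Set.Ioi 0 from
        fun x hx => lt_of_lt_of_le ha hx.1), integral_const_mul,
      integral_inv_Ico ha h, Real.log_one]
    ring

/-- For an integer `m` no Taylor remainder is integrable at both ends. The term of degree `2 * m` is
removed at low frequencies only; it is annihilated for `m < ℓ`, so the energy is unchanged. -/
theorem spectralInt_eq_of_nat {m : ℕ} (hm : 1 ≤ m) {ℓ : ℕ} (hmℓ : m < ℓ) {v : ℕ → ℝ}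
    (hv : StrictMonoOn v (Set.Iic ℓ)) :
    spectralInt ℓ v m = -((-1) ^ m / ((2 * m).factorial : ℝ)) * doubleDiff ℓ v m := by
  set c : ℝ := (-1) ^ m / ((2 * m).factorial : ℝ) with hc
  set K := ∫ x in Set.Ioi (0 : ℝ), cosRemCut m 1 x * x ^ (-2 * (m : ℝ) - 1) with hK
  have hpow0 : (0 : ℝ) ^ (2 * m) = 0 := zero_pow (by omega)
  have hpow : ∀ a : ℝ, a ^ (2 * (m : ℝ)) = a ^ (2 * m) := fun a => by
    rw [← Real.rpow_natCast]; push_cast; rfl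
  have hG : ∀ a : ℝ, 0 ≤ a → G m a = a ^ (2 * m) * Real.log a := by
    intro a ha
    rcases ha.eq_or_lt with rfl | ha
    · simp [G]
    · rw [G, if_neg ha.ne', if_pos ⟨m, by simp⟩, hpow]
  -- In the variable `lam` the threshold is `1` for every pair of nodes.
  have hcut : ∀ a lam : ℝ, 0 < a → cosRemCut m a (lam * a) =
      cosRem m (lam * a) - (if lam < 1 then c * (lam * a) ^ (2 * m) else 0) := by
    intro a lam ha
    have : lam * a < a ↔ lam < 1 := mul_lt_iff_lt_one_left ha
    simp only [cosRemCut, this, ← hc]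
  rw [spectralInt_eq_sum
    (fun a lam => cosRem m (lam * a) - (if lam < 1 then c * (lam * a) ^ (2 * m) else 0))
    (fun a => a ^ (2 * m) * (K - c * Real.log a))]
  · have h1 : ∀ k j, ddWeight ℓ v k * ddWeight ℓ v j *
        (|v k - v j| ^ (2 * m) * (K - c * Real.log |v k - v j|)) =
        K * (ddWeight ℓ v k * ddWeight ℓ v j * (v k - v j) ^ (2 * m)) +
        (-c) * (ddWeight ℓ v k * ddWeight ℓ v j * G m |v k - v j|) := by
      intro k j
      rw [hG _ (abs_nonneg _), pow_mul |_|, sq_abs, ← pow_mul]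
      ring
    simp_rw [h1, Finset.sum_add_distrib, ← Finset.mul_sum]
    rw [sum_sum_ddWeight_mul_sub_pow hv hmℓ, mul_zero, zero_add]
    rfl
  · intro lam _
    have h1 : ∀ k j, ddWeight ℓ v k * ddWeight ℓ v j * (cosRem m (lam * |v k - v j|) -
        (if lam < 1 then c * (lam * |v k - v j|) ^ (2 * m) else 0)) =
        ddWeight ℓ v k * ddWeight ℓ v j * cosRem m (lam * |v k - v j|) -
        (if lam < 1 then c * lam ^ (2 * m) else 0) *
          (ddWeight ℓ v k * ddWeight ℓ v j * (v k - v j) ^ (2 * m)) := by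
      intro k j
      split_ifs
      · rw [mul_pow, pow_mul |_|, sq_abs, ← pow_mul]; ring
      · ring
    simp_rw [h1, Finset.sum_sub_distrib, ← Finset.mul_sum]
    rw [sum_sum_ddWeight_mul_sub_pow hv hmℓ, mul_zero, sub_zero]
    exact energy_eq_sum_cosRem hv hmℓ.le lam
  · intro a ha
    rcases ha.eq_or_lt with rfl | ha
    · simp [cosRem_zero hm, hpow0]
    · simp_rw [← hcut a _ ha]
      exact integrableOn_comp_mul_mul_rpow ha (integral_cosRemCut hm ha).1
  · intro a ha
    rcases ha.eq_or_lt with rfl | ha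
    · simp [cosRem_zero hm, hpow0]
    · simp_rw [← hcut a _ ha]
      rw [integral_comp_mul_mul_rpow _ ha, (integral_cosRemCut hm ha).2, ← hK, ← hc, hpow]

/-- Up to a factor which depends on `s` only, the double divided differences of `G s` are the
(positive) spectral integrals. The nodes enter through the spectral integral alone. -/
theorem exists_spectralInt_eq {ℓ : ℕ} {s : ℝ} (hs : 0 < s) (hsℓ : s < ℓ) :
    ∃ c : ℝ, ∀ v : ℕ → ℝ, StrictMonoOn v (Set.Iic ℓ) →
      spectralInt ℓ v s = c * doubleDiff ℓ v s := by
  by_cases hn : ∃ m : ℤ, s = m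
  · obtain ⟨m, rfl⟩ := hn
    obtain ⟨n, rfl⟩ : ∃ n : ℕ, m = n := ⟨m.toNat, by
      have : 0 < m := by exact_mod_cast hs
      omega⟩
    have h1 : 1 ≤ n := by
      have : (0 : ℤ) < n := by exact_mod_cast hs
      omega
    have h2 : n < ℓ := by exact_mod_cast hsℓ
    exact ⟨_, fun v hv => spectralInt_eq_of_nat h1 h2 hv⟩
  · exact ⟨_, fun v hv => spectralInt_eq_of_not_int hs hn hsℓ hv⟩

/-! ### Perturbation of equidistant nodes -/

theorem tendsto_ddWeight {α : Type*} {L : Filter α} {ℓ : ℕ} {z : α → ℕ → ℝ} {v : ℕ → ℝ}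
    (hv : StrictMonoOn v (Set.Iic ℓ)) (hz : ∀ k ≤ ℓ, Tendsto (fun n => z n k) L (𝓝 (v k)))
    {k : ℕ} (hk : k ≤ ℓ) :
    Tendsto (fun n => ddWeight ℓ (z n) k) L (𝓝 (ddWeight ℓ v k)) := by
  unfold ddWeight
  refine tendsto_const_nhds.div (tendsto_finsetProd _ fun j hj => ?_)
    (Finset.prod_ne_zero_iff.mpr fun j hj => sub_ne_zero.mpr ?_)
  · simp only [Finset.mem_erase, Finset.mem_range] at hj
    exact (hz k hk).sub (hz j (by omega))
  · intro h
    simp only [Finset.mem_erase, Finset.mem_range] at hj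
    exact hj.1 (hv.injOn (by simpa using hk) (by simp; omega) h).symm

/-- Dominated convergence: for `s` in a compact subinterval of `(0, ℓ)` the integrands have a
common integrable envelope. -/
theorem tendsto_spectralInt {ℓ : ℕ} {z : ℕ → ℕ → ℝ} {v : ℕ → ℝ}
    (hv : StrictMonoOn v (Set.Iic ℓ)) (hmono : ∀ n, StrictMonoOn (z n) (Set.Iic ℓ))
    (hz : ∀ k ≤ ℓ, Tendsto (fun n => z n k) atTop (𝓝 (v k))) {s : ℕ → ℝ} {s₀ : ℝ}
    (h0 : 0 < s₀) (h1 : s₀ < ℓ) (hs : Tendsto s atTop (𝓝 s₀)) :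
    Tendsto (fun n => spectralInt ℓ (z n) (s n)) atTop (𝓝 (spectralInt ℓ v s₀)) := by
  have hw : ∀ k ≤ ℓ, Tendsto (fun n => ddWeight ℓ (z n) k) atTop (𝓝 (ddWeight ℓ v k)) :=
    fun k hk => tendsto_ddWeight hv hz hk
  have hW : Tendsto (fun n => (∑ k ∈ Finset.range (ℓ + 1), |ddWeight ℓ (z n) k|) ^ 2) atTop
      (𝓝 ((∑ k ∈ Finset.range (ℓ + 1), |ddWeight ℓ v k|) ^ 2)) :=
    (tendsto_finsetSum _ fun k hk => (hw k (by simp at hk; omega)).abs).pow 2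
  set W := (∑ k ∈ Finset.range (ℓ + 1), |ddWeight ℓ v k|) ^ 2 with hWdef
  obtain ⟨p, hp0, hps⟩ := exists_between h0
  obtain ⟨q, hsq, hqℓ⟩ := exists_between h1
  have hq0 : 0 < q := by linarith
  have hpℓ : p < ℓ := by linarith
  refine tendsto_integral_filter_of_dominated_convergence
    (fun x => (2 + (W + 1)) * (envelope ℓ p x + envelope ℓ q x)) ?_ ?_ ?_ ?_
  · exact Eventually.of_forall fun n =>
      aestronglyMeasurable_mul_rpow (continuous_energy ℓ (z n)).measurable _
  · filter_upwards [hW.eventually (gt_mem_nhds (lt_add_one W)), hs.eventually (lt_mem_nhds hps),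
      hs.eventually (gt_mem_nhds hsq)] with n hn hnp hnq
    filter_upwards [ae_restrict_mem measurableSet_Ioi] with x hx
    have hx' : 0 < x := hx
    have hW0 : 0 ≤ W := sq_nonneg _
    rw [Real.norm_of_nonneg (mul_nonneg (energy_nonneg _ _ _) (by positivity))]
    refine (energy_mul_rpow_le_envelope (hmono n) (by linarith : 2 ≤ 2 + (W + 1))
      (by linarith) (s n) hx').trans ?_
    refine mul_le_mul_of_nonneg_left ?_ (by linarith)
    unfold envelope
    rw [← mul_add]
    refine mul_le_mul_of_nonneg_left ?_ (by positivity)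
    rcases le_total x 1 with h | h
    · refine (Real.rpow_le_rpow_of_exponent_ge hx' h
        (by linarith : -2 * q - 1 ≤ -2 * s n - 1)).trans ?_
      have : 0 ≤ x ^ (-2 * p - 1) := by positivity
      linarith
    · refine (Real.rpow_le_rpow_of_exponent_le h
        (by linarith : -2 * s n - 1 ≤ -2 * p - 1)).trans ?_
      have : 0 ≤ x ^ (-2 * q - 1) := by positivity
      linarith
  · exact ((integrableOn_envelope hp0 hpℓ).add (integrableOn_envelope hq0 hqℓ)).const_mul _
  · filter_upwards [ae_restrict_mem measurableSet_Ioi] with x hx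
    have hx' : 0 < x := hx
    refine Tendsto.mul ?_ ?_
    · refine tendsto_finsetSum _ fun k hk => tendsto_finsetSum _ fun j hj => ?_
      simp only [Finset.mem_range, Nat.lt_succ_iff] at hk hj
      refine ((hw k hk).mul (hw j hj)).mul ?_
      exact (Real.continuous_cos.tendsto _).comp
        (tendsto_const_nhds.mul ((hz k hk).sub (hz j hj)).abs)
    · exact tendsto_const_nhds.rpow ((tendsto_const_nhds.mul hs).sub_const 1) (Or.inl hx'.ne')

theorem not_int_of_mem_Ioo {s : ℝ} (hs : s ∈ Set.Ioo (0 : ℝ) 1) : ¬ ∃ m : ℤ, s = m := by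
  rintro ⟨m, rfl⟩
  have h1 : (0 : ℤ) < m := by exact_mod_cast hs.1
  have h2 : m < (1 : ℤ) := by exact_mod_cast hs.2
  omega

/-- As `s → 0+`, `G s u → 1` for `u > 0` while `G s 0 = 0`, so that only the diagonal of the square
of `∑ k, ddWeight ℓ v k = 0` is missing in the limit. -/
theorem tendsto_doubleDiff_zero {α : Type*} {L : Filter α} {ℓ : ℕ} (hℓ : 1 ≤ ℓ) {z : α → ℕ → ℝ}
    {v : ℕ → ℝ} (hv : StrictMonoOn v (Set.Iic ℓ))
    (hmono : ∀ n, StrictMonoOn (z n) (Set.Iic ℓ))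
    (hz : ∀ k ≤ ℓ, Tendsto (fun n => z n k) L (𝓝 (v k))) {s : α → ℝ}
    (hs : Tendsto s L (𝓝[>] 0)) :
    Tendsto (fun n => doubleDiff ℓ (z n) (s n)) L
      (𝓝 (-∑ k ∈ Finset.range (ℓ + 1), ddWeight ℓ v k ^ 2)) := by
  have hlim : (-∑ k ∈ Finset.range (ℓ + 1), ddWeight ℓ v k ^ 2) =
      ∑ k ∈ Finset.range (ℓ + 1), ∑ j ∈ Finset.range (ℓ + 1),
        ddWeight ℓ v k * ddWeight ℓ v j * (if k = j then 0 else 1) := by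
    have h0 : ∑ k ∈ Finset.range (ℓ + 1), ddWeight ℓ v k = 0 := by
      simpa using sum_ddWeight_mul_pow hv (p := 0) (by omega)
    have h1 : ∀ k j, ddWeight ℓ v k * ddWeight ℓ v j * (if k = j then (0 : ℝ) else 1) =
        ddWeight ℓ v k * ddWeight ℓ v j -
          (if k = j then ddWeight ℓ v k * ddWeight ℓ v j else 0) := by
      intro k j; split_ifs <;> ring
    simp_rw [h1, Finset.sum_sub_distrib, ← Finset.sum_mul_sum, h0]
    rw [zero_mul, zero_sub, neg_inj]
    refine Finset.sum_congr rfl fun k hk => ?_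
    rw [Finset.sum_ite_eq, if_pos hk, sq]
  rw [hlim]
  have hsIoo : ∀ᶠ n in L, s n ∈ Set.Ioo (0 : ℝ) 1 :=
    hs.eventually (Ioo_mem_nhdsGT one_pos)
  have hs0 : Tendsto s L (𝓝 0) := hs.mono_right nhdsWithin_le_nhds
  refine tendsto_finsetSum _ fun k hk => tendsto_finsetSum _ fun j hj => ?_
  simp only [Finset.mem_range, Nat.lt_succ_iff] at hk hj
  refine ((tendsto_ddWeight hv hz hk).mul (tendsto_ddWeight hv hz hj)).mul ?_
  by_cases hkj : k = j
  · subst hkj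
    simp only [sub_self, abs_zero, G, if_true]
    exact tendsto_const_nhds
  · rw [if_neg hkj]
    have hne : v k - v j ≠ 0 := sub_ne_zero.mpr fun h =>
      hkj (hv.injOn (by simpa using hk) (by simpa using hj) h)
    have h := ((hz k hk).sub (hz j hj)).abs.rpow (hs0.const_mul 2) (Or.inl (abs_ne_zero.mpr hne))
    rw [mul_zero, Real.rpow_zero] at h
    refine h.congr' ?_
    filter_upwards [hsIoo] with n hn
    have hne' : z n k - z n j ≠ 0 := sub_ne_zero.mpr fun h =>
      hkj ((hmono n).injOn (by simpa using hk) (by simpa using hj) h)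
    rw [G, if_neg (abs_ne_zero.mpr hne'), if_neg (not_int_of_mem_Ioo hn)]

theorem strictMonoOn_natCast (ℓ : ℕ) : StrictMonoOn (fun k : ℕ => (k : ℝ)) (Set.Iic ℓ) :=
  Nat.strictMono_cast.strictMonoOn _

theorem strictMonoOn_of_abs_sub_natCast_le {ℓ : ℕ} {z : ℕ → ℝ}
    (hz : ∀ k ≤ ℓ, |z k - k| ≤ 1 / 4) : StrictMonoOn z (Set.Iic ℓ) := by
  intro j hj k hk hjk
  have h1 := abs_le.mp (hz j hj)
  have h2 := abs_le.mp (hz k hk)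
  have h3 : (j : ℝ) + 1 ≤ k := by exact_mod_cast hjk
  linarith [h1.2, h2.1]

theorem sum_ddWeight_sq_pos {ℓ : ℕ} {v : ℕ → ℝ} (hv : StrictMonoOn v (Set.Iic ℓ)) :
    0 < ∑ k ∈ Finset.range (ℓ + 1), ddWeight ℓ v k ^ 2 := by
  refine Finset.sum_pos (fun k hk => ?_) ⟨0, by simp⟩
  have := ddWeight_ne_zero hv (k := k) (by simp at hk; omega)
  positivity

/-- The relative spectral integral of nearly equidistant nodes is close to one, uniformly in the
smoothness `s` down to `0`. For `s` away from `0` the integrals converge dominatedly; near `0` the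
integrals diverge, and the double divided differences, which have the same ratio, are used. -/
theorem exists_abs_spectralInt_div_sub_one_le {ℓ : ℕ} (hℓ : 1 ≤ ℓ) {M : ℝ} (hM : M < ℓ) {ε : ℝ}
    (hε : 0 < ε) : ∃ δ > 0, ∀ z : ℕ → ℝ, (∀ k ≤ ℓ, |z k - k| ≤ δ) → ∀ s ∈ Set.Ioc 0 M,
      |spectralInt ℓ z s / spectralInt ℓ (fun k => (k : ℝ)) s - 1| ≤ ε := by
  by_contra! hcon
  have hpos : ∀ n : ℕ, (0 : ℝ) < min (1 / 4) (1 / ((n : ℝ) + 1)) := fun n => by positivity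
  choose z hz s hs hbad using fun n : ℕ => hcon _ (hpos n)
  have hmono : ∀ n, StrictMonoOn (z n) (Set.Iic ℓ) := fun n =>
    strictMonoOn_of_abs_sub_natCast_le fun k hk => (hz n k hk).trans (min_le_left _ _)
  have hlim : ∀ k ≤ ℓ, Tendsto (fun n => z n k) atTop (𝓝 (k : ℝ)) := by
    intro k hk
    refine tendsto_iff_norm_sub_tendsto_zero.mpr ?_
    exact squeeze_zero (fun n => norm_nonneg _) (fun n => (hz n k hk).trans (min_le_right _ _))
      tendsto_one_div_add_atTop_nhds_zero_nat
  obtain ⟨s₀, hs₀, g, hg, hsg⟩ := isCompact_Icc.tendsto_subseq (x := s) (s := Set.Icc 0 M)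
    fun n => ⟨(hs n).1.le, (hs n).2⟩
  have hid := strictMonoOn_natCast ℓ
  have hlim' : ∀ k ≤ ℓ, Tendsto (fun n => z (g n) k) atTop (𝓝 (k : ℝ)) := fun k hk =>
    (hlim k hk).comp hg.tendsto_atTop
  have key : Tendsto (fun n => spectralInt ℓ (z (g n)) (s (g n)) /
      spectralInt ℓ (fun k => (k : ℝ)) (s (g n))) atTop (𝓝 1) := by
    rcases hs₀.1.eq_or_lt with h0 | h0
    · have hs0 : Tendsto (fun n => s (g n)) atTop (𝓝[>] 0) :=
        tendsto_nhdsWithin_iff.mpr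
          ⟨by rw [h0]; exact hsg, Eventually.of_forall fun n => (hs (g n)).1⟩
      have hne := (sum_ddWeight_sq_pos hid).ne'
      have t1 := tendsto_doubleDiff_zero hℓ hid (fun n => hmono (g n)) hlim' hs0
      have t2 := tendsto_doubleDiff_zero hℓ (z := fun _ k => (k : ℝ)) hid
        (fun _ : ℕ => hid) (fun _ _ => tendsto_const_nhds) hs0
      have t3 := t1.div t2 (neg_ne_zero.mpr hne)
      rw [div_self (neg_ne_zero.mpr hne)] at t3
      refine t3.congr fun n => ?_
      have hsn := hs (g n)
      have hsℓ : s (g n) < ℓ := hsn.2.trans_lt hM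
      obtain ⟨c, hc⟩ := exists_spectralInt_eq hsn.1 hsℓ
      have hp := spectralInt_pos hid hsn.1 hsℓ
      have hc0 : c ≠ 0 := by
        rintro rfl
        rw [hc _ hid, zero_mul] at hp
        exact lt_irrefl _ hp
      rw [hc _ hid, hc _ (hmono _), mul_div_mul_left _ _ hc0]
      rfl
    · have hℓ0 : s₀ < ℓ := hs₀.2.trans_lt hM
      have hp := (spectralInt_pos hid h0 hℓ0).ne'
      have t1 := tendsto_spectralInt hid (fun n => hmono (g n)) hlim' h0 hℓ0 hsg
      have t2 := tendsto_spectralInt hid (z := fun _ k => (k : ℝ)) (fun _ => hid)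
        (fun _ _ => tendsto_const_nhds) h0 hℓ0 hsg
      have t3 := t1.div t2 hp
      rw [div_self hp] at t3
      exact t3
  have h1 : Tendsto (fun n => |spectralInt ℓ (z (g n)) (s (g n)) /
      spectralInt ℓ (fun k => (k : ℝ)) (s (g n)) - 1|) atTop (𝓝 0) := by
    simpa using (key.sub_const 1).abs
  obtain ⟨n, hn⟩ := (h1.eventually (gt_mem_nhds hε)).exists
  exact absurd (hbad (g n)) (not_lt.mpr hn.le)

/-! ### Geometry of the design -/

/-- The local mesh `t_{n,i+1} - t_{n,i}` of the design. -/
def step (φ : ℝ → ℝ) (n i : ℕ) : ℝ := site φ n (i + 1) - site φ n i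

/-- The nodes of the difference of dilation `θ` at the index `i`, moved to the origin and divided by
`θ` times the local mesh: they are close to `0, 1, …, ℓ`. -/
def localNode (φ : ℝ → ℝ) (n θ i k : ℕ) : ℝ :=
  (site φ n (i + θ * k) - site φ n i) / (θ * step φ n i)

namespace IsDesign

variable {φ : ℝ → ℝ}

theorem continuous_deriv (hφ : IsDesign φ) : Continuous (deriv φ) :=
  hφ.smooth.continuous_deriv (by norm_num)

theorem exists_deriv_eq (hφ : IsDesign φ) {n i j : ℕ} (hi : 1 ≤ i) (hij : i < j) (hj : j ≤ n) :
    ∃ ξ ∈ Set.Icc (0 : ℝ) 1,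
      ξ ∈ Set.Icc (((i : ℝ) - 1) / ((n : ℝ) - 1)) (((j : ℝ) - 1) / ((n : ℝ) - 1)) ∧
      site φ n j - site φ n i = deriv φ ξ * (((j : ℝ) - i) / ((n : ℝ) - 1)) := by
  have hi' : (1 : ℝ) ≤ i := by exact_mod_cast hi
  have hij' : (i : ℝ) < j := by exact_mod_cast hij
  have hj' : (j : ℝ) ≤ n := by exact_mod_cast hj
  have hn : (0 : ℝ) < (n : ℝ) - 1 := by linarith
  have hlt : ((i : ℝ) - 1) / ((n : ℝ) - 1) < ((j : ℝ) - 1) / ((n : ℝ) - 1) := by gcongr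
  obtain ⟨ξ, hξ, h⟩ := exists_deriv_eq_slope φ hlt hφ.smooth.continuous.continuousOn
    (hφ.smooth.differentiable (by norm_num)).differentiableOn
  have h0 : 0 ≤ ((i : ℝ) - 1) / ((n : ℝ) - 1) := div_nonneg (by linarith) hn.le
  have h1 : ((j : ℝ) - 1) / ((n : ℝ) - 1) ≤ 1 := by rw [div_le_one hn]; linarith
  refine ⟨ξ, ⟨h0.trans hξ.1.le, hξ.2.le.trans h1⟩, ⟨hξ.1.le, hξ.2.le⟩, ?_⟩
  have e : ((j : ℝ) - 1) / ((n : ℝ) - 1) - ((i : ℝ) - 1) / ((n : ℝ) - 1) =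
      ((j : ℝ) - i) / ((n : ℝ) - 1) := by ring
  rw [h, e, div_mul_cancel₀]
  · rfl
  · exact (div_pos (by linarith) hn).ne'

theorem exists_bounds (hφ : IsDesign φ) : ∃ m m' : ℝ, 0 < m ∧ m ≤ m' ∧
    ∀ n i j : ℕ, 1 ≤ i → i ≤ j → j ≤ n →
      m * (((j : ℝ) - i) / ((n : ℝ) - 1)) ≤ site φ n j - site φ n i ∧
      site φ n j - site φ n i ≤ m' * (((j : ℝ) - i) / ((n : ℝ) - 1)) := by
  have hne : (Set.Icc (0 : ℝ) 1).Nonempty := ⟨0, by simp⟩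
  obtain ⟨x, hx, hmin⟩ := isCompact_Icc.exists_isMinOn hne hφ.continuous_deriv.continuousOn
  obtain ⟨y, hy, hmax⟩ := isCompact_Icc.exists_isMaxOn hne hφ.continuous_deriv.continuousOn
  refine ⟨deriv φ x, deriv φ y, hφ.deriv_pos x hx, hmin hy, fun n i j hi hij hj => ?_⟩
  rcases hij.eq_or_lt with rfl | hij
  · simp
  obtain ⟨ξ, hξ, -, h⟩ := hφ.exists_deriv_eq hi hij hj
  have hij' : (i : ℝ) < j := by exact_mod_cast hij
  have hi' : (1 : ℝ) ≤ i := by exact_mod_cast hi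
  have hj' : (j : ℝ) ≤ n := by exact_mod_cast hj
  have h0 : 0 ≤ ((j : ℝ) - i) / ((n : ℝ) - 1) := div_nonneg (by linarith) (by linarith)
  rw [h]
  exact ⟨mul_le_mul_of_nonneg_right (hmin hξ) h0, mul_le_mul_of_nonneg_right (hmax hξ) h0⟩

theorem site_lt_site (hφ : IsDesign φ) {n i j : ℕ} (hi : 1 ≤ i) (hij : i < j) (hj : j ≤ n) :
    site φ n i < site φ n j := by
  obtain ⟨ξ, hξ, -, h⟩ := hφ.exists_deriv_eq hi hij hj
  have hij' : (i : ℝ) < j := by exact_mod_cast hij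
  have hi' : (1 : ℝ) ≤ i := by exact_mod_cast hi
  have hj' : (j : ℝ) ≤ n := by exact_mod_cast hj
  have : 0 < site φ n j - site φ n i := by
    rw [h]
    exact mul_pos (hφ.deriv_pos ξ hξ) (div_pos (by linarith) (by linarith))
  linarith

theorem site_mem_Icc (hφ : IsDesign φ) {n i : ℕ} (hn : 2 ≤ n) (hi : 1 ≤ i) (hin : i ≤ n) :
    site φ n i ∈ Set.Icc (0 : ℝ) 1 := by
  have h1 : site φ n 1 = 0 := by simp [site, hφ.zero]
  have h2 : site φ n n = 1 := by
    have : (n : ℝ) - 1 ≠ 0 := by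
      have : (2 : ℝ) ≤ n := by exact_mod_cast hn
      linarith
    rw [site, div_self this, hφ.one]
  constructor
  · rcases hi.eq_or_lt with rfl | h
    · exact h1.ge
    · exact h1 ▸ (hφ.site_lt_site le_rfl h hin).le
  · rcases hin.eq_or_lt with rfl | h
    · exact h2.le
    · exact h2 ▸ (hφ.site_lt_site hi h le_rfl).le

theorem strictMonoOn_site (hφ : IsDesign φ) {n θ ℓ i : ℕ} (hθ : 1 ≤ θ) (hi : 1 ≤ i)
    (hin : i + θ * ℓ ≤ n) : StrictMonoOn (fun k => site φ n (i + θ * k)) (Set.Iic ℓ) := by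
  intro j hj k hk hjk
  refine hφ.site_lt_site (by omega) ?_ ?_
  · have := Nat.mul_lt_mul_of_pos_left hjk hθ; omega
  · have := Nat.mul_le_mul_left θ (show k ≤ ℓ from hk); omega

theorem step_pos (hφ : IsDesign φ) {n i : ℕ} (hi : 1 ≤ i) (hin : i + 1 ≤ n) : 0 < step φ n i :=
  sub_pos.mpr (hφ.site_lt_site hi (Nat.lt_succ_self i) hin)

/-- Since `deriv φ` is uniformly continuous, the design is locally almost equidistant. -/
theorem eventually_abs_div_step_sub_le (hφ : IsDesign φ) (K : ℕ) {ε : ℝ} (hε : 0 < ε) :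
    ∀ᶠ n : ℕ in atTop, ∀ i k : ℕ, 1 ≤ i → i + 1 ≤ n → k ≤ K → i + k ≤ n →
      |(site φ n (i + k) - site φ n i) / step φ n i - k| ≤ ε := by
  obtain ⟨m, m', hm, -, hb⟩ := hφ.exists_bounds
  have huc : UniformContinuousOn (deriv φ) (Set.Icc 0 1) :=
    isCompact_Icc.uniformContinuousOn_of_continuous hφ.continuous_deriv.continuousOn
  obtain ⟨δ, hδ, hcont⟩ := Metric.uniformContinuousOn_iff.mp huc (ε * m / (K + 1)) (by positivity)
  have hlarge : ∀ᶠ n : ℕ in atTop, (K + 1 : ℝ) / δ + 1 < n :=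
    tendsto_natCast_atTop_atTop.eventually_gt_atTop _
  filter_upwards [hlarge] with n hn i k hi hin hk hik
  rcases Nat.eq_zero_or_pos k with rfl | hk0
  · simpa using hε.le
  have hN : 0 < (n : ℝ) - 1 := by
    have : 0 < (K + 1 : ℝ) / δ := by positivity
    linarith
  obtain ⟨ξ, hξ, hξ', h1⟩ := hφ.exists_deriv_eq hi (by omega : i < i + k) hik
  obtain ⟨η, hη, hη', h2⟩ := hφ.exists_deriv_eq hi (by omega : i < i + 1) hin
  have hkK : (k : ℝ) ≤ K := by exact_mod_cast hk
  have hk1 : (1 : ℝ) ≤ k := by exact_mod_cast hk0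
  have hstep := hφ.step_pos hi hin
  have hdist : dist ξ η < δ := by
    push_cast at hξ' hη'
    have e1 : ((i : ℝ) + k - 1) / ((n : ℝ) - 1) =
        ((i : ℝ) - 1) / ((n : ℝ) - 1) + k / ((n : ℝ) - 1) := by
      ring
    have e2 : ((i : ℝ) + 1 - 1) / ((n : ℝ) - 1) =
        ((i : ℝ) - 1) / ((n : ℝ) - 1) + 1 / ((n : ℝ) - 1) := by
      ring
    rw [e1] at hξ'
    rw [e2] at hη'
    have h3 : (k : ℝ) / ((n : ℝ) - 1) ≤ (K + 1) / ((n : ℝ) - 1) := by gcongr; linarith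
    have h4 : (1 : ℝ) / ((n : ℝ) - 1) ≤ (K + 1) / ((n : ℝ) - 1) := by gcongr; linarith
    have h5 : (K + 1 : ℝ) / ((n : ℝ) - 1) < δ := by
      rw [div_lt_iff₀ hN]
      have : (K + 1 : ℝ) / δ < (n : ℝ) - 1 := by linarith
      rw [div_lt_iff₀ hδ] at this
      linarith
    rw [Real.dist_eq, abs_lt]
    constructor <;> linarith [hξ'.1, hξ'.2, hη'.1, hη'.2]
  have hd := hcont ξ hξ η hη hdist
  rw [Real.dist_eq] at hd
  have hlow := (hb n i (i + 1) hi (by omega) hin).1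
  have e3 : step φ n i = deriv φ η * (1 / ((n : ℝ) - 1)) := by
    rw [step, h2]; push_cast; ring
  have e4 : site φ n (i + k) - site φ n i - k * step φ n i =
      (deriv φ ξ - deriv φ η) * (k / ((n : ℝ) - 1)) := by
    rw [h1, e3]; push_cast; ring
  have e5 : (site φ n (i + k) - site φ n i) / step φ n i - k =
      (site φ n (i + k) - site φ n i - k * step φ n i) / step φ n i := by
    field_simp
  rw [e5, abs_div, abs_of_pos hstep, div_le_iff₀ hstep, e4, abs_mul,
    abs_of_nonneg (by positivity : 0 ≤ (k : ℝ) / ((n : ℝ) - 1))]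
  have h6 : m * (1 / ((n : ℝ) - 1)) ≤ step φ n i := by
    refine le_trans (le_of_eq ?_) hlow
    push_cast; ring
  calc |deriv φ ξ - deriv φ η| * (k / ((n : ℝ) - 1))
      ≤ ε * m / (K + 1) * ((K + 1) / ((n : ℝ) - 1)) := by
        gcongr
        linarith
    _ = ε * (m * (1 / ((n : ℝ) - 1))) := by field_simp
    _ ≤ ε * step φ n i := by gcongr

end IsDesign

theorem site_eq_add_mul_localNode {φ : ℝ → ℝ} {n θ i : ℕ} (hθ : 1 ≤ θ) (hstep : 0 < step φ n i)
    (k : ℕ) : site φ n (i + θ * k) = site φ n i + θ * step φ n i * localNode φ n θ i k := by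
  have hθ' : (0 : ℝ) < θ := by exact_mod_cast hθ
  unfold localNode
  field_simp
  ring

theorem IsDesign.eventually_abs_localNode_sub_le {φ : ℝ → ℝ} (hφ : IsDesign φ) (θ ℓ : ℕ)
    (hθ : 1 ≤ θ) {δ : ℝ} (hδ : 0 < δ) : ∀ᶠ n : ℕ in atTop, ∀ i : ℕ, 1 ≤ i → i + 1 ≤ n →
      i + θ * ℓ ≤ n → ∀ k ≤ ℓ, |localNode φ n θ i k - k| ≤ δ := by
  filter_upwards [hφ.eventually_abs_div_step_sub_le (θ * ℓ) hδ] with n hn i hi hin hiθ k hk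
  have hkθ := Nat.mul_le_mul_left θ hk
  have h := hn i (θ * k) hi hin hkθ (by omega)
  have hθ' : (1 : ℝ) ≤ θ := by exact_mod_cast hθ
  have e : localNode φ n θ i k - k =
      ((site φ n (i + θ * k) - site φ n i) / step φ n i - (θ * k : ℕ)) / θ := by
    have := (hφ.step_pos hi hin).ne'
    unfold localNode
    push_cast
    field_simp
  rw [e, abs_div, abs_of_pos (by linarith : (0 : ℝ) < θ)]
  exact (div_le_self (abs_nonneg _) hθ').trans h

/-- The spectral integral of the nodes of a difference at `i`, relative to the one for equidistant
nodes. -/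
theorem eventually_abs_spectralInt_sub_le {φ : ℝ → ℝ} (hφ : IsDesign φ) {θ ℓ : ℕ} (hθ : 1 ≤ θ)
    (hℓ : 1 ≤ ℓ) {M : ℝ} (hM : M < ℓ) {ε : ℝ} (hε : 0 < ε) :
    ∀ᶠ n : ℕ in atTop, ∀ i : ℕ, 1 ≤ i → i + θ * ℓ ≤ n → ∀ s ∈ Set.Ioc 0 M,
      |spectralInt ℓ (fun k => site φ n (i + θ * k)) s -
        step φ n i ^ (2 * s - 2 * ℓ) * (θ ^ (2 * s - 2 * ℓ) * spectralInt ℓ (fun k => (k : ℝ)) s)| ≤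
      ε * (step φ n i ^ (2 * s - 2 * ℓ) *
        (θ ^ (2 * s - 2 * ℓ) * spectralInt ℓ (fun k => (k : ℝ)) s)) := by
  obtain ⟨δ, hδ, hclose⟩ := exists_abs_spectralInt_div_sub_one_le hℓ hM hε
  filter_upwards [hφ.eventually_abs_localNode_sub_le θ ℓ hθ hδ] with n hn i hi hin s hs
  have hin1 : i + 1 ≤ n := by
    have := Nat.mul_le_mul hθ hℓ; omega
  have hstep := hφ.step_pos hi hin1
  have hθ' : (0 : ℝ) < θ := by exact_mod_cast hθ
  have h := hclose (localNode φ n θ i) (hn i hi hin1 hin) s hs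
  have hp := spectralInt_pos (strictMonoOn_natCast ℓ) hs.1 (hs.2.trans_lt hM)
  have e : (fun k => site φ n (i + θ * k)) =
      fun k => site φ n i + θ * step φ n i * localNode φ n θ i k :=
    funext fun k => site_eq_add_mul_localNode hθ hstep k
  rw [e, spectralInt_add_mul ℓ _ (by positivity), Real.mul_rpow hθ'.le hstep.le]
  have e2 : (θ : ℝ) ^ (2 * s - 2 * ℓ) * step φ n i ^ (2 * s - 2 * ℓ) *
        spectralInt ℓ (localNode φ n θ i) s - step φ n i ^ (2 * s - 2 * ℓ) *
        (θ ^ (2 * s - 2 * ℓ) * spectralInt ℓ (fun k => (k : ℝ)) s) =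
      (spectralInt ℓ (localNode φ n θ i) s / spectralInt ℓ (fun k => (k : ℝ)) s - 1) *
      (step φ n i ^ (2 * s - 2 * ℓ) *
        (θ ^ (2 * s - 2 * ℓ) * spectralInt ℓ (fun k => (k : ℝ)) s)) := by
    field_simp
  rw [e2, abs_mul, abs_of_pos (by positivity :
    0 < step φ n i ^ (2 * s - 2 * ℓ) * (θ ^ (2 * s - 2 * ℓ) * spectralInt ℓ (fun k => (k : ℝ)) s))]
  gcongr

/-! ### The ratio `F` -/

/-- The sums of the powers of the local meshes over the two index ranges are asymptotically equal,
since they differ by `ℓ` terms and all terms are comparable. -/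
theorem IsDesign.eventually_sum_step_rpow_le {φ : ℝ → ℝ} (hφ : IsDesign φ) {ℓ : ℕ} (hℓ : 1 ≤ ℓ)
    {M : ℝ} (hM : M < ℓ) {ε : ℝ} (hε : 0 < ε) :
    ∀ᶠ n : ℕ in atTop, ∀ s ∈ Set.Ioc 0 M,
      0 < ∑ i ∈ Finset.Icc 1 (n - 2 * ℓ), step φ n i ^ (2 * s - 2 * ℓ) ∧
      ∑ i ∈ Finset.Icc 1 (n - 2 * ℓ), step φ n i ^ (2 * s - 2 * ℓ) ≤
        ∑ i ∈ Finset.Icc 1 (n - 1 * ℓ), step φ n i ^ (2 * s - 2 * ℓ) ∧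
      ∑ i ∈ Finset.Icc 1 (n - 1 * ℓ), step φ n i ^ (2 * s - 2 * ℓ) ≤
        (1 + ε) * ∑ i ∈ Finset.Icc 1 (n - 2 * ℓ), step φ n i ^ (2 * s - 2 * ℓ) := by
  obtain ⟨m, m', hm, hmm', hb⟩ := hφ.exists_bounds
  have hm' : 0 < m' := hm.trans_le hmm'
  set Λ : ℝ := (m' / m) ^ (2 * (ℓ : ℝ)) with hΛ
  have hlarge : ∀ᶠ n : ℕ in atTop, (ℓ * Λ / ε + 2 * ℓ + 1 : ℝ) < n :=
    tendsto_natCast_atTop_atTop.eventually_gt_atTop _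
  filter_upwards [hlarge] with n hn s hs
  have hΛ0 : 0 < Λ := by positivity
  have hn2 : 2 * ℓ + 1 < n := by
    have h : 0 < ℓ * Λ / ε := by positivity
    have : (2 * ℓ + 1 : ℝ) < n := by linarith
    exact_mod_cast this
  have hN : (0 : ℝ) < (n : ℝ) - 1 := by
    have : (1 : ℝ) < n := by exact_mod_cast (by omega : 1 < n)
    linarith
  have hstep : ∀ i ∈ Finset.Icc 1 (n - 1 * ℓ), m / ((n : ℝ) - 1) ≤ step φ n i ∧
      step φ n i ≤ m' / ((n : ℝ) - 1) := by
    intro i hi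
    rw [Finset.mem_Icc] at hi
    have h := hb n i (i + 1) hi.1 (by omega) (by omega)
    push_cast at h
    rw [add_sub_cancel_left, mul_one_div, mul_one_div] at h
    exact h
  have hstep0 : ∀ i ∈ Finset.Icc 1 (n - 1 * ℓ), 0 < step φ n i := fun i hi =>
    (div_pos hm hN).trans_le (hstep i hi).1
  have hsub : Finset.Icc 1 (n - 2 * ℓ) ⊆ Finset.Icc 1 (n - 1 * ℓ) :=
    Finset.Icc_subset_Icc le_rfl (by omega)
  have hcomp : ∀ i ∈ Finset.Icc 1 (n - 1 * ℓ), ∀ j ∈ Finset.Icc 1 (n - 1 * ℓ),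
      step φ n i ^ (2 * s - 2 * ℓ) ≤ Λ * step φ n j ^ (2 * s - 2 * ℓ) := by
    intro i hi j hj
    have h1 : m / m' * step φ n j ≤ step φ n i := by
      refine le_trans ?_ (hstep i hi).1
      calc m / m' * step φ n j ≤ m / m' * (m' / ((n : ℝ) - 1)) :=
            mul_le_mul_of_nonneg_left (hstep j hj).2 (by positivity)
        _ = m / ((n : ℝ) - 1) := by field_simp
    have hx : 2 * s - 2 * ℓ ≤ 0 := by linarith [hs.2]
    have hj0 := hstep0 j hj
    refine (Real.rpow_le_rpow_of_nonpos (by positivity) h1 hx).trans ?_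
    rw [Real.mul_rpow (by positivity) hj0.le]
    refine mul_le_mul_of_nonneg_right ?_ (by positivity)
    rw [hΛ, ← inv_div m' m, Real.inv_rpow (by positivity), ← Real.rpow_neg (by positivity)]
    refine Real.rpow_le_rpow_of_exponent_le ((one_le_div hm).mpr hmm') ?_
    linarith [hs.1]
  have hBpos : 0 < ∑ i ∈ Finset.Icc 1 (n - 2 * ℓ), step φ n i ^ (2 * s - 2 * ℓ) :=
    Finset.sum_pos (fun i hi => Real.rpow_pos_of_pos (hstep0 i (hsub hi)) _)
      ⟨1, by rw [Finset.mem_Icc]; omega⟩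
  refine ⟨hBpos, Finset.sum_le_sum_of_subset_of_nonneg hsub fun i hi _ =>
      (Real.rpow_pos_of_pos (hstep0 i hi) _).le, ?_⟩
  have hsplit := Finset.sum_sdiff (f := fun i => step φ n i ^ (2 * s - 2 * ℓ)) hsub
  set B := ∑ i ∈ Finset.Icc 1 (n - 2 * ℓ), step φ n i ^ (2 * s - 2 * ℓ) with hB
  have hterm : ∀ i ∈ Finset.Icc 1 (n - 1 * ℓ),
      ((n : ℝ) - 2 * ℓ) * step φ n i ^ (2 * s - 2 * ℓ) ≤ Λ * B := by
    intro i hi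
    have h := Finset.sum_le_sum fun j (hj : j ∈ Finset.Icc 1 (n - 2 * ℓ)) => hcomp i hi j (hsub hj)
    rw [Finset.sum_const, ← Finset.mul_sum, Nat.card_Icc, Nat.add_sub_cancel, nsmul_eq_mul,
      Nat.cast_sub (by omega)] at h
    push_cast at h
    exact h
  have hn2' : 0 < (n : ℝ) - 2 * ℓ := by
    have : (2 * ℓ : ℝ) < n := by exact_mod_cast (by omega : 2 * ℓ < n)
    linarith
  have hcard : (Finset.Icc 1 (n - 1 * ℓ) \ Finset.Icc 1 (n - 2 * ℓ)).card = ℓ := by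
    rw [Finset.card_sdiff_of_subset hsub, Nat.card_Icc, Nat.card_Icc]; omega
  suffices h : ∑ i ∈ Finset.Icc 1 (n - 1 * ℓ) \ Finset.Icc 1 (n - 2 * ℓ),
      step φ n i ^ (2 * s - 2 * ℓ) ≤ ε * B by linarith
  calc ∑ i ∈ Finset.Icc 1 (n - 1 * ℓ) \ Finset.Icc 1 (n - 2 * ℓ), step φ n i ^ (2 * s - 2 * ℓ)
      ≤ ∑ i ∈ Finset.Icc 1 (n - 1 * ℓ) \ Finset.Icc 1 (n - 2 * ℓ), Λ * B / ((n : ℝ) - 2 * ℓ) := by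
        refine Finset.sum_le_sum fun i hi => ?_
        rw [le_div_iff₀ hn2', mul_comm]
        exact hterm i (Finset.mem_sdiff.mp hi).1
    _ = ℓ * Λ / ((n : ℝ) - 2 * ℓ) * B := by
        rw [Finset.sum_const, hcard, nsmul_eq_mul]; ring
    _ ≤ ε * B := by
        refine mul_le_mul_of_nonneg_right ?_ hBpos.le
        rw [div_le_iff₀ hn2']
        have : ℓ * Λ / ε ≤ (n : ℝ) - 2 * ℓ := by linarith
        rw [div_le_iff₀ hε] at this
        linarith

/-- If `q` and `r` approximate `A * D` and `B * (κ * D)` up to small relative errors and `B` is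
close to `A`, then `r / q` is close to `κ`. -/
theorem abs_div_sub_le_of_approx {A B D κ ε q r : ℝ} (hB : 0 < B) (hBA : B ≤ A)
    (hAB : A ≤ (1 + ε) * B) (hD : 0 < D) (hκ : 0 < κ) (hκ1 : κ ≤ 1) (hε : 0 < ε) (hε4 : ε ≤ 1 / 4)
    (hq : |q - A * D| ≤ ε * (A * D)) (hr : |r - B * (κ * D)| ≤ ε * (B * (κ * D))) :
    |r / q - κ| ≤ 4 * ε := by
  have hA : 0 < A := hB.trans_le hBA
  have hAD : 0 < A * D := mul_pos hA hD
  rw [abs_le] at hq hr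
  have hq0 : 0 < q := by nlinarith
  have h1 : |r / q - κ| ≤ 4 * ε * κ := by
    have e : r / q - κ = (r - κ * q) / q := by field_simp
    rw [e, abs_div, abs_of_pos hq0, div_le_iff₀ hq0, abs_le]
    have hBD : 0 < κ * (B * D) := by positivity
    have hAD' : 0 < κ * (A * D) := by positivity
    have h2 : κ * (B * D) ≤ κ * (A * D) := by gcongr
    have h3 : κ * (A * D) ≤ (1 + ε) * (κ * (B * D)) := by
      calc κ * (A * D) ≤ κ * (((1 + ε) * B) * D) := by gcongr
        _ = _ := by ring
    have h4 : κ * q ≤ (1 + ε) * (κ * (A * D)) := by nlinarith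
    have h5 : (1 - ε) * (κ * (A * D)) ≤ κ * q := by nlinarith
    constructor
    · -- The worst case is `r = (1 - ε) κ B D` and `κ q = (1 + ε) κ A D`.
      have h6 : (1 - ε) * (κ * (B * D)) ≤ r := by linarith [hr.1]
      have h7 : (1 - ε) * (κ * (A * D)) ≤ (1 + ε) * ((1 - ε) * (κ * (B * D))) := by
        nlinarith
      nlinarith
    · have h6 : r ≤ (1 + ε) * (κ * (B * D)) := by linarith [hr.2]
      nlinarith
  refine h1.trans ?_
  nlinarith

theorem abs_sum_sub_le_of_approx {ι : Type*} (I : Finset ι) {q p : ι → ℝ} {D ε : ℝ}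
    (h : ∀ i ∈ I, |q i - p i * D| ≤ ε * (p i * D)) :
    |∑ i ∈ I, q i - (∑ i ∈ I, p i) * D| ≤ ε * ((∑ i ∈ I, p i) * D) := by
  rw [Finset.sum_mul, ← Finset.sum_sub_distrib, Finset.mul_sum]
  exact (Finset.abs_sum_le_sum_abs _ _).trans (Finset.sum_le_sum h)

/-- If the summands of two sums are asymptotically `(θ * step) ^ (2 * s - 2 * ℓ) * D`, for `θ = 2`
and `θ = 1`, then the ratio of the sums is asymptotically `2 ^ (2 * s - 2 * ℓ)`. -/
theorem IsDesign.eventually_abs_sum_div_sum_sub_le {φ : ℝ → ℝ} (hφ : IsDesign φ) {ℓ : ℕ}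
    (hℓ : 1 ≤ ℓ) {M : ℝ} (hM : M < ℓ) {ε : ℝ} (hε : 0 < ε) :
    ∃ η > 0, ∀ᶠ n : ℕ in atTop, ∀ s ∈ Set.Ioc 0 M, ∀ (D : ℝ) (q : ℕ → ℕ → ℝ), 0 < D →
      (∀ θ ∈ ({1, 2} : Set ℕ), ∀ i ∈ Finset.Icc 1 (n - θ * ℓ),
        |q θ i - step φ n i ^ (2 * s - 2 * ℓ) * (θ ^ (2 * s - 2 * ℓ) * D)| ≤
          η * (step φ n i ^ (2 * s - 2 * ℓ) * (θ ^ (2 * s - 2 * ℓ) * D))) →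
      |(∑ i ∈ Finset.Icc 1 (n - 2 * ℓ), q 2 i) / (∑ i ∈ Finset.Icc 1 (n - 1 * ℓ), q 1 i) -
        2 ^ (2 * s - 2 * ℓ)| ≤ ε := by
  refine ⟨min (ε / 4) (1 / 4), by positivity, ?_⟩
  filter_upwards [hφ.eventually_sum_step_rpow_le hℓ hM
    (by positivity : 0 < min (ε / 4) (1 / 4))] with n hn s hs D q hD hq
  obtain ⟨hB, hBA, hAB⟩ := hn s hs
  have h1 := abs_sum_sub_le_of_approx _ (hq 1 (by simp))
  have h2 := abs_sum_sub_le_of_approx _ (hq 2 (by simp))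
  simp only [Nat.cast_one, Real.one_rpow, one_mul] at h1
  have hκ1 : (2 : ℝ) ^ (2 * s - 2 * ℓ) ≤ 1 :=
    Real.rpow_le_one_of_one_le_of_nonpos (by norm_num) (by linarith [hs.2])
  have h3 := abs_div_sub_le_of_approx hB hBA (by simpa using hAB) hD
    (Real.rpow_pos_of_pos two_pos _) hκ1
    (by positivity : 0 < min (ε / 4) (1 / 4)) (min_le_right _ _)
    (by simpa using h1) (by simpa using h2)
  have h4 := min_le_left (ε / 4) (1 / 4)
  simp only [one_mul]
  linarith

theorem sum_sum_range_of_symm {h : ℕ → ℕ → ℝ} (hsymm : ∀ k j, h k j = h j k)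
    (hdiag : ∀ k, h k k = 0) (N : ℕ) : ∑ k ∈ Finset.range N, ∑ j ∈ Finset.range N, h k j =
      2 * ∑ k ∈ Finset.range N, ∑ j ∈ Finset.range k, h j k := by
  induction N with
  | zero => simp
  | succ N ih =>
    rw [Finset.sum_range_succ, Finset.sum_range_succ _ N, Finset.sum_range_succ _ N, hdiag]
    simp_rw [Finset.sum_range_succ, Finset.sum_add_distrib]
    rw [ih, Finset.sum_congr rfl fun j _ => hsymm N j]
    ring

/-- The double sum over `k₁ < k₂` in `f` is half of the full double sum, since `G s 0 = 0`. -/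
theorem f_eq {φ : ℝ → ℝ} (hφ : IsDesign φ) {n θ ℓ : ℕ} (hθ : 1 ≤ θ) (b : ℝ → ℝ) (s : ℝ) :
    f φ n θ ℓ b s =
      b s * ∑ i ∈ Finset.Icc 1 (n - θ * ℓ), doubleDiff ℓ (fun k => site φ n (i + θ * k)) s := by
  unfold f
  rw [mul_comm 2 (b s), mul_assoc, Finset.mul_sum]
  congr 1
  refine Finset.sum_congr rfl fun i hi => ?_
  rw [Finset.mem_Icc] at hi
  unfold doubleDiff
  rw [sum_sum_range_of_symm (fun k j => by rw [abs_sub_comm]; ring) (fun k => by simp [G])]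
  congr 1
  refine Finset.sum_congr rfl fun k hk => Finset.sum_congr rfl fun j hj => ?_
  rw [Finset.mem_range] at hk hj
  have hlt : site φ n (i + θ * j) < site φ n (i + θ * k) := by
    rcases Nat.eq_zero_or_pos ℓ with h0 | h0
    · omega
    have h1 : θ * ℓ < n := by omega
    exact hφ.strictMonoOn_site (ℓ := ℓ) hθ hi.1 (by omega) (by simp; omega) (by simp; omega) hj
  rw [abs_sub_comm, abs_of_pos (sub_pos.mpr hlt)]
  rfl

theorem IsDesign.strictMonoOn_of_mem_Icc {φ : ℝ → ℝ} (hφ : IsDesign φ) {n θ ℓ i : ℕ} (hθ : 1 ≤ θ)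
    (hℓ : 1 ≤ ℓ) (hi : i ∈ Finset.Icc 1 (n - θ * ℓ)) :
    StrictMonoOn (fun k => site φ n (i + θ * k)) (Set.Iic ℓ) := by
  rw [Finset.mem_Icc] at hi
  have := Nat.mul_le_mul hθ hℓ
  exact hφ.strictMonoOn_site hθ hi.1 (by omega)

/-- In the ratio both `b s` and the constant relating `G s` to the spectral integral cancel. -/
theorem f_div_f_eq {φ : ℝ → ℝ} (hφ : IsDesign φ) {n ℓ : ℕ} (hℓ : 1 ≤ ℓ) {b : ℝ → ℝ} {s : ℝ}
    (hs : 0 < s) (hsℓ : s < ℓ) (hb : b s ≠ 0) :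
    f φ n 2 ℓ b s / f φ n 1 ℓ b s =
      (∑ i ∈ Finset.Icc 1 (n - 2 * ℓ), spectralInt ℓ (fun k => site φ n (i + 2 * k)) s) /
      ∑ i ∈ Finset.Icc 1 (n - 1 * ℓ), spectralInt ℓ (fun k => site φ n (i + 1 * k)) s := by
  obtain ⟨c, hc⟩ := exists_spectralInt_eq hs hsℓ
  have hp := spectralInt_pos (strictMonoOn_natCast ℓ) hs hsℓ
  have hc0 : c ≠ 0 := by
    rintro rfl
    rw [hc _ (strictMonoOn_natCast ℓ), zero_mul] at hp
    exact lt_irrefl _ hp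
  rw [f_eq hφ one_le_two, f_eq hφ le_rfl, mul_div_mul_left _ _ hb,
    Finset.sum_congr rfl fun i hi => hc _ (hφ.strictMonoOn_of_mem_Icc one_le_two hℓ hi),
    Finset.sum_congr (g := fun i => c * _) rfl fun i hi =>
      hc _ (hφ.strictMonoOn_of_mem_Icc le_rfl hℓ hi),
    ← Finset.mul_sum, ← Finset.mul_sum, mul_div_mul_left _ _ hc0]

/-- The limit that defines `F` at `s = 0` exists. -/
theorem exists_tendsto_f_div_f {φ : ℝ → ℝ} (hφ : IsDesign φ) {n ℓ : ℕ} (hℓ : 1 ≤ ℓ)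
    (hn : 2 * ℓ + 1 ≤ n) {b : ℝ → ℝ} {M : ℝ} (hM : 0 < M) (hb : ∀ s ∈ Set.Ioc 0 M, b s ≠ 0) :
    ∃ L, Tendsto (fun δ => f φ n 2 ℓ b δ / f φ n 1 ℓ b δ) (𝓝[>] 0) (𝓝 L) := by
  have key : ∀ θ, 1 ≤ θ → Tendsto (fun δ => ∑ i ∈ Finset.Icc 1 (n - θ * ℓ),
      doubleDiff ℓ (fun k => site φ n (i + θ * k)) δ) (𝓝[>] 0)
      (𝓝 (∑ i ∈ Finset.Icc 1 (n - θ * ℓ),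
        -∑ k ∈ Finset.range (ℓ + 1), ddWeight ℓ (fun k => site φ n (i + θ * k)) k ^ 2)) := by
    intro θ hθ
    refine tendsto_finsetSum _ fun i hi => ?_
    have hmono := hφ.strictMonoOn_of_mem_Icc hθ hℓ hi
    exact tendsto_doubleDiff_zero hℓ (z := fun _ k => site φ n (i + θ * k)) hmono (fun _ => hmono)
      (fun _ _ => tendsto_const_nhds) tendsto_id
  have hne : ∑ i ∈ Finset.Icc 1 (n - 1 * ℓ),
        -∑ k ∈ Finset.range (ℓ + 1), ddWeight ℓ (fun k => site φ n (i + 1 * k)) k ^ 2 ≠ 0 := by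
    rw [Finset.sum_neg_distrib, neg_ne_zero]
    refine (Finset.sum_pos (fun i hi =>
      sum_ddWeight_sq_pos (hφ.strictMonoOn_of_mem_Icc le_rfl hℓ hi)) ⟨1, ?_⟩).ne'
    rw [Finset.mem_Icc]; omega
  refine ⟨_, ((key 2 one_le_two).div (key 1 le_rfl) hne).congr' ?_⟩
  filter_upwards [Ioc_mem_nhdsGT hM] with δ hδ
  rw [f_eq hφ one_le_two, f_eq hφ le_rfl, mul_div_mul_left _ _ (hb δ hδ)]
  rfl

/-- `F` converges to `s ↦ 2 ^ (2 * s - 2 * ℓ)` uniformly on `[0, M]`. -/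
theorem eventually_abs_F_sub_le {φ : ℝ → ℝ} (hφ : IsDesign φ) {ℓ : ℕ} (hℓ : 1 ≤ ℓ) {M : ℝ}
    (hM0 : 0 < M) (hM : M < ℓ) {b : ℝ → ℝ} (hb : ∀ s ∈ Set.Ioc 0 M, b s ≠ 0) {ε : ℝ} (hε : 0 < ε) :
    ∀ᶠ n : ℕ in atTop, ∀ s ∈ Set.Icc 0 M, |F φ n ℓ b s - 2 ^ (2 * s - 2 * ℓ)| ≤ ε := by
  obtain ⟨η, hη, hratio⟩ := hφ.eventually_abs_sum_div_sum_sub_le hℓ hM hε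
  filter_upwards [hratio, eventually_abs_spectralInt_sub_le hφ (le_refl 1) hℓ hM hη,
    eventually_abs_spectralInt_sub_le hφ one_le_two hℓ hM hη, eventually_ge_atTop (2 * ℓ + 1)]
    with n hn h1 h2 hnℓ
  have key : ∀ s ∈ Set.Ioc 0 M, |f φ n 2 ℓ b s / f φ n 1 ℓ b s - 2 ^ (2 * s - 2 * ℓ)| ≤ ε := by
    intro s hs
    rw [f_div_f_eq hφ hℓ hs.1 (hs.2.trans_lt hM) (hb s hs)]
    refine hn s hs _ (fun θ i => spectralInt ℓ (fun k => site φ n (i + θ * k)) s)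
      (spectralInt_pos (strictMonoOn_natCast ℓ) hs.1 (hs.2.trans_lt hM)) ?_
    rintro θ (rfl | rfl) i hi
    · rw [Finset.mem_Icc] at hi
      exact h1 i hi.1 (by omega) s hs
    · rw [Finset.mem_Icc] at hi
      exact h2 i hi.1 (by omega) s hs
  intro s hs
  rcases hs.1.eq_or_lt with rfl | h0
  · obtain ⟨L, hL⟩ := exists_tendsto_f_div_f hφ hℓ hnℓ hM0 hb
    rw [F, if_pos rfl, hL.limUnder_eq]
    have hpow : Tendsto (fun δ : ℝ => (2 : ℝ) ^ (2 * δ - 2 * ℓ)) (𝓝[>] 0)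
        (𝓝 (2 ^ (2 * (0 : ℝ) - 2 * ℓ))) := by
      have : Continuous fun δ : ℝ => (2 : ℝ) ^ (2 * δ - 2 * ℓ) :=
        Continuous.rpow continuous_const (by fun_prop) fun _ => Or.inl two_ne_zero
      exact (this.tendsto 0).mono_left nhdsWithin_le_nhds
    refine le_of_tendsto (hL.sub hpow).abs ?_
    filter_upwards [Ioc_mem_nhdsGT hM0] with δ hδ
    exact key δ hδ
  · rw [F, if_neg h0.ne']
    exact key s ⟨h0, hs.2⟩

/-! ### Concentration of Gaussian quadratic variations -/

theorem inv_sqrt_one_sub_le_exp {y : ℝ} (hy : |y| ≤ 1 / 2) :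
    (√(1 - y))⁻¹ ≤ Real.exp (y / 2 + y ^ 2) := by
  have hy' := abs_le.mp hy
  have h1 : 0 < 1 - y := by linarith
  have h := Real.abs_log_sub_add_sum_range_le (lt_of_le_of_lt hy (by norm_num)) 1
  simp only [Finset.range_one, Finset.sum_singleton, Nat.cast_zero, zero_add, pow_one, div_one] at h
  have h2 : |y| ^ (1 + 1) / (1 - |y|) ≤ 2 * y ^ 2 := by
    rw [div_le_iff₀ (by linarith), sq_abs]
    nlinarith [sq_nonneg y]
  have h3 := (abs_le.mp (h.trans h2)).1
  rw [← Real.exp_log (Real.sqrt_pos.mpr h1), ← Real.exp_neg, Real.log_sqrt h1.le]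
  exact Real.exp_le_exp.mpr (by linarith)

theorem integral_exp_mul_sq_gaussianReal {v : NNReal} (hv : v ≠ 0) {t : ℝ} (ht : 2 * t * v < 1) :
    ∫ x, Real.exp (t * x ^ 2) ∂(gaussianReal 0 v) = (√(1 - 2 * t * v))⁻¹ := by
  have hv0 : (0 : ℝ) < v := by positivity
  rw [integral_gaussianReal_eq_integral_smul hv]
  have e : ∀ x : ℝ, gaussianPDFReal 0 v x • Real.exp (t * x ^ 2) =
      (√(2 * Real.pi * v))⁻¹ * Real.exp (-((1 - 2 * t * v) / (2 * v)) * x ^ 2) := by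
    intro x
    rw [gaussianPDFReal, smul_eq_mul, mul_assoc, ← Real.exp_add]
    congr 2
    field_simp
    ring
  simp_rw [e]
  have h1 : 0 < 1 - 2 * t * v := by linarith
  rw [integral_const_mul, integral_gaussian, ← Real.sqrt_inv, ← Real.sqrt_mul (by positivity),
    ← Real.sqrt_inv]
  congr 1
  have := Real.pi_pos
  field_simp

/-- The cumulant generating function of the square of a centred normal variable of variance `v` is
`-log (1 - 2 * t * v) / 2`, which differs from `t * v` by `O((t * v) ^ 2)`. -/
theorem mgf_sq_le {Ω : Type*} [MeasurableSpace Ω] {P : Measure Ω} [IsProbabilityMeasure P]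
    {Z : Ω → ℝ} (hZ : HasGaussianLaw Z P) (h0 : ∫ ω, Z ω ∂P = 0) {t : ℝ}
    (ht : |t| * variance Z P ≤ 1 / 4) :
    0 < mgf (fun ω => Z ω ^ 2) P t ∧
      mgf (fun ω => Z ω ^ 2) P t ≤
        Real.exp (t * variance Z P + 4 * t ^ 2 * variance Z P ^ 2) := by
  have hmap := hZ.map_eq_gaussianReal
  have hv0 := variance_nonneg Z P
  rw [h0] at hmap
  have e : mgf (fun ω => Z ω ^ 2) P t =
      ∫ x, Real.exp (t * x ^ 2) ∂(gaussianReal 0 (variance Z P).toNNReal) := by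
    rw [← hmap, integral_map hZ.aemeasurable (by fun_prop)]
    rfl
  rcases hv0.eq_or_lt with hv | hv
  · rw [e, ← hv]
    simp
  · have hvn : (variance Z P).toNNReal ≠ 0 := by simpa using hv
    have habs : |2 * t * variance Z P| ≤ 1 / 2 := by
      rw [abs_mul, abs_mul, abs_of_pos hv, abs_two]; linarith
    have hlt : 2 * t * variance Z P < 1 := by
      have := (abs_le.mp habs).2; linarith
    rw [e, integral_exp_mul_sq_gaussianReal hvn (by rwa [Real.coe_toNNReal _ hv0]),
      Real.coe_toNNReal _ hv0]
    refine ⟨inv_pos.mpr (Real.sqrt_pos.mpr (by linarith)),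
      (inv_sqrt_one_sub_le_exp habs).trans (le_of_eq ?_)⟩
    congr 1
    ring

open Matrix in
/-- Rotating a Gaussian vector to the principal axes of its covariance matrix gives independent
coordinates with the same sum of squares. -/
theorem exists_indep_sum_sq_eq {ι Ω : Type*} [Fintype ι] [MeasurableSpace Ω] {P : Measure Ω}
    [IsProbabilityMeasure P] {Y : ι → Ω → ℝ} (hY : HasGaussianLaw (fun ω i => Y i ω) P)
    (h0 : ∀ i, ∫ ω, Y i ω ∂P = 0) {R : ℝ}
    (hrow : ∀ i, ∑ j, |covariance (Y i) (Y j) P| ≤ R) :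
    ∃ Z : ι → Ω → ℝ, (∀ a, HasGaussianLaw (Z a) P) ∧ (∀ a, ∫ ω, Z a ω ∂P = 0) ∧
      iIndepFun Z P ∧ (∀ ω, ∑ a, Z a ω ^ 2 = ∑ i, Y i ω ^ 2) ∧
      (∀ a, variance (Z a) P ≤ R) ∧
      ∑ a, variance (Z a) P = ∑ i, covariance (Y i) (Y i) P := by
  classical
  set A : Matrix ι ι ℝ := Matrix.of fun i j => covariance (Y i) (Y j) P with hA
  have hH : A.IsHermitian := by
    ext i j
    simp [hA, covariance_comm]
  set u : ι → ι → ℝ := fun a i => hH.eigenvectorBasis a i with hu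
  have hortho : ∀ a b, ∑ i, u a i * u b i = if a = b then 1 else 0 := by
    intro a b
    have h := orthonormal_iff_ite.mp hH.eigenvectorBasis.orthonormal a b
    rw [PiLp.inner_apply] at h
    rw [← h]
    exact Finset.sum_congr rfl fun i _ => by simp [hu, mul_comm]
  have hortho' : ∀ i j, ∑ a, u a i * u a j = if i = j then 1 else 0 := by
    intro i j
    have h := Unitary.coe_mul_star_self hH.eigenvectorUnitary
    have h2 := congrFun (congrFun h i) j
    rw [Matrix.mul_apply, Matrix.one_apply] at h2
    rw [← h2]
    exact Finset.sum_congr rfl fun a _ => by simp [hu, Matrix.star_apply]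
  have heig : ∀ b i, ∑ j, covariance (Y i) (Y j) P * u b j = hH.eigenvalues b * u b i := by
    intro b i
    have h := congrFun (hH.mulVec_eigenvectorBasis b) i
    simpa [Matrix.mulVec, dotProduct, hA] using h
  have hLp : ∀ i, MemLp (Y i) 2 P := fun i => (hY.eval i).memLp_two
  set Z : ι → Ω → ℝ := fun a ω => ∑ i, u a i * Y i ω with hZ
  have hcov : ∀ a b, covariance (Z a) (Z b) P = if a = b then hH.eigenvalues b else 0 := by
    intro a b
    rw [hZ]
    rw [covariance_fun_sum_fun_sum (fun i => (hLp i).const_mul _) (fun i => (hLp i).const_mul _)]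
    have h1 : ∀ i j, covariance (fun ω => u a i * Y i ω) (fun ω => u b j * Y j ω) P =
        u a i * (covariance (Y i) (Y j) P * u b j) := by
      intro i j
      rw [covariance_const_mul_left, covariance_const_mul_right]
      ring
    simp_rw [h1, ← Finset.mul_sum, heig]
    have h2 : ∀ i, u a i * (hH.eigenvalues b * u b i) = hH.eigenvalues b * (u a i * u b i) :=
      fun i => by ring
    simp_rw [h2, ← Finset.mul_sum, hortho]
    simp
  have hZlaw : HasGaussianLaw (fun ω a => Z a ω) P := by
    have h := hY.map_fun (Matrix.toLin' (Matrix.of u)).toContinuousLinearMap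
    have e : (fun ω a => Z a ω) =
        fun ω => (Matrix.toLin' (Matrix.of u)).toContinuousLinearMap (fun i => Y i ω) := by
      funext ω a
      simp [hZ, Matrix.mulVec, dotProduct]
    rw [e]
    exact h
  have hvar : ∀ a, variance (Z a) P = hH.eigenvalues a := by
    intro a
    rw [← covariance_self (hZlaw.eval a).aemeasurable, hcov, if_pos rfl]
  refine ⟨Z, fun a => hZlaw.eval a, fun a => ?_, ?_, fun ω => ?_, fun a => ?_, ?_⟩
  · simp only [hZ]
    rw [integral_finsetSum _ fun i _ => (hY.eval i).integrable.const_mul _]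
    refine Finset.sum_eq_zero fun i _ => ?_
    rw [integral_const_mul, h0, mul_zero]
  · exact hZlaw.iIndepFun_of_covariance_eq_zero fun a b hab => by rw [hcov, if_neg hab]
  · have h1 : ∀ a, Z a ω ^ 2 = ∑ i, ∑ j, (Y i ω * Y j ω) * (u a i * u a j) := by
      intro a
      rw [sq, hZ, Finset.sum_mul_sum]
      exact Finset.sum_congr rfl fun i _ => Finset.sum_congr rfl fun j _ => by ring
    simp_rw [h1]
    rw [Finset.sum_comm]
    refine Finset.sum_congr rfl fun i _ => ?_
    rw [Finset.sum_comm]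
    simp_rw [← Finset.mul_sum, hortho']
    simp [sq]
  · rw [hvar]
    have hev : Module.End.HasEigenvalue (Matrix.toLin' A) (hH.eigenvalues a) := by
      refine Module.End.hasEigenvalue_of_hasEigenvector (x := u a) ⟨?_, ?_⟩
      · rw [Module.End.mem_eigenspace_iff, Matrix.toLin'_apply]
        exact hH.mulVec_eigenvectorBasis a
      · intro h
        have := hortho a a
        simp [h] at this
    obtain ⟨k, hk⟩ := eigenvalue_mem_ball hev
    rw [Metric.mem_closedBall, Real.dist_eq] at hk
    have h1 := hrow k
    rw [← Finset.add_sum_erase _ _ (Finset.mem_univ k)] at h1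
    have h2 : A k k ≤ |covariance (Y k) (Y k) P| := le_abs_self _
    have h3 : ∑ j ∈ Finset.univ.erase k, ‖A k j‖ =
      ∑ j ∈ Finset.univ.erase k, |covariance (Y k) (Y j) P| := rfl
    linarith [(abs_le.mp hk).2]
  · simp_rw [hvar]
    have h := hH.trace_eq_sum_eigenvalues
    simp only [Matrix.trace, Matrix.diag_apply, hA, Matrix.of_apply, RCLike.ofReal_real_eq_id,
      id_eq] at h
    exact h.symm

/-- The exponent of Chernoff's bound at the value `t = ε / (8 * R)`, which minimises
`-t * (ε * T) + 4 * t ^ 2 * (R * T)`. -/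
theorem exp_tail_bound {ε R T : ℝ} (hR : 0 < R) :
    Real.exp (-(ε / (8 * R)) * (ε * T)) * Real.exp (4 * (ε / (8 * R)) ^ 2 * (R * T)) =
      Real.exp (-(ε ^ 2 * T / (16 * R))) := by
  rw [← Real.exp_add]
  congr 1
  field_simp
  ring

/-- A Gaussian quadratic form concentrates around its mean at an exponential rate, governed by the
ratio of the mean to a bound `R` of the row sums of the covariance matrix. -/
theorem measureReal_abs_sum_sq_sub_ge_le {ι Ω : Type*} [Fintype ι] [MeasurableSpace Ω]
    {P : Measure Ω} [IsProbabilityMeasure P] {Y : ι → Ω → ℝ}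
    (hY : HasGaussianLaw (fun ω i => Y i ω) P)
    (h0 : ∀ i, ∫ ω, Y i ω ∂P = 0) {R : ℝ} (hR : 0 < R)
    (hrow : ∀ i, ∑ j, |covariance (Y i) (Y j) P| ≤ R) {ε : ℝ} (hε : 0 < ε) (hε1 : ε ≤ 1) {T : ℝ}
    (hT : T = ∑ i, covariance (Y i) (Y i) P) :
    P.real {ω | ε * T ≤ |∑ i, Y i ω ^ 2 - T|} ≤ 2 * Real.exp (-(ε ^ 2 * T / (16 * R))) := by
  obtain ⟨Z, hZ, hZ0, hind, hsq, hvar, hsum⟩ := exists_indep_sum_sq_eq hY h0 hrow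
  rw [← hT] at hsum
  have hind2 : iIndepFun (fun a ω => Z a ω ^ 2) P :=
    hind.comp (fun _ x => x ^ 2) (fun _ => by fun_prop)
  set S : Ω → ℝ := ∑ a, fun ω => Z a ω ^ 2 with hS
  have hSY : ∀ ω, S ω = ∑ i, Y i ω ^ 2 := fun ω => by rw [hS, Finset.sum_apply, hsq]
  -- The moment generating function of the centred form is at most `exp (4 t² R T)`.
  have hmgf : ∀ t : ℝ, |t| ≤ 1 / (4 * R) → 0 < mgf S P t ∧
      mgf S P t ≤ Real.exp (t * T) * Real.exp (4 * t ^ 2 * (R * T)) := by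
    intro t ht
    have h1 : ∀ a, |t| * variance (Z a) P ≤ 1 / 4 := by
      intro a
      calc |t| * variance (Z a) P ≤ 1 / (4 * R) * R := by
            exact mul_le_mul ht (hvar a) (variance_nonneg _ _) (by positivity)
        _ = 1 / 4 := by field_simp
    have h2 : mgf S P t = ∏ a, mgf (fun ω => Z a ω ^ 2) P t :=
      hind2.mgf_sum₀ (fun a => (hZ a).aemeasurable.pow_const 2) _
    rw [h2]
    refine ⟨Finset.prod_pos fun a _ => (mgf_sq_le (hZ a) (hZ0 a) (h1 a)).1, ?_⟩
    refine (Finset.prod_le_prod (fun a _ => (mgf_sq_le (hZ a) (hZ0 a) (h1 a)).1.le)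
      fun a _ => (mgf_sq_le (hZ a) (hZ0 a) (h1 a)).2).trans ?_
    rw [← Real.exp_sum, ← Real.exp_add, Finset.sum_add_distrib, ← Finset.mul_sum, hsum]
    refine Real.exp_le_exp.mpr ?_
    gcongr
    rw [← Finset.mul_sum]
    gcongr
    rw [← hsum, Finset.mul_sum]
    refine Finset.sum_le_sum fun a _ => ?_
    rw [sq]
    exact mul_le_mul_of_nonneg_right (hvar a) (variance_nonneg _ _)
  have hint : ∀ t : ℝ, |t| ≤ 1 / (4 * R) → Integrable (fun ω => Real.exp (t * S ω)) P := by
    intro t ht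
    -- If the exponential were not integrable, its integral would have the junk value `0`.
    by_contra hni
    have h := (hmgf t ht).1
    rw [mgf, integral_undef hni] at h
    exact lt_irrefl _ h
  set t := ε / (8 * R) with ht
  have ht0 : 0 < t := by positivity
  have htR : t ≤ 1 / (4 * R) := by
    rw [ht, div_le_div_iff₀ (by positivity) (by positivity)]
    nlinarith
  have hup : P.real {ω | T + ε * T ≤ S ω} ≤ Real.exp (-(ε ^ 2 * T / (16 * R))) := by
    have habs : |t| ≤ 1 / (4 * R) := by rwa [abs_of_pos ht0]
    refine (measure_ge_le_exp_mul_mgf _ ht0.le (hint t habs)).trans ?_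
    refine (mul_le_mul_of_nonneg_left (hmgf t habs).2 (Real.exp_pos _).le).trans (le_of_eq ?_)
    rw [← exp_tail_bound hR, ← ht, ← mul_assoc, ← Real.exp_add]
    congr 2
    ring
  have hlow : P.real {ω | S ω ≤ T - ε * T} ≤ Real.exp (-(ε ^ 2 * T / (16 * R))) := by
    have habs : |-t| ≤ 1 / (4 * R) := by rwa [abs_neg, abs_of_pos ht0]
    refine (measure_le_le_exp_mul_mgf _ (by linarith) (hint (-t) habs)).trans ?_
    refine (mul_le_mul_of_nonneg_left (hmgf (-t) habs).2 (Real.exp_pos _).le).trans (le_of_eq ?_)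
    rw [← exp_tail_bound hR, ← ht, ← mul_assoc, ← Real.exp_add, neg_sq]
    congr 2
    ring
  have hsub : {ω | ε * T ≤ |∑ i, Y i ω ^ 2 - T|} ⊆
      {ω | T + ε * T ≤ S ω} ∪ {ω | S ω ≤ T - ε * T} := by
    intro ω hω
    have hω' : ε * T ≤ |∑ i, Y i ω ^ 2 - T| := hω
    rw [← hSY] at hω'
    rcases le_abs.mp hω' with h | h
    · left; show T + ε * T ≤ S ω; linarith
    · right; show S ω ≤ T - ε * T; linarith
  calc P.real {ω | ε * T ≤ |∑ i, Y i ω ^ 2 - T|}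
      ≤ P.real ({ω | T + ε * T ≤ S ω} ∪ {ω | S ω ≤ T - ε * T}) := measureReal_mono hsub
    _ ≤ P.real {ω | T + ε * T ≤ S ω} + P.real {ω | S ω ≤ T - ε * T} := measureReal_union_le _ _
    _ ≤ _ := by linarith

/-! ### Covariances of the generalised differences -/

/-- The covariance of the generalised differences at `i` and `i'`, for a process with covariance
function `(x, y) ↦ Kt (x - y)`. -/
def nablaCov (φ : ℝ → ℝ) (n θ ℓ : ℕ) (Kt : ℝ → ℝ) (i i' : ℕ) : ℝ :=
  ∑ k ∈ Finset.range (ℓ + 1), ∑ j ∈ Finset.range (ℓ + 1),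
    a φ n θ ℓ i k * a φ n θ ℓ i' j * Kt (site φ n (i + θ * k) - site φ n (i' + θ * j))

theorem a_eq_ddWeight (φ : ℝ → ℝ) (n θ ℓ i k : ℕ) :
    a φ n θ ℓ i k = ddWeight ℓ (fun j => site φ n (i + θ * j)) k := rfl

theorem abs_ddWeight_le {ℓ : ℕ} {v : ℕ → ℝ} {μ : ℝ} (hμ : 0 < μ)
    (hv : ∀ k ≤ ℓ, ∀ j ≤ ℓ, j ≠ k → μ ≤ |v k - v j|) {k : ℕ} (hk : k ≤ ℓ) :
    |ddWeight ℓ v k| ≤ ℓ.factorial / μ ^ ℓ := by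
  unfold ddWeight
  rw [abs_div, Nat.abs_cast, Finset.abs_prod]
  have hcard : ((Finset.range (ℓ + 1)).erase k).card = ℓ := by
    rw [Finset.card_erase_of_mem (by simp; omega)]; simp
  refine div_le_div_of_nonneg_left (by positivity) (by positivity) ?_
  calc μ ^ ℓ = ∏ _j ∈ (Finset.range (ℓ + 1)).erase k, μ := by rw [Finset.prod_const, hcard]
    _ ≤ _ := Finset.prod_le_prod (fun _ _ => hμ.le) fun j hj => by
        simp only [Finset.mem_erase, Finset.mem_range] at hj
        exact hv k hk j (by omega) hj.1

theorem contDiffOn_iteratedDeriv {U : Set ℝ} (hU : IsOpen U) {m k : ℕ} {K : ℝ → ℝ}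
    (hK : ContDiffOn ℝ ((m + k : ℕ) : WithTop ℕ∞) K U) : ContDiffOn ℝ m (iteratedDeriv k K) U := by
  induction k generalizing K with
  | zero => simpa using hK
  | succ k ih =>
    rw [iteratedDeriv_succ']
    exact ih (hK.deriv_of_isOpen hU (by norm_cast))

/-- The mean value theorem for divided differences, applied in both variables. -/
theorem exists_sum_sum_ddWeight_eq {K : ℝ → ℝ} {c d : ℝ} {ℓ : ℕ}
    (hK : ContDiffOn ℝ ((2 * ℓ : ℕ) : WithTop ℕ∞) K (Set.Ioo c d)) {u v : ℕ → ℝ}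
    (hu : StrictMonoOn u (Set.Iic ℓ)) (hv : StrictMonoOn v (Set.Iic ℓ))
    (hc : c < u 0 - v ℓ) (hd : u ℓ - v 0 < d) :
    ∃ t ∈ Set.Icc (u 0 - v ℓ) (u ℓ - v 0),
      ∑ k ∈ Finset.range (ℓ + 1), ∑ j ∈ Finset.range (ℓ + 1),
        ddWeight ℓ v k * ddWeight ℓ u j * K (u j - v k) = (-1) ^ ℓ * iteratedDeriv (2 * ℓ) K t := by
  have hu0 : ∀ j ≤ ℓ, u 0 ≤ u j := fun j hj =>
    hu.monotoneOn (by simp) (by simpa using hj) (by omega)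
  have hu1 : ∀ j ≤ ℓ, u j ≤ u ℓ := fun j hj => hu.monotoneOn (by simpa using hj) (by simp) hj
  have hKℓ : ContDiffOn ℝ ℓ K (Set.Ioo c d) := hK.of_le (by norm_cast; omega)
  have hterm : ∀ j ≤ ℓ, ContDiffOn ℝ ℓ (fun x => K (u j - x)) (Set.Ioo (u ℓ - d) (u 0 - c)) := by
    intro j hj
    refine hKℓ.comp (contDiff_const.sub contDiff_id).contDiffOn fun x hx => ⟨?_, ?_⟩
    · have := hx.2; have := hu0 j hj; linarith
    · have := hx.1; have := hu1 j hj; linarith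
  obtain ⟨ξ, hξ, h1⟩ := exists_sum_ddWeight_eq (isOpen_Ioo (a := u ℓ - d) (b := u 0 - c)) hv
    (fun x hx => ⟨by linarith [hx.1], by linarith [hx.2]⟩)
    (g := fun x => ∑ j ∈ Finset.range (ℓ + 1), ddWeight ℓ u j * K (u j - x))
    (ContDiffOn.sum fun j hj => contDiffOn_const.mul (hterm j (by simp at hj; omega)))
  have hξU : ξ ∈ Set.Ioo (u ℓ - d) (u 0 - c) := ⟨by linarith [hξ.1], by linarith [hξ.2]⟩
  have hat : ∀ j ≤ ℓ, ContDiffAt ℝ ℓ (fun x => K (u j - x)) ξ := fun j hj =>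
    (hterm j hj).contDiffAt (isOpen_Ioo.mem_nhds hξU)
  rw [iteratedDeriv_fun_sum fun j hj =>
    contDiffAt_const.mul (hat j (by simp at hj; omega))] at h1
  have h2 : ∀ j ∈ Finset.range (ℓ + 1), iteratedDeriv ℓ (fun x => ddWeight ℓ u j * K (u j - x)) ξ =
      (-1) ^ ℓ * (ddWeight ℓ u j * iteratedDeriv ℓ K (u j - ξ)) := by
    intro j hj
    rw [iteratedDeriv_const_mul_field, iteratedDeriv_comp_const_sub]
    simp only [smul_eq_mul]
    ring
  rw [Finset.sum_congr rfl h2, ← Finset.mul_sum] at h1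
  have hKder : ContDiffOn ℝ ℓ (iteratedDeriv ℓ K) (Set.Ioo c d) :=
    contDiffOn_iteratedDeriv isOpen_Ioo (by rwa [← two_mul])
  obtain ⟨η, hη, h3⟩ := exists_sum_ddWeight_eq (isOpen_Ioo (a := c + ξ) (b := d + ξ)) hu
    (fun x hx => ⟨by linarith [hx.1, hξ.2], by linarith [hx.2, hξ.1]⟩)
    (g := fun y => iteratedDeriv ℓ K (y - ξ))
    (hKder.comp (contDiff_id.sub contDiff_const).contDiffOn fun x hx =>
      ⟨by linarith [hx.1], by linarith [hx.2]⟩)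
  rw [iteratedDeriv_comp_sub_const] at h3
  refine ⟨η - ξ, ⟨by linarith [hη.1, hξ.2], by linarith [hη.2, hξ.1]⟩, ?_⟩
  have h4 : iteratedDeriv (2 * ℓ) K = iteratedDeriv ℓ (iteratedDeriv ℓ K) := by
    rw [iteratedDeriv_eq_iterate, iteratedDeriv_eq_iterate, iteratedDeriv_eq_iterate, two_mul,
      Function.iterate_add_apply]
  have h5 : _ = iteratedDeriv ℓ (iteratedDeriv ℓ K) (η - ξ) := h3
  rw [h4, ← h5, ← h1]
  refine Finset.sum_congr rfl fun k _ => ?_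
  rw [Finset.mul_sum]
  exact Finset.sum_congr rfl fun j _ => by ring

/-- Decay of the covariances away from the diagonal: the mean value theorem reduces them to the
derivative of order `2 * ℓ` at a point no smaller than the gap between the two blocks of sites. -/
theorem exists_abs_nablaCov_le {φ Kt : ℝ → ℝ} (hφ : IsDesign φ) {ν : ℝ} {ℓ : ℕ} (hℓ : 1 ≤ ℓ)
    (hνℓ : ν < ℓ)
    (hsmooth : ∃ c d : ℝ, Set.Ioc (0 : ℝ) 1 ⊆ Set.Ioo c d ∧
      ContDiffOn ℝ ((2 * ℓ : ℕ) : WithTop ℕ∞) Kt (Set.Ioo c d))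
    (hbound : ∃ C : ℝ, ∀ t ∈ Set.Ioc (0 : ℝ) 1,
      |iteratedDeriv (2 * ℓ) Kt t| ≤ C * t ^ (2 * ν - 2 * ℓ)) :
    ∃ C : ℝ, 0 ≤ C ∧ ∀ n θ i i' : ℕ, 1 ≤ θ → 1 ≤ i → i + θ * ℓ < i' → i' + θ * ℓ ≤ n →
      |nablaCov φ n θ ℓ Kt i' i| ≤
        C * (((i' : ℝ) - i - θ * ℓ) / ((n : ℝ) - 1)) ^ (2 * ν - 2 * ℓ) := by
  obtain ⟨c, d, hcd, hK⟩ := hsmooth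
  obtain ⟨C, hC⟩ := hbound
  obtain ⟨m, m', hm, -, hb⟩ := hφ.exists_bounds
  have hC0 : 0 ≤ C := by
    have := (abs_nonneg _).trans (hC 1 ⟨one_pos, le_rfl⟩)
    simpa using this
  have hc0 : c ≤ 0 := by
    by_contra! h
    have h1 : min c 1 ∈ Set.Ioc (0 : ℝ) 1 := ⟨by positivity, min_le_right _ _⟩
    exact absurd (hcd h1).1 (not_lt.mpr (min_le_left _ _))
  have hd1 : 1 < d := (hcd ⟨one_pos, le_rfl⟩).2
  refine ⟨C * m ^ (2 * ν - 2 * ℓ), by positivity, fun n θ i i' hθ hi hii' hi'n => ?_⟩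
  have hθℓ := Nat.mul_le_mul hθ hℓ
  have hu := hφ.strictMonoOn_site (n := n) (θ := θ) (ℓ := ℓ) (i := i') hθ (by omega) hi'n
  have hv := hφ.strictMonoOn_site (n := n) (θ := θ) (ℓ := ℓ) (i := i) hθ hi (by omega)
  have hlow := (hb n (i + θ * ℓ) i' (by omega) (by omega) (by omega)).1
  have hgap : (0 : ℝ) < ((i' : ℝ) - i - θ * ℓ) / ((n : ℝ) - 1) := by
    refine div_pos ?_ ?_
    · have : ((i + θ * ℓ : ℕ) : ℝ) < i' := by exact_mod_cast hii'
      push_cast at this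
      linarith
    · have : (1 : ℝ) < n := by exact_mod_cast (by omega : 1 < n)
      linarith
  have hlow' : m * (((i' : ℝ) - i - θ * ℓ) / ((n : ℝ) - 1)) ≤
      site φ n (i' + θ * 0) - site φ n (i + θ * ℓ) := by
    refine le_trans (le_of_eq ?_) hlow
    push_cast
    ring
  have hpos : 0 < site φ n (i' + θ * 0) - site φ n (i + θ * ℓ) :=
    (mul_pos hm hgap).trans_le hlow'
  have hle1 : site φ n (i' + θ * ℓ) - site φ n (i + θ * 0) ≤ 1 := by
    have h1 := (hφ.site_mem_Icc (n := n) (i := i' + θ * ℓ) (by omega) (by omega) hi'n).2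
    have h2 := (hφ.site_mem_Icc (n := n) (i := i + θ * 0) (by omega) (by omega) (by omega)).1
    linarith
  obtain ⟨t, ht, h⟩ := exists_sum_sum_ddWeight_eq hK hu hv (by linarith) (by linarith)
  have e : nablaCov φ n θ ℓ Kt i' i = (-1) ^ ℓ * iteratedDeriv (2 * ℓ) Kt t := by
    rw [← h, nablaCov, Finset.sum_comm]
    refine Finset.sum_congr rfl fun k _ => Finset.sum_congr rfl fun j _ => ?_
    rw [a_eq_ddWeight, a_eq_ddWeight]
    ring
  have ht0 : 0 < t := hpos.trans_le ht.1
  rw [e, abs_mul, abs_pow, abs_neg, abs_one, one_pow, one_mul]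
  refine (hC t ⟨ht0, ht.2.trans hle1⟩).trans ?_
  rw [mul_assoc, ← Real.mul_rpow hm.le hgap.le]
  exact mul_le_mul_of_nonneg_left (Real.rpow_le_rpow_of_nonpos (mul_pos hm hgap)
    (hlow'.trans ht.1) (by linarith)) hC0

/-- The remainder `r` of the covariance function contributes less than the order of the variances
by a factor `n ^ (-τ)`. -/
theorem exists_eventually_abs_sum_sum_mul_le {φ : ℝ → ℝ} (hφ : IsDesign φ) {ν τ : ℝ} (hν : 0 < ν)
    (hτ : 0 < τ) (ℓ : ℕ) (hℓ : 1 ≤ ℓ) {r : ℝ → ℝ → ℝ}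
    (hr : (fun p : ℝ × ℝ => r p.1 p.2) =O[comap (fun p : ℝ × ℝ => |p.1 - p.2|) (𝓝 0)]
      (fun p : ℝ × ℝ => |p.1 - p.2| ^ (2 * ν + τ))) :
    ∃ C : ℝ, 0 ≤ C ∧ ∀ᶠ n : ℕ in atTop, ∀ θ ∈ ({1, 2} : Set ℕ), ∀ i ∈ Finset.Icc 1 (n - θ * ℓ),
      |∑ k ∈ Finset.range (ℓ + 1), ∑ j ∈ Finset.range (ℓ + 1),
        a φ n θ ℓ i k * a φ n θ ℓ i j * r (site φ n (i + θ * k)) (site φ n (i + θ * j))| ≤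
        C * ((n : ℝ) - 1) ^ (2 * ℓ - 2 * ν - τ) := by
  obtain ⟨m, m', hm, hmm', hb⟩ := hφ.exists_bounds
  have hm' : 0 < m' := hm.trans_le hmm'
  obtain ⟨C, hC0, hC⟩ := hr.exists_pos
  rw [Asymptotics.IsBigOWith, eventually_comap] at hC
  obtain ⟨δ, hδ, hball⟩ := Metric.eventually_nhds_iff.mp hC
  have hlarge : ∀ᶠ n : ℕ in atTop, (2 * ℓ * m' / δ + 2 * ℓ + 1 : ℝ) < n :=
    tendsto_natCast_atTop_atTop.eventually_gt_atTop _
  refine ⟨((ℓ : ℝ) + 1) ^ 2 * ((ℓ.factorial : ℝ) / m ^ ℓ) ^ 2 * C * (2 * ℓ * m') ^ (2 * ν + τ),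
    by positivity, ?_⟩
  filter_upwards [hlarge] with n hn θ hθ i hi
  have hθ1 : 1 ≤ θ := by rcases hθ with rfl | rfl <;> norm_num
  have hθ2 : θ ≤ 2 := by rcases hθ with rfl | rfl <;> norm_num
  have hθℓ : θ * ℓ ≤ 2 * ℓ := Nat.mul_le_mul_right ℓ hθ2
  have hN : 0 < (n : ℝ) - 1 := by
    have : 0 < 2 * ℓ * m' / δ := by positivity
    have : (0 : ℝ) ≤ ℓ := by positivity
    linarith
  rw [Finset.mem_Icc] at hi
  have hθℓ1 := Nat.mul_le_mul hθ1 hℓ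
  have hin : i + θ * ℓ ≤ n := by omega
  -- The sites involved are at distance of order `1 / n` from one another, so that the asymptotic
  -- bound on `r` applies and the weights are of order `n ^ ℓ`.
  have hmk : ∀ k ≤ ℓ, θ * k ≤ θ * ℓ := fun k hk => Nat.mul_le_mul_left θ hk
  have hdist : ∀ k ≤ ℓ, ∀ j < k, m / ((n : ℝ) - 1) ≤ site φ n (i + θ * k) - site φ n (i + θ * j) ∧
      site φ n (i + θ * k) - site φ n (i + θ * j) ≤ 2 * ℓ * m' / ((n : ℝ) - 1) := by
    intro k hk j hj
    have hmono : θ * j < θ * k := Nat.mul_lt_mul_of_pos_left hj hθ1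
    have h := hb n (i + θ * j) (i + θ * k) (by omega) (by omega) (by have := hmk k hk; omega)
    have e : (((i + θ * k : ℕ) : ℝ) - ((i + θ * j : ℕ) : ℝ)) = ((θ * k - θ * j : ℕ) : ℝ) := by
      rw [Nat.cast_sub hmono.le]; push_cast; ring
    rw [e] at h
    have h1 : (1 : ℝ) ≤ ((θ * k - θ * j : ℕ) : ℝ) := by exact_mod_cast (by omega)
    have h2 : ((θ * k - θ * j : ℕ) : ℝ) ≤ 2 * ℓ := by
      have := hmk k hk
      exact_mod_cast (by omega : θ * k - θ * j ≤ 2 * ℓ)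
    constructor
    · refine le_trans ?_ h.1
      rw [div_eq_mul_one_div]
      gcongr
    · refine h.2.trans (le_trans (b := m' * (2 * ℓ / ((n : ℝ) - 1))) ?_ (le_of_eq (by ring)))
      gcongr
  have hsep : ∀ k ≤ ℓ, ∀ j ≤ ℓ, j ≠ k → m / ((n : ℝ) - 1) ≤
      |site φ n (i + θ * k) - site φ n (i + θ * j)| := by
    intro k hk j hj hjk
    rcases lt_or_gt_of_ne hjk with h | h
    · exact (hdist k hk j h).1.trans (le_abs_self _)
    · rw [abs_sub_comm]
      exact (hdist j hj k h).1.trans (le_abs_self _)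
  have hnear : ∀ k ≤ ℓ, ∀ j ≤ ℓ, |site φ n (i + θ * k) - site φ n (i + θ * j)| ≤
      2 * ℓ * m' / ((n : ℝ) - 1) := by
    intro k hk j hj
    have hμ : 0 < m / ((n : ℝ) - 1) := by positivity
    rcases lt_trichotomy j k with h | rfl | h
    · have := hdist k hk j h
      rw [abs_of_nonneg (by linarith)]
      exact this.2
    · rw [sub_self, abs_zero]; positivity
    · have := hdist j hj k h
      rw [abs_sub_comm, abs_of_nonneg (by linarith)]
      exact this.2
  have hlt : 2 * ℓ * m' / ((n : ℝ) - 1) < δ := by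
    have h1 : 2 * ℓ * m' / δ < (n : ℝ) - 1 := by
      have : (0 : ℝ) ≤ ℓ := by positivity
      linarith
    rw [div_lt_iff₀ hδ] at h1
    rw [div_lt_iff₀ hN]
    linarith
  have hrb : ∀ k ≤ ℓ, ∀ j ≤ ℓ, |r (site φ n (i + θ * k)) (site φ n (i + θ * j))| ≤
      C * (2 * ℓ * m' / ((n : ℝ) - 1)) ^ (2 * ν + τ) := by
    intro k hk j hj
    have h1 := hnear k hk j hj
    have h2 := hball (y := |site φ n (i + θ * k) - site φ n (i + θ * j)|)
      (by rw [Real.dist_eq, sub_zero, abs_abs]; exact h1.trans_lt hlt)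
      (site φ n (i + θ * k), site φ n (i + θ * j)) rfl
    simp only [Real.norm_eq_abs] at h2
    refine h2.trans ?_
    rw [abs_of_nonneg (by positivity)]
    gcongr
  have hab : ∀ k ≤ ℓ, |a φ n θ ℓ i k| ≤ (ℓ.factorial : ℝ) / (m / ((n : ℝ) - 1)) ^ ℓ := by
    intro k hk
    rw [a_eq_ddWeight]
    exact abs_ddWeight_le (by positivity) hsep hk
  set N := (n : ℝ) - 1 with hNdef
  calc |∑ k ∈ Finset.range (ℓ + 1), ∑ j ∈ Finset.range (ℓ + 1),
        a φ n θ ℓ i k * a φ n θ ℓ i j * r (site φ n (i + θ * k)) (site φ n (i + θ * j))|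
      ≤ ∑ k ∈ Finset.range (ℓ + 1), ∑ j ∈ Finset.range (ℓ + 1),
        ((ℓ.factorial : ℝ) / (m / N) ^ ℓ) * ((ℓ.factorial : ℝ) / (m / N) ^ ℓ) *
          (C * (2 * ℓ * m' / N) ^ (2 * ν + τ)) := by
        refine (Finset.abs_sum_le_sum_abs _ _).trans (Finset.sum_le_sum fun k hk => ?_)
        refine (Finset.abs_sum_le_sum_abs _ _).trans (Finset.sum_le_sum fun j hj => ?_)
        simp only [Finset.mem_range, Nat.lt_succ_iff] at hk hj
        rw [abs_mul, abs_mul]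
        gcongr
        · exact hab k hk
        · exact hab j hj
        · exact hrb k hk j hj
    _ = ((ℓ : ℝ) + 1) ^ 2 * ((ℓ.factorial : ℝ) / m ^ ℓ) ^ 2 * C * (2 * ℓ * m') ^ (2 * ν + τ) *
        N ^ (2 * ℓ - 2 * ν - τ) := by
        simp only [Finset.sum_const, Finset.card_range, nsmul_eq_mul]
        have e1 : N ^ (2 * (ℓ : ℝ) - 2 * ν - τ) = N ^ ℓ * N ^ ℓ / N ^ (2 * ν + τ) := by
          rw [← pow_add, ← Real.rpow_natCast, ← Real.rpow_sub hN]
          congr 1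
          push_cast
          ring
        rw [e1, Real.div_rpow (by positivity) hN.le, div_pow]
        have := Real.rpow_pos_of_pos hN (2 * ν + τ)
        push_cast
        field_simp

/-- The variances of the generalised differences are asymptotically
`(θ * step) ^ (2 * ν - 2 * ℓ) * D`. The irregular part of the covariance gives the main term, and
its even polynomial part is annihilated. -/
theorem exists_eventually_abs_nablaCov_self_sub_le {φ Kt : ℝ → ℝ} (hφ : IsDesign φ) {ν β : ℝ}
    (hν : 0 < ν) {ℓ : ℕ} (hνℓ : ν < ℓ) (hβ : β ≠ 0)
    (hK : HasCovarianceForm (fun x y => Kt (x - y)) ν β) :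
    ∃ D : ℝ, D ≠ 0 ∧ ∀ ε > 0, ∀ᶠ n : ℕ in atTop, ∀ θ ∈ ({1, 2} : Set ℕ),
      ∀ i ∈ Finset.Icc 1 (n - θ * ℓ),
        |nablaCov φ n θ ℓ Kt i i - step φ n i ^ (2 * ν - 2 * ℓ) * (θ ^ (2 * ν - 2 * ℓ) * D)| ≤
          ε * (step φ n i ^ (2 * ν - 2 * ℓ) * (θ ^ (2 * ν - 2 * ℓ) * |D|)) := by
  have hℓ : 1 ≤ ℓ := by
    have : (0 : ℝ) < ℓ := hν.trans hνℓ
    exact_mod_cast this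
  obtain ⟨coef, r, τ, hτ, hform, hr⟩ := hK
  beta_reduce at hform
  obtain ⟨c, hc⟩ := exists_spectralInt_eq hν hνℓ
  have hId := spectralInt_pos (strictMonoOn_natCast ℓ) hν hνℓ
  have hc0 : c ≠ 0 := by
    rintro rfl
    rw [hc _ (strictMonoOn_natCast ℓ), zero_mul] at hId
    exact lt_irrefl _ hId
  set I₀ := spectralInt ℓ (fun k => (k : ℝ)) ν with hI₀
  obtain ⟨m, m', hm, hmm', hb⟩ := hφ.exists_bounds
  have hm' : 0 < m' := hm.trans_le hmm'
  obtain ⟨C, hC0, hC⟩ := exists_eventually_abs_sum_sum_mul_le hφ hν hτ ℓ hℓ hr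
  set D := β / c * I₀ with hD
  have hD0 : D ≠ 0 := mul_ne_zero (div_ne_zero hβ hc0) hId.ne'
  have hDabs : 0 < |D| := abs_pos.mpr hD0
  refine ⟨D, hD0, fun ε hε => ?_⟩
  set κ := (2 * m') ^ (2 * ν - 2 * ℓ) with hκ
  have hκ0 : 0 < κ := by positivity
  have hsmall : ∀ᶠ n : ℕ in atTop, C * ((n : ℝ) - 1) ^ (-τ) < ε / 2 * (κ * |D|) := by
    have h1 : Tendsto (fun n : ℕ => (n : ℝ) - 1) atTop atTop :=
      tendsto_atTop_add_const_right _ _ tendsto_natCast_atTop_atTop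
    have h2 := ((tendsto_rpow_neg_atTop hτ).comp h1).const_mul C
    rw [mul_zero] at h2
    exact h2.eventually (gt_mem_nhds (by positivity))
  filter_upwards [hC, hsmall, eventually_ge_atTop 2,
    eventually_abs_spectralInt_sub_le hφ (le_refl 1) hℓ hνℓ (half_pos hε),
    eventually_abs_spectralInt_sub_le hφ one_le_two hℓ hνℓ (half_pos hε)]
    with n hCn hsm hn2 hs1 hs2 θ hθ i hi
  have hθ1 : 1 ≤ θ := by rcases hθ with rfl | rfl <;> norm_num
  have hθ2 : (θ : ℝ) ≤ 2 := by rcases hθ with rfl | rfl <;> norm_num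
  have hmono := hφ.strictMonoOn_of_mem_Icc hθ1 hℓ hi
  have hN : 0 < (n : ℝ) - 1 := by
    have : (2 : ℝ) ≤ n := by exact_mod_cast hn2
    linarith
  have hi' := Finset.mem_Icc.mp hi
  have hθℓ := Nat.mul_le_mul hθ1 hℓ
  have hin : i + θ * ℓ ≤ n := by omega
  have hspec : |spectralInt ℓ (fun k => site φ n (i + θ * k)) ν -
        step φ n i ^ (2 * ν - 2 * ℓ) * (θ ^ (2 * ν - 2 * ℓ) * I₀)| ≤
      ε / 2 * (step φ n i ^ (2 * ν - 2 * ℓ) * (θ ^ (2 * ν - 2 * ℓ) * I₀)) := by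
    rcases hθ with rfl | rfl
    · exact hs1 i hi'.1 hin ν ⟨hν, le_rfl⟩
    · exact hs2 i hi'.1 hin ν ⟨hν, le_rfl⟩
  set rem := ∑ k ∈ Finset.range (ℓ + 1), ∑ j ∈ Finset.range (ℓ + 1),
        a φ n θ ℓ i k * a φ n θ ℓ i j * r (site φ n (i + θ * k)) (site φ n (i + θ * j)) with hrem
  have hstep := hφ.step_pos hi'.1 (by omega : i + 1 ≤ n)
  have hθpos : (0 : ℝ) < θ := by exact_mod_cast hθ1
  set q := step φ n i ^ (2 * ν - 2 * ℓ) * θ ^ (2 * ν - 2 * ℓ) with hq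
  have hq0 : 0 < q := by positivity
  have hdecomp : nablaCov φ n θ ℓ Kt i i =
      β / c * spectralInt ℓ (fun k => site φ n (i + θ * k)) ν + rem := by
    rw [hc _ hmono]
    have e1 : ∀ k j, a φ n θ ℓ i k * a φ n θ ℓ i j *
        Kt (site φ n (i + θ * k) - site φ n (i + θ * j)) =
        ∑ p ∈ Finset.range (⌊ν⌋₊ + 1), coef p * (a φ n θ ℓ i k * a φ n θ ℓ i j *
          (site φ n (i + θ * k) - site φ n (i + θ * j)) ^ (2 * p)) +
        β * (a φ n θ ℓ i k * a φ n θ ℓ i j *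
          G ν |site φ n (i + θ * k) - site φ n (i + θ * j)|) +
        a φ n θ ℓ i k * a φ n θ ℓ i j * r (site φ n (i + θ * k)) (site φ n (i + θ * j)) := by
      intro k j
      rw [hform, mul_add, mul_add, Finset.mul_sum]
      congr 2
      · refine Finset.sum_congr rfl fun p _ => ?_
        rw [pow_mul |_|, sq_abs, ← pow_mul]
        ring
      · ring
    unfold nablaCov
    simp_rw [e1, Finset.sum_add_distrib]
    have e2 : ∑ k ∈ Finset.range (ℓ + 1), ∑ j ∈ Finset.range (ℓ + 1),
        ∑ p ∈ Finset.range (⌊ν⌋₊ + 1), coef p * (a φ n θ ℓ i k * a φ n θ ℓ i j *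
          (site φ n (i + θ * k) - site φ n (i + θ * j)) ^ (2 * p)) = 0 := by
      rw [Finset.sum_congr rfl fun k _ => Finset.sum_comm, Finset.sum_comm]
      refine Finset.sum_eq_zero fun p hp => ?_
      have hpℓ : p < ℓ := by
        have h1 : (⌊ν⌋₊ : ℝ) < ℓ := (Nat.floor_le hν.le).trans_lt hνℓ
        have h2 : ⌊ν⌋₊ < ℓ := by exact_mod_cast h1
        rw [Finset.mem_range] at hp
        omega
      simp_rw [← Finset.mul_sum]
      rw [mul_eq_zero]
      right
      exact sum_sum_ddWeight_mul_sub_pow hmono hpℓ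
    rw [e2, zero_add]
    simp_rw [← Finset.mul_sum]
    congr 1
    rw [← mul_assoc, div_mul_cancel₀ _ hc0]
    rfl
  have hremle : |rem| ≤ ε / 2 * (q * |D|) := by
    refine (hCn θ hθ i hi).trans ?_
    have e3 : ((n : ℝ) - 1) ^ (2 * (ℓ : ℝ) - 2 * ν - τ) =
        ((n : ℝ) - 1) ^ (-τ) * ((n : ℝ) - 1) ^ (2 * (ℓ : ℝ) - 2 * ν) := by
      rw [← Real.rpow_add hN]; congr 1; ring
    have hup : θ * step φ n i ≤ 2 * m' / ((n : ℝ) - 1) := by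
      have h := (hb n i (i + 1) hi'.1 (by omega) (by omega)).2
      push_cast at h
      rw [add_sub_cancel_left, mul_one_div] at h
      calc θ * step φ n i ≤ 2 * (m' / ((n : ℝ) - 1)) :=
            mul_le_mul hθ2 h hstep.le (by norm_num)
        _ = _ := by ring
    have hκq : κ * ((n : ℝ) - 1) ^ (2 * (ℓ : ℝ) - 2 * ν) ≤ q := by
      have h := Real.rpow_le_rpow_of_nonpos (by positivity) hup
        (by linarith : 2 * ν - 2 * ℓ ≤ 0)
      rw [Real.mul_rpow hθpos.le hstep.le, mul_comm ((θ : ℝ) ^ _),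
        Real.div_rpow (by positivity) hN.le] at h
      refine le_trans (le_of_eq ?_) h
      rw [div_eq_mul_inv, ← Real.rpow_neg hN.le, neg_sub]
    calc C * ((n : ℝ) - 1) ^ (2 * (ℓ : ℝ) - 2 * ν - τ)
        = (C * ((n : ℝ) - 1) ^ (-τ)) * ((n : ℝ) - 1) ^ (2 * (ℓ : ℝ) - 2 * ν) := by rw [e3]; ring
      _ ≤ (ε / 2 * (κ * |D|)) * ((n : ℝ) - 1) ^ (2 * (ℓ : ℝ) - 2 * ν) := by gcongr
      _ = ε / 2 * ((κ * ((n : ℝ) - 1) ^ (2 * (ℓ : ℝ) - 2 * ν)) * |D|) := by ring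
      _ ≤ ε / 2 * (q * |D|) := by gcongr
  have e4 : nablaCov φ n θ ℓ Kt i i - step φ n i ^ (2 * ν - 2 * ℓ) * (θ ^ (2 * ν - 2 * ℓ) * D) =
      β / c * (spectralInt ℓ (fun k => site φ n (i + θ * k)) ν -
        step φ n i ^ (2 * ν - 2 * ℓ) * (θ ^ (2 * ν - 2 * ℓ) * I₀)) + rem := by
    rw [hdecomp, hD]; ring
  rw [e4]
  refine (abs_add_le _ _).trans ?_
  have h5 : |β / c * (spectralInt ℓ (fun k => site φ n (i + θ * k)) ν -
        step φ n i ^ (2 * ν - 2 * ℓ) * (θ ^ (2 * ν - 2 * ℓ) * I₀))| ≤ ε / 2 * (q * |D|) := by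
    rw [abs_mul]
    refine (mul_le_mul_of_nonneg_left hspec (abs_nonneg _)).trans (le_of_eq ?_)
    rw [hD, abs_mul, abs_of_pos hId, hq]
    ring
  calc _ ≤ ε / 2 * (q * |D|) + ε / 2 * (q * |D|) := add_le_add h5 hremle
    _ = _ := by rw [hq]; ring

/-! ### Row sums of the covariance matrix -/

theorem sum_Icc_rpow_neg_le {η : ℝ} (h0 : 0 ≤ η) (h1 : η < 1) (n : ℕ) :
    ∑ k ∈ Finset.Icc 1 n, (k : ℝ) ^ (-η) ≤ (n : ℝ) ^ (1 - η) / (1 - η) := by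
  have hη : 0 < 1 - η := by linarith
  induction n with
  | zero => simp [Real.zero_rpow hη.ne']
  | succ n ih =>
    rw [Finset.sum_Icc_succ_top (by omega)]
    have hn : (0 : ℝ) < n + 1 := by positivity
    have hx : (n : ℝ) = (n + 1) * (1 + -(1 / ((n : ℝ) + 1))) := by field_simp; ring
    have hle : 1 / ((n : ℝ) + 1) ≤ 1 := by
      rw [div_le_one hn]
      have : (0 : ℝ) ≤ n := by positivity
      linarith
    have hb := rpow_one_add_le_one_add_mul_self (s := -(1 / ((n : ℝ) + 1))) (by linarith) hη.le
      (by linarith)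
    have h2 : (n : ℝ) ^ (1 - η) ≤ ((n : ℝ) + 1) ^ (1 - η) - (1 - η) * ((n : ℝ) + 1) ^ (-η) := by
      have e : ((n : ℝ) + 1) ^ (1 - η) - (1 - η) * ((n : ℝ) + 1) ^ (-η) =
          ((n : ℝ) + 1) ^ (1 - η) * (1 + (1 - η) * -(1 / ((n : ℝ) + 1))) := by
        have : ((n : ℝ) + 1) ^ (1 - η) = ((n : ℝ) + 1) ^ (-η) * ((n : ℝ) + 1) := by
          rw [← Real.rpow_add_one hn.ne']; congr 1; ring
        rw [this]
        field_simp
        ring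
      rw [e]
      nth_rewrite 1 [hx]
      rw [Real.mul_rpow hn.le (by linarith)]
      exact mul_le_mul_of_nonneg_left hb (by positivity)
    push_cast
    rw [le_div_iff₀ hη] at ih ⊢
    rw [add_mul]
    linarith

theorem sum_comp_le_sum_of_injOn {s t : Finset ℕ} {e : ℕ → ℕ} {g : ℕ → ℝ}
    (he : Set.InjOn e s) (hmap : ∀ x ∈ s, e x ∈ t) (hg : ∀ y ∈ t, 0 ≤ g y) :
    ∑ x ∈ s, g (e x) ≤ ∑ y ∈ t, g y := by
  rw [← Finset.sum_image (f := g) he]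
  refine Finset.sum_le_sum_of_subset_of_nonneg (fun y hy => ?_) fun y hy _ => hg y hy
  obtain ⟨x, hx, rfl⟩ := Finset.mem_image.mp hy
  exact hmap x hx

/-- A bound for the row sums of a symmetric array that is bounded by `B` in a band of half-width `q`
and by `B * d ^ (-ρ)` at distance `d` from the band. -/
theorem sum_abs_le_of_decay {L n q : ℕ} (hL : L ≤ n) {B ρ : ℝ} (hB : 0 ≤ B) {c : ℕ → ℕ → ℝ}
    (hsymm : ∀ i i', c i i' = c i' i)
    (hnear : ∀ i ∈ Finset.Icc 1 L, ∀ i' ∈ Finset.Icc 1 L, |c i i'| ≤ B)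
    (hfar : ∀ i ∈ Finset.Icc 1 L, ∀ i' ∈ Finset.Icc 1 L, i + q < i' →
      |c i' i| ≤ B * ((i' - i - q : ℕ) : ℝ) ^ (-ρ)) {i : ℕ} (hi : i ∈ Finset.Icc 1 L) :
    ∑ i' ∈ Finset.Icc 1 L, |c i i'| ≤
      B * ((2 * q + 1) + 2 * ∑ k ∈ Finset.Icc 1 n, (k : ℝ) ^ (-ρ)) := by
  set I := Finset.Icc 1 L with hI
  set w : ℕ → ℝ := fun k => (k : ℝ) ^ (-ρ) with hw
  have hw0 : ∀ k, 0 ≤ w k := fun k => by positivity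
  have hpt : ∀ i' ∈ I, |c i i'| ≤
      (if i' ≤ i + q ∧ i ≤ i' + q then B else 0) + (if i + q < i' then B * w (i' - i - q) else 0) +
        (if i' + q < i then B * w (i - i' - q) else 0) := by
    intro i' hi'
    rcases lt_or_ge (i + q) i' with h | h
    · rw [if_neg (by omega), if_pos h, if_neg (by omega), zero_add, add_zero, hsymm]
      exact hfar i hi i' hi' h
    · rcases lt_or_ge (i' + q) i with h' | h'
      · rw [if_neg (by omega), if_neg (by omega), if_pos h', zero_add, zero_add]
        exact hfar i' hi' i hi h'
      · rw [if_pos ⟨h, h'⟩, if_neg (by omega), if_neg (by omega), add_zero, add_zero]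
        exact hnear i hi i' hi'
  refine (Finset.sum_le_sum hpt).trans ?_
  rw [Finset.sum_add_distrib, Finset.sum_add_distrib, ← Finset.sum_filter, ← Finset.sum_filter,
    ← Finset.sum_filter, ← Finset.mul_sum, ← Finset.mul_sum, Finset.sum_const, nsmul_eq_mul]
  have h1 : ((I.filter fun i' => i' ≤ i + q ∧ i ≤ i' + q).card : ℝ) ≤ 2 * q + 1 := by
    have : (I.filter fun i' => i' ≤ i + q ∧ i ≤ i' + q).card ≤ 2 * q + 1 := by
      refine (Finset.card_le_card (t := Finset.Icc (i - q) (i + q)) fun x hx => ?_).trans ?_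
      · simp only [Finset.mem_filter] at hx
        rw [Finset.mem_Icc]; omega
      · rw [Nat.card_Icc]; omega
    exact_mod_cast this
  have h2 : ∑ i' ∈ I.filter (fun i' => i + q < i'), w (i' - i - q) ≤
      ∑ k ∈ Finset.Icc 1 n, w k := by
    refine sum_comp_le_sum_of_injOn (e := fun i' => i' - i - q) ?_ ?_ fun k _ => hw0 k
    · intro x hx y hy hxy
      simp only [Finset.coe_filter, Set.mem_ofPred_eq] at hx hy hxy
      omega
    · intro x hx
      simp only [hI, Finset.mem_filter, Finset.mem_Icc] at hx ⊢
      omega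
  have h3 : ∑ i' ∈ I.filter (fun i' => i' + q < i), w (i - i' - q) ≤
      ∑ k ∈ Finset.Icc 1 n, w k := by
    rw [hI, Finset.mem_Icc] at hi
    refine sum_comp_le_sum_of_injOn (e := fun i' => i - i' - q) ?_ ?_ fun k _ => hw0 k
    · intro x hx y hy hxy
      simp only [Finset.coe_filter, Set.mem_ofPred_eq] at hx hy hxy
      omega
    · intro x hx
      simp only [hI, Finset.mem_filter, Finset.mem_Icc] at hx ⊢
      omega
  have h1' := mul_le_mul_of_nonneg_right h1 hB
  have h2' := mul_le_mul_of_nonneg_left h2 hB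
  have h3' := mul_le_mul_of_nonneg_left h3 hB
  nlinarith

/-- The trace of the covariance matrix of the generalised differences dominates its row sums by a
power of `n`. The exponent is positive for every `ν < ℓ`, although the row sums may be unbounded
relative to the variances. -/
theorem exists_rowSum_bound {φ Kt : ℝ → ℝ} (hφ : IsDesign φ) {ν : ℝ} {ℓ : ℕ} (hℓ : 1 ≤ ℓ)
    (hνℓ : ν < ℓ)
    (hoff : ∃ C : ℝ, 0 ≤ C ∧ ∀ n θ i i' : ℕ, 1 ≤ θ → 1 ≤ i → i + θ * ℓ < i' → i' + θ * ℓ ≤ n →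
      |nablaCov φ n θ ℓ Kt i' i| ≤
        C * (((i' : ℝ) - i - θ * ℓ) / ((n : ℝ) - 1)) ^ (2 * ν - 2 * ℓ)) {D : ℝ} (hD : 0 < D)
    (hdiag : ∀ ε > 0, ∀ᶠ n : ℕ in atTop, ∀ θ ∈ ({1, 2} : Set ℕ),
      ∀ i ∈ Finset.Icc 1 (n - θ * ℓ),
        |nablaCov φ n θ ℓ Kt i i - step φ n i ^ (2 * ν - 2 * ℓ) * (θ ^ (2 * ν - 2 * ℓ) * D)| ≤
          ε * (step φ n i ^ (2 * ν - 2 * ℓ) * (θ ^ (2 * ν - 2 * ℓ) * D)))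
    (hsymm : ∀ n θ i i', nablaCov φ n θ ℓ Kt i i' = nablaCov φ n θ ℓ Kt i' i)
    (hcs : ∀ n θ i i', |nablaCov φ n θ ℓ Kt i i'| ≤
      (nablaCov φ n θ ℓ Kt i i + nablaCov φ n θ ℓ Kt i' i') / 2)
    {θ : ℕ} (hθ : θ ∈ ({1, 2} : Set ℕ)) :
    ∃ c : ℝ, 0 < c ∧ ∃ η : ℝ, 0 < η ∧ ∀ᶠ n : ℕ in atTop, ∃ R > 0,
      (∀ i ∈ Finset.Icc 1 (n - θ * ℓ),
        ∑ i' ∈ Finset.Icc 1 (n - θ * ℓ), |nablaCov φ n θ ℓ Kt i i'| ≤ R) ∧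
      c * (n : ℝ) ^ η * R ≤ ∑ i ∈ Finset.Icc 1 (n - θ * ℓ), nablaCov φ n θ ℓ Kt i i := by
  obtain ⟨C, hC0, hC⟩ := hoff
  obtain ⟨m, m', hm, hmm', hb⟩ := hφ.exists_bounds
  have hm' : 0 < m' := hm.trans_le hmm'
  have hθ1 : 1 ≤ θ := by rcases hθ with rfl | rfl <;> norm_num
  have hθ1' : (1 : ℝ) ≤ θ := by exact_mod_cast hθ1
  have hθ2 : θ ≤ 2 := by rcases hθ with rfl | rfl <;> norm_num
  have hθ2' : (θ : ℝ) ≤ 2 := by exact_mod_cast hθ2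
  set ρ := 2 * (ℓ : ℝ) - 2 * ν with hρ
  have hρ0 : 0 < ρ := by linarith
  have hneg : 2 * ν - 2 * ℓ = -ρ := by ring
  simp only [hneg] at hC hdiag
  -- The row sums are of the order `∑ k ^ (-ρ)` relative to the variances; replacing `ρ` by an
  -- exponent `η < 1` bounds them by a multiple of `n ^ (1 - η)`.
  set η := min ρ (1 / 2) with hη
  have hη0 : 0 < η := by positivity
  have hη1 : η < 1 := (min_le_right _ _).trans_lt (by norm_num)
  set B₀ := 2 * (m ^ (-ρ) * D) + C with hB₀
  have hB₀0 : 0 < B₀ := by positivity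
  set A := 4 * (ℓ : ℝ) + 1 + 2 / (1 - η) with hA
  have h1η : 0 < 1 - η := by linarith
  have hA0 : 0 < A := by positivity
  set E := (2 * m') ^ (-ρ) * D / 2 with hE
  have hE0 : 0 < E := by positivity
  refine ⟨E / 2 / (B₀ * A), by positivity, η, hη0, ?_⟩
  filter_upwards [hdiag (1 / 2) (by norm_num), eventually_ge_atTop (4 * ℓ + 2)] with n hn hnℓ
  have hθℓ : θ * ℓ ≤ 2 * ℓ := Nat.mul_le_mul_right ℓ hθ2
  have hθℓ1 := Nat.mul_le_mul hθ1 hℓ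
  have hn2 : (2 : ℝ) ≤ n := by exact_mod_cast (by omega : 2 ≤ n)
  have hN : 0 < (n : ℝ) - 1 := by linarith
  set N := (n : ℝ) - 1 with hNdef
  have hNρ : 0 < N ^ ρ := by positivity
  have hdivpow : ∀ x : ℝ, 0 < x → (x / N) ^ (-ρ) = x ^ (-ρ) * N ^ ρ := by
    intro x hx
    rw [Real.div_rpow hx.le hN.le, Real.rpow_neg hN.le, div_inv_eq_mul]
  have hscale : ∀ i ∈ Finset.Icc 1 (n - θ * ℓ),
      (2 * m') ^ (-ρ) * N ^ ρ ≤ step φ n i ^ (-ρ) * θ ^ (-ρ) ∧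
      step φ n i ^ (-ρ) * θ ^ (-ρ) ≤ m ^ (-ρ) * N ^ ρ := by
    intro i hi
    rw [Finset.mem_Icc] at hi
    have h := hb n i (i + 1) hi.1 (by omega) (by omega)
    push_cast at h
    rw [add_sub_cancel_left, mul_one_div, mul_one_div] at h
    have hs : 0 < step φ n i := hφ.step_pos hi.1 (by omega)
    have h1 : m / N ≤ step φ n i := h.1
    have h2 : step φ n i ≤ m' / N := h.2
    rw [← Real.mul_rpow hs.le (by linarith), ← hdivpow _ (by positivity), ← hdivpow _ hm]
    constructor
    · refine Real.rpow_le_rpow_of_nonpos (by positivity) ?_ (by linarith)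
      calc step φ n i * θ ≤ m' / N * 2 := by gcongr
        _ = 2 * m' / N := by ring
    · refine Real.rpow_le_rpow_of_nonpos (by positivity) ?_ (by linarith)
      exact h1.trans (le_mul_of_one_le_right hs.le hθ1')
  have hup : ∀ i ∈ Finset.Icc 1 (n - θ * ℓ), nablaCov φ n θ ℓ Kt i i ≤ B₀ * N ^ ρ := by
    intro i hi
    have h1 := (abs_le.mp (hn θ hθ i hi)).2
    have h2 := mul_le_mul_of_nonneg_right (hscale i hi).2 hD.le
    have h3 : 0 ≤ step φ n i ^ (-ρ) * θ ^ (-ρ) * D := by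
      have : 0 < step φ n i := by
        rw [Finset.mem_Icc] at hi
        exact hφ.step_pos hi.1 (by omega)
      positivity
    have h4 : 0 ≤ C * N ^ ρ := by positivity
    rw [hB₀]
    linarith
  have hlow : ∀ i ∈ Finset.Icc 1 (n - θ * ℓ), E * N ^ ρ ≤ nablaCov φ n θ ℓ Kt i i := by
    intro i hi
    have h1 := (abs_le.mp (hn θ hθ i hi)).1
    have h2 := mul_le_mul_of_nonneg_right (hscale i hi).1 hD.le
    rw [hE]
    linarith
  have hn0 : (0 : ℝ) < n := by linarith
  refine ⟨B₀ * N ^ ρ * ((n : ℝ) ^ (1 - η) * A), by positivity, fun i hi => ?_, ?_⟩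
  · refine (sum_abs_le_of_decay (n := n) (q := θ * ℓ) (ρ := ρ) (by omega)
      (by positivity : 0 ≤ B₀ * N ^ ρ) (hsymm n θ) ?_ ?_ hi).trans ?_
    · intro i hi i' hi'
      have h1 := hcs n θ i i'
      have h2 := hup i hi
      have h3 := hup i' hi'
      linarith
    · intro i hi i' hi' hlt
      rw [Finset.mem_Icc] at hi hi'
      refine (hC n θ i i' hθ1 hi.1 hlt (by omega)).trans ?_
      have e : ((i' - i - θ * ℓ : ℕ) : ℝ) = (i' : ℝ) - i - θ * ℓ := by
        rw [Nat.cast_sub (by omega), Nat.cast_sub (by omega)]; push_cast; ring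
      have hpos : (0 : ℝ) < (i' : ℝ) - i - θ * ℓ := by
        rw [← e]; exact_mod_cast (by omega)
      rw [hdivpow _ hpos, e]
      have h1 : C ≤ B₀ := by
        have : 0 < m ^ (-ρ) * D := by positivity
        rw [hB₀]
        linarith
      calc C * (((i' : ℝ) - i - θ * ℓ) ^ (-ρ) * N ^ ρ)
          ≤ B₀ * (((i' : ℝ) - i - θ * ℓ) ^ (-ρ) * N ^ ρ) := by gcongr
        _ = _ := by ring
    · refine mul_le_mul_of_nonneg_left ?_ (by positivity)
      have h1 : ∑ k ∈ Finset.Icc 1 n, (k : ℝ) ^ (-ρ) ≤ (n : ℝ) ^ (1 - η) / (1 - η) := by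
        refine le_trans (Finset.sum_le_sum fun k hk => ?_) (sum_Icc_rpow_neg_le hη0.le hη1 n)
        rw [Finset.mem_Icc] at hk
        refine Real.rpow_le_rpow_of_exponent_le (by exact_mod_cast hk.1) ?_
        exact neg_le_neg (min_le_left _ _)
      have h2 : (1 : ℝ) ≤ (n : ℝ) ^ (1 - η) := Real.one_le_rpow (by linarith) h1η.le
      have h3 : ((θ * ℓ : ℕ) : ℝ) ≤ 2 * ℓ := by exact_mod_cast hθℓ
      have h4 : (4 * (ℓ : ℝ) + 1) ≤ (n : ℝ) ^ (1 - η) * (4 * ℓ + 1) :=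
        le_mul_of_one_le_left (by positivity) h2
      calc 2 * ((θ * ℓ : ℕ) : ℝ) + 1 + 2 * ∑ k ∈ Finset.Icc 1 n, (k : ℝ) ^ (-ρ)
          ≤ (n : ℝ) ^ (1 - η) * (4 * ℓ + 1) + 2 * ((n : ℝ) ^ (1 - η) / (1 - η)) := by linarith
        _ = (n : ℝ) ^ (1 - η) * A := by rw [hA]; ring
  · have hcard : (n : ℝ) / 2 ≤ (n - θ * ℓ : ℕ) := by
      have h1 : (n : ℝ) ≤ 2 * ((n - θ * ℓ : ℕ) : ℝ) := by exact_mod_cast (by omega)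
      linarith
    have h1 := Finset.sum_le_sum hlow
    rw [Finset.sum_const, Nat.card_Icc, Nat.add_sub_cancel, nsmul_eq_mul] at h1
    refine le_trans ?_ h1
    have e : (n : ℝ) ^ η * (n : ℝ) ^ (1 - η) = n := by
      rw [← Real.rpow_add hn0]; simp
    calc E / 2 / (B₀ * A) * (n : ℝ) ^ η * (B₀ * N ^ ρ * ((n : ℝ) ^ (1 - η) * A))
        = E / 2 * N ^ ρ * ((n : ℝ) ^ η * (n : ℝ) ^ (1 - η)) := by field_simp
      _ = (n : ℝ) / 2 * (E * N ^ ρ) := by rw [e]; ring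
      _ ≤ ((n - θ * ℓ : ℕ) : ℝ) * (E * N ^ ρ) := by gcongr

/-! ### Generalised differences of the process -/

section Differences

variable {Ω : Type*} [MeasurableSpace Ω] {P : Measure Ω} {X : ℝ → Ω → ℝ} {Kt : ℝ → ℝ}

theorem IsStationaryGaussian.memLp_two [IsProbabilityMeasure P] (hX : IsStationaryGaussian X P Kt)
    (x : ℝ) : MemLp (X x) 2 P :=
  (hX.gaussian.hasGaussianLaw_eval x).memLp_two

theorem IsStationaryGaussian.isGaussianProcess_nabla (hX : IsStationaryGaussian X P Kt)
    (φ : ℝ → ℝ) (n θ ℓ : ℕ) :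
    IsGaussianProcess (fun i ω => nabla φ n θ ℓ (fun t => X t ω) i) P := by
  classical
  refine hX.gaussian.of_isGaussianProcess fun i => ?_
  refine ⟨(Finset.range (ℓ + 1)).image fun k => site φ n (i + θ * k),
    ∑ k ∈ (Finset.range (ℓ + 1)).attach, a φ n θ ℓ i k •
      ContinuousLinearMap.proj (R := ℝ)
        ⟨site φ n (i + θ * k), Finset.mem_image_of_mem _ k.2⟩, fun ω => ?_⟩
  simp only [nabla, _root_.sum_apply, _root_.smul_apply,
    ContinuousLinearMap.proj_apply, Finset.restrict_def, smul_eq_mul]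
  exact (Finset.sum_attach _
    (fun k => a φ n θ ℓ i k * X (site φ n (i + θ * k)) ω)).symm

theorem IsStationaryGaussian.covariance_nabla [IsProbabilityMeasure P]
    (hX : IsStationaryGaussian X P Kt) (φ : ℝ → ℝ) (n θ ℓ i i' : ℕ) :
    covariance (fun ω => nabla φ n θ ℓ (fun t => X t ω) i)
      (fun ω => nabla φ n θ ℓ (fun t => X t ω) i') P = nablaCov φ n θ ℓ Kt i i' := by
  unfold nabla nablaCov
  rw [covariance_fun_sum_fun_sum' (fun k _ => (hX.memLp_two _).const_mul _)
    (fun k _ => (hX.memLp_two _).const_mul _)]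
  refine Finset.sum_congr rfl fun k _ => Finset.sum_congr rfl fun j _ => ?_
  rw [covariance_const_mul_left, covariance_const_mul_right, hX.cov, mul_assoc]

/-- The generalised differences are centred, because the weights annihilate constants. -/
theorem IsStationaryGaussian.integral_nabla [IsProbabilityMeasure P]
    (hX : IsStationaryGaussian X P Kt) {φ : ℝ → ℝ} (hφ : IsDesign φ) {n θ ℓ i : ℕ} (hθ : 1 ≤ θ)
    (hℓ : 1 ≤ ℓ) (hi : i ∈ Finset.Icc 1 (n - θ * ℓ)) :
    ∫ ω, nabla φ n θ ℓ (fun t => X t ω) i ∂P = 0 := by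
  obtain ⟨μ, hμ⟩ := hX.mean
  have h0 := sum_ddWeight_mul_pow (hφ.strictMonoOn_of_mem_Icc hθ hℓ hi)
    (show 0 < ℓ from hℓ)
  unfold nabla
  rw [integral_finsetSum _ fun k _ => ((hX.memLp_two _).const_mul _).integrable one_le_two]
  simp only [integral_const_mul, hμ, ← Finset.sum_mul]
  simp only [pow_zero, mul_one] at h0
  simp only [a_eq_ddWeight]
  rw [h0, zero_mul]

theorem IsStationaryGaussian.nablaCov_comm [IsProbabilityMeasure P]
    (hX : IsStationaryGaussian X P Kt) (φ : ℝ → ℝ) (n θ ℓ i i' : ℕ) :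
    nablaCov φ n θ ℓ Kt i i' = nablaCov φ n θ ℓ Kt i' i := by
  rw [← hX.covariance_nabla, ← hX.covariance_nabla, covariance_comm]

theorem IsStationaryGaussian.nablaCov_self_nonneg [IsProbabilityMeasure P]
    (hX : IsStationaryGaussian X P Kt) (φ : ℝ → ℝ) (n θ ℓ i : ℕ) :
    0 ≤ nablaCov φ n θ ℓ Kt i i := by
  have hY := ((hX.isGaussianProcess_nabla φ n θ ℓ).hasGaussianLaw_eval i).memLp_two
  rw [← hX.covariance_nabla, covariance_self hY.aestronglyMeasurable.aemeasurable]
  exact variance_nonneg _ _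

theorem IsStationaryGaussian.abs_nablaCov_le [IsProbabilityMeasure P]
    (hX : IsStationaryGaussian X P Kt) (φ : ℝ → ℝ) (n θ ℓ i i' : ℕ) :
    |nablaCov φ n θ ℓ Kt i i'| ≤
      (nablaCov φ n θ ℓ Kt i i + nablaCov φ n θ ℓ Kt i' i') / 2 := by
  have hY := ((hX.isGaussianProcess_nabla φ n θ ℓ).hasGaussianLaw_eval i).memLp_two
  have hY' := ((hX.isGaussianProcess_nabla φ n θ ℓ).hasGaussianLaw_eval i').memLp_two
  -- The variances of the sum and of the difference are nonnegative.
  have h1 := variance_nonneg ((fun ω => nabla φ n θ ℓ (fun t => X t ω) i) +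
    fun ω => nabla φ n θ ℓ (fun t => X t ω) i') P
  have h2 := variance_nonneg ((fun ω => nabla φ n θ ℓ (fun t => X t ω) i) -
    fun ω => nabla φ n θ ℓ (fun t => X t ω) i') P
  rw [variance_add hY hY', ← covariance_self hY.aestronglyMeasurable.aemeasurable,
    ← covariance_self hY'.aestronglyMeasurable.aemeasurable] at h1
  rw [variance_sub hY hY', ← covariance_self hY.aestronglyMeasurable.aemeasurable,
    ← covariance_self hY'.aestronglyMeasurable.aemeasurable] at h2
  simp only [hX.covariance_nabla] at h1 h2
  rw [abs_le]
  constructor <;> linarith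

end Differences

/-! ### Almost sure equivalence of the quadratic variations and their expectations -/

theorem summable_exp_neg_mul_rpow {c η : ℝ} (hc : 0 < c) (hη : 0 < η) :
    Summable fun n : ℕ => Real.exp (-c * (n : ℝ) ^ η) := by
  have h1 := ((isLittleO_exp_neg_mul_rpow_atTop hc (-2 / η)).comp_tendsto
    (tendsto_rpow_atTop hη)).comp_tendsto tendsto_natCast_atTop_atTop
  have h2 : Summable fun n : ℕ => (n : ℝ) ^ (-2 : ℝ) :=
    Real.summable_nat_rpow.mpr (by norm_num)
  refine summable_of_isBigO_nat h2 (h1.isBigO.congr_right fun n => ?_)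
  simp only [Function.comp_apply]
  rw [← Real.rpow_mul n.cast_nonneg, mul_div_cancel₀ _ hη.ne']

/-- Relative concentration at a stretched exponential rate gives almost sure convergence, by the
Borel–Cantelli lemma. -/
theorem ae_tendsto_div_of_measureReal_le {Ω : Type*} [MeasurableSpace Ω] {P : Measure Ω}
    [IsProbabilityMeasure P] {W : ℕ → Ω → ℝ} {T : ℕ → ℝ} (hT : ∀ᶠ n in atTop, 0 < T n)
    {η : ℝ} (hη : 0 < η)
    (htail : ∀ ε : ℝ, 0 < ε → ε ≤ 1 → ∃ c : ℝ, 0 < c ∧ ∀ᶠ n : ℕ in atTop,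
      P.real {ω | ε * T n ≤ |W n ω - T n|} ≤ 2 * Real.exp (-c * (n : ℝ) ^ η)) :
    ∀ᵐ ω ∂P, Tendsto (fun n => W n ω / T n) atTop (𝓝 1) := by
  have key : ∀ k : ℕ, ∀ᵐ ω ∂P, ∀ᶠ n in atTop, |W n ω - T n| < 1 / ((k : ℝ) + 1) * T n := by
    intro k
    obtain ⟨c, hc, hn⟩ := htail (1 / ((k : ℝ) + 1)) (by positivity)
      (by rw [div_le_one (by positivity)]; linarith [(k.cast_nonneg : (0 : ℝ) ≤ k)])
    have hs : Summable fun n : ℕ =>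
        P.real {ω | 1 / ((k : ℝ) + 1) * T n ≤ |W n ω - T n|} := by
      refine Summable.of_norm_bounded_eventually_nat
        ((summable_exp_neg_mul_rpow hc hη).mul_left 2) ?_
      filter_upwards [hn] with n hn
      rwa [Real.norm_of_nonneg measureReal_nonneg]
    have h := ae_eventually_notMem (μ := P)
      (s := fun n : ℕ => {ω | 1 / ((k : ℝ) + 1) * T n ≤ |W n ω - T n|})
      (by
        have := hs.tsum_ofReal_ne_top
        simpa only [measureReal_def, ENNReal.ofReal_toReal (measure_ne_top _ _)] using this)
    filter_upwards [h] with ω hω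
    filter_upwards [hω] with n hn
    simpa using hn
  filter_upwards [ae_all_iff.mpr key] with ω hω
  rw [Metric.tendsto_nhds]
  intro ε hε
  obtain ⟨k, hk⟩ := exists_nat_one_div_lt hε
  filter_upwards [hω k, hT] with n hn hTn
  rw [Real.dist_eq, div_sub_one hTn.ne', abs_div, abs_of_pos hTn, div_lt_iff₀ hTn]
  exact hn.trans (mul_lt_mul_of_pos_right hk hTn)

/-- The quadratic variation is almost surely equivalent to its expectation, the sum of the
variances of the generalised differences. -/
theorem IsStationaryGaussian.ae_tendsto_V_div {Ω : Type*} [MeasurableSpace Ω] {P : Measure Ω}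
    [IsProbabilityMeasure P] {X : ℝ → Ω → ℝ} {Kt φ : ℝ → ℝ} (hX : IsStationaryGaussian X P Kt)
    (hφ : IsDesign φ) {θ ℓ : ℕ} (hθ : 1 ≤ θ) (hℓ : 1 ≤ ℓ)
    (hR : ∃ c : ℝ, 0 < c ∧ ∃ η : ℝ, 0 < η ∧ ∀ᶠ n : ℕ in atTop, ∃ R > 0,
      (∀ i ∈ Finset.Icc 1 (n - θ * ℓ),
        ∑ i' ∈ Finset.Icc 1 (n - θ * ℓ), |nablaCov φ n θ ℓ Kt i i'| ≤ R) ∧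
      c * (n : ℝ) ^ η * R ≤ ∑ i ∈ Finset.Icc 1 (n - θ * ℓ), nablaCov φ n θ ℓ Kt i i) :
    ∀ᵐ ω ∂P, Tendsto (fun n => V φ n θ ℓ (fun t => X t ω) /
      ∑ i ∈ Finset.Icc 1 (n - θ * ℓ), nablaCov φ n θ ℓ Kt i i) atTop (𝓝 1) := by
  obtain ⟨c, hc, η, hη, hR⟩ := hR
  refine ae_tendsto_div_of_measureReal_le ?_ hη ?_
  · filter_upwards [hR, eventually_ge_atTop 1] with n ⟨R, hR0, _, hR2⟩ hn
    have : (0 : ℝ) < n := by exact_mod_cast hn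
    exact lt_of_lt_of_le (by positivity) hR2
  · intro ε hε hε1
    refine ⟨ε ^ 2 * c / 16, by positivity, ?_⟩
    filter_upwards [hR] with n ⟨R, hR0, hR1, hR2⟩
    set I := Finset.Icc 1 (n - θ * ℓ) with hI
    set Y : I → Ω → ℝ := fun i ω => nabla φ n θ ℓ (fun t => X t ω) i with hY
    have hcov : ∀ i j : I, covariance (Y i) (Y j) P = nablaCov φ n θ ℓ Kt i j :=
      fun i j => hX.covariance_nabla φ n θ ℓ i j
    have h := measureReal_abs_sum_sq_sub_ge_le (P := P) (Y := Y) (R := R) (ε := ε)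
      (T := ∑ i ∈ I, nablaCov φ n θ ℓ Kt i i)
      ((hX.isGaussianProcess_nabla φ n θ ℓ).hasGaussianLaw I)
      (fun i => hX.integral_nabla hφ hθ hℓ i.2) hR0
      (fun i => by
        simp only [hcov]
        rw [Finset.sum_coe_sort I (fun i' => |nablaCov φ n θ ℓ Kt i i'|)]
        exact hR1 i i.2) hε hε1
      (by
        simp only [hcov]
        rw [Finset.sum_coe_sort I (fun i' => nablaCov φ n θ ℓ Kt i' i')])
    have e : ∀ ω, ∑ i, Y i ω ^ 2 = V φ n θ ℓ (fun t => X t ω) := fun ω =>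
      Finset.sum_coe_sort I (fun i => nabla φ n θ ℓ (fun t => X t ω) i ^ 2)
    simp only [e] at h
    refine h.trans ?_
    gcongr 2 * Real.exp ?_
    rw [neg_mul, neg_le_neg_iff, le_div_iff₀ (by positivity)]
    calc ε ^ 2 * c / 16 * (n : ℝ) ^ η * (16 * R) = ε ^ 2 * (c * (n : ℝ) ^ η * R) := by ring
      _ ≤ _ := by gcongr

/-! ### Consistency of the minimiser -/

/-- If `F_{ℓ,n}(s) → 2 ^ (2s - 2ℓ)` uniformly in `s ∈ [0, M]` and `V_{2,ℓ} / V_{1,ℓ}` tends to the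
value of this limit at `ν`, then the minimisers of the criterion converge to `ν`. -/
theorem tendsto_of_isEstimate {φ b : ℝ → ℝ} {ℓ : ℕ} {ν M : ℝ} {x : ℝ → ℝ} {est : ℕ → ℝ}
    (hν : ν ∈ Set.Icc 0 M)
    (hF : ∀ ε > 0, ∀ᶠ n : ℕ in atTop, ∀ s ∈ Set.Icc 0 M,
      |F φ n ℓ b s - (2 : ℝ) ^ (2 * s - 2 * ℓ)| ≤ ε)
    (hV : Tendsto (fun n => V φ n 2 ℓ x / V φ n 1 ℓ x) atTop
      (𝓝 ((2 : ℝ) ^ (2 * ν - 2 * ℓ))))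
    (hest : ∀ᶠ n in atTop, IsEstimate φ n ℓ b M x (est n)) :
    Tendsto est atTop (𝓝 ν) := by
  set L := (2 : ℝ) ^ (2 * ν - 2 * ℓ) with hL
  have hL0 : 0 < L := by positivity
  have hq : Tendsto (fun n => V φ n 1 ℓ x / V φ n 2 ℓ x) atTop (𝓝 L⁻¹) := by
    simpa only [inv_div] using hV.inv₀ hL0.ne'
  have hFlim : ∀ s : ℕ → ℝ, (∀ᶠ n in atTop, s n ∈ Set.Icc 0 M) →
      Tendsto (fun n => F φ n ℓ b (s n) - (2 : ℝ) ^ (2 * s n - 2 * ℓ)) atTop (𝓝 0) := by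
    intro s hs
    rw [Metric.tendsto_nhds]
    intro ε hε
    filter_upwards [hF (ε / 2) (by positivity), hs] with n h1 h2
    rw [dist_zero_right, Real.norm_eq_abs]
    exact (h1 _ h2).trans_lt (by linarith)
  have hFν : Tendsto (fun n => F φ n ℓ b ν) atTop (𝓝 L) :=
    tendsto_sub_nhds_zero_iff.mp (hFlim (fun _ => ν) (Eventually.of_forall fun _ => hν))
  have hcν : Tendsto (fun n => criterion φ n ℓ b x ν) atTop (𝓝 0) := by
    have h := ((hq.mul hFν).sub_const 1).pow 2
    rw [inv_mul_cancel₀ hL0.ne', sub_self, zero_pow two_ne_zero] at h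
    refine h.congr fun n => ?_
    rw [criterion, div_mul_eq_mul_div]
  have hc : Tendsto (fun n => criterion φ n ℓ b x (est n)) atTop (𝓝 0) :=
    tendsto_of_tendsto_of_tendsto_of_le_of_le' tendsto_const_nhds hcν
      (Eventually.of_forall fun n => sq_nonneg _) (hest.mono fun n hn => hn.2 hν)
  have hprod : Tendsto (fun n => V φ n 1 ℓ x / V φ n 2 ℓ x * F φ n ℓ b (est n)) atTop
      (𝓝 1) := by
    rw [← tendsto_sub_nhds_zero_iff, tendsto_zero_iff_abs_tendsto_zero]
    have h := (Real.continuous_sqrt.tendsto 0).comp hc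
    rw [Real.sqrt_zero] at h
    refine h.congr fun n => ?_
    simp only [Function.comp_apply, criterion]
    rw [Real.sqrt_sq_eq_abs, div_mul_eq_mul_div]
  have hFest : Tendsto (fun n => F φ n ℓ b (est n)) atTop (𝓝 L) := by
    have h := hprod.div hq (inv_ne_zero hL0.ne')
    rw [one_div, inv_inv] at h
    refine h.congr' ?_
    filter_upwards [hq.eventually_ne (inv_ne_zero hL0.ne')] with n hn
    rw [Pi.div_apply, mul_div_cancel_left₀ _ hn]
  have hpow : Tendsto (fun n => (2 : ℝ) ^ (2 * est n - 2 * ℓ)) atTop (𝓝 L) := by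
    have h := hFest.sub (hFlim est (hest.mono fun n hn => hn.1))
    simpa using h
  have hlog := hpow.logb (b := 2) hL0.ne'
  rw [hL, Real.logb_rpow two_pos (by norm_num)] at hlog
  simp only [Real.logb_rpow two_pos (show (2 : ℝ) ≠ 1 by norm_num)] at hlog
  have h := (hlog.add_const (2 * (ℓ : ℝ))).div_const 2
  simpa using h

end QuadVar

end

theorem theorem2p2 {Ω : Type*} [MeasurableSpace Ω] (P : Measure Ω) [IsProbabilityMeasure P]
    (X : ℝ → Ω → ℝ) (Kt φ b : ℝ → ℝ) (ν M : ℝ) (ℓ : ℕ)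
    (hν : 0 < ν) (hνM : ν ≤ M) (hMℓ : M < ℓ) (hℓ : ℓ ≤ 10)
    (hb : ∀ s ∈ Set.Ioc 0 M, b s ≠ 0)
    (hX : QuadVar.IsStationaryGaussian X P Kt)
    (hK : QuadVar.HasCovarianceForm (fun x y => Kt (x - y)) ν (b ν))
    (hφ : QuadVar.IsDesign φ)
    (hsmooth : ∃ c d : ℝ, Set.Ioc (0 : ℝ) 1 ⊆ Set.Ioo c d ∧
      ContDiffOn ℝ ((2 * ℓ : ℕ) : WithTop ℕ∞) Kt (Set.Ioo c d))
    (hbound : ∃ C : ℝ, ∀ t ∈ Set.Ioc (0 : ℝ) 1,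
      |iteratedDeriv (2 * ℓ) Kt t| ≤ C * t ^ (2 * ν - 2 * ℓ))
    (est : ℕ → Ω → ℝ)
    (hest : ∀ᵐ ω ∂P, ∀ n : ℕ, 2 * ℓ + 1 ≤ n →
      QuadVar.IsEstimate φ n ℓ b M (fun t => X t ω) (est n ω)) :
    ∀ᵐ ω ∂P, Tendsto (fun n => est n ω) atTop (𝓝 ν) := by
  open QuadVar in
  have hM : 0 < M := hν.trans_le hνM
  have hνℓ : ν < ℓ := hνM.trans_lt hMℓ
  have hℓ1 : 1 ≤ ℓ := by
    have : (0 : ℝ) < ℓ := hν.trans hνℓ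
    exact_mod_cast this
  obtain ⟨D, hD0, hdiag⟩ := exists_eventually_abs_nablaCov_self_sub_le hφ hν hνℓ
    (hb ν ⟨hν, hνM⟩) hK
  -- Variances are nonnegative, which determines the sign of the leading constant.
  have hD : 0 < D := by
    obtain ⟨n, hn, hnℓ⟩ := ((hdiag (1 / 2) (by norm_num)).and
      (eventually_ge_atTop (2 * ℓ + 1))).exists
    have hmem : 1 ∈ Finset.Icc 1 (n - 1 * ℓ) := by rw [Finset.mem_Icc]; omega
    have h := (abs_le.mp (hn 1 (by simp) 1 hmem)).2
    have hs : 0 < step φ n 1 := hφ.step_pos le_rfl (by omega)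
    have h0 := hX.nablaCov_self_nonneg φ n 1 ℓ 1
    by_contra hneg
    rw [abs_of_neg (lt_of_le_of_ne (not_lt.mp hneg) hD0), Nat.cast_one, Real.one_rpow, one_mul,
      one_mul, mul_neg] at h
    have h2 : step φ n 1 ^ (2 * ν - 2 * ℓ) * D < 0 :=
      mul_neg_of_pos_of_neg (by positivity) (lt_of_le_of_ne (not_lt.mp hneg) hD0)
    linarith
  rw [abs_of_pos hD] at hdiag
  have hoff := exists_abs_nablaCov_le hφ hℓ1 hνℓ hsmooth hbound
  have hratio : Tendsto (fun n : ℕ =>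
      (∑ i ∈ Finset.Icc 1 (n - 2 * ℓ), nablaCov φ n 2 ℓ Kt i i) /
        ∑ i ∈ Finset.Icc 1 (n - 1 * ℓ), nablaCov φ n 1 ℓ Kt i i) atTop
      (𝓝 ((2 : ℝ) ^ (2 * ν - 2 * ℓ))) := by
    rw [Metric.tendsto_nhds]
    intro ε hε
    obtain ⟨η, hη, h⟩ := hφ.eventually_abs_sum_div_sum_sub_le hℓ1 hMℓ (half_pos hε)
    filter_upwards [h, hdiag η hη] with n h1 h2
    rw [Real.dist_eq]
    exact (h1 ν ⟨hν, hνM⟩ D (fun θ i => nablaCov φ n θ ℓ Kt i i) hD h2).trans_lt (by linarith)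
  have hrow : ∀ θ ∈ ({1, 2} : Set ℕ), ∀ᵐ ω ∂P, Tendsto (fun n =>
      V φ n θ ℓ (fun t => X t ω) / ∑ i ∈ Finset.Icc 1 (n - θ * ℓ), nablaCov φ n θ ℓ Kt i i)
      atTop (𝓝 1) := fun θ hθ =>
    hX.ae_tendsto_V_div hφ (by rcases hθ with rfl | rfl <;> norm_num) hℓ1
      (exists_rowSum_bound hφ hℓ1 hνℓ hoff hD hdiag (fun n θ => hX.nablaCov_comm φ n θ ℓ)
        (fun n θ => hX.abs_nablaCov_le φ n θ ℓ) hθ)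
  filter_upwards [hest, hrow 1 (by simp), hrow 2 (by simp)] with ω hω h1 h2
  refine tendsto_of_isEstimate ⟨hν.le, hνM⟩
    (fun ε hε => eventually_abs_F_sub_le hφ hℓ1 hM hMℓ hb hε) ?_
    ((eventually_ge_atTop (2 * ℓ + 1)).mono hω)
  have h := (h2.div h1 one_ne_zero).mul hratio
  rw [div_one, one_mul ((2 : ℝ) ^ _)] at h
  have hpos : (0 : ℝ) < (2 : ℝ) ^ (2 * ν - 2 * ℓ) := by positivity
  refine h.congr' ?_
  filter_upwards [hratio.eventually_ne hpos.ne'] with n hn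
  have hT2 := (div_ne_zero_iff.mp hn).1
  have hT1 := (div_ne_zero_iff.mp hn).2
  rw [Pi.div_apply, div_div_div_comm, div_mul_cancel₀ _ hn]
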